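/- Theorem 1.1. Let $G$ be a finite connected graph with at least one edge (loops and multiple edges are allowed; a loop contributes $2$ to the degree of its vertex) in which every vertex has degree at least $3$. Let $V$ and $E$ be its sets of vertices and edges, let $\beta(G)=|E|-|V|+1$ be its Betti number, and let $d:E\to\mathbb R_{>0}$ be an assignment of lengths to the edges. Then there exist a real number $t>0$, a closed (compact, connected, oriented, without boundary) hyperbolic surface $S$ of genus $$g=|E|+\beta(G),$$ and an essential isometric embedding $\Phi:(G,t\,d)\to S$. Here $(G,t\,d)$ is the graph $G$ realized as a topological space in which each edge $e$ is an interval of length $t\,d(e)$. That $\Phi$ is an isometric embedding means that it is a topological embedding which maps each edge $e$, by arc length, onto a geodesic segment of length $t\,d(e)$. That it is essential means that every connected component of $S\setminus\Phi(G)$ has negative Euler characteristic. -/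

import Mathlib

open Set Topology

universe u

/-! ### Finite graphs (loops and multiple edges are allowed) -/

/-- A finite graph: a finite non-empty set of directed edges, a fixed-point free involution
that reverses the direction, and an equivalence relation on directed edges ("emanate from the
same vertex"), whose classes are the vertices. -/
structure FiniteGraph where
  /-- The directed edges. -/
  Dart : Type u
  finite_dart : Finite Dart
  nonempty_dart : Nonempty Dart
  /-- Reversal of directed edges. -/
  rev : Dart → Dart
  rev_rev : ∀ e, rev (rev e) = e
  rev_ne : ∀ e, rev e ≠ e
  /-- Two directed edges are related when they emanate from the same vertex. -/
  sameSource : Setoid Dart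

namespace FiniteGraph

/-- The vertices: classes of directed edges with the same initial vertex. -/
def Vertex (G : FiniteGraph.{u}) : Type u := Quotient G.sameSource

/-- The relation identifying a directed edge with its reverse. -/
def edgeSetoid (G : FiniteGraph.{u}) : Setoid G.Dart where
  r e e' := e' = e ∨ e' = G.rev e
  iseqv :=
    { refl := fun _ => Or.inl rfl
      symm := by
        rintro e e' (h | h)
        · exact Or.inl h.symm
        · exact Or.inr (by rw [h, G.rev_rev])
      trans := by
        rintro a b c (h | h) (h' | h')
        · exact Or.inl (by rw [h', h])
        · exact Or.inr (by rw [h', h])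
        · exact Or.inr (by rw [h', h])
        · exact Or.inl (by rw [h', h, G.rev_rev]) }

/-- The undirected edges. -/
def Edge (G : FiniteGraph.{u}) : Type u := Quotient G.edgeSetoid

/-- The undirected edge underlying a directed edge. -/
def edge (G : FiniteGraph.{u}) (e : G.Dart) : G.Edge := Quotient.mk G.edgeSetoid e

/-- The initial vertex of a directed edge. -/
def source (G : FiniteGraph.{u}) (e : G.Dart) : G.Vertex := Quotient.mk G.sameSource e

/-- The degree of a vertex: the number of directed edges emanating from it
(so a loop contributes two). -/
noncomputable def degree (G : FiniteGraph.{u}) (v : G.Vertex) : ℕ :=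
  Nat.card {e : G.Dart // G.source e = v}

/-- Any two vertices are joined by an edge path. -/
def Connected (G : FiniteGraph.{u}) : Prop :=
  ∀ v w : G.Vertex, Relation.ReflTransGen
    (fun a b => ∃ e : G.Dart, G.source e = a ∧ G.source (G.rev e) = b) v w

/-- The Betti number `|E| - |V| + 1` (of a connected graph). -/
noncomputable def betti (G : FiniteGraph.{u}) : ℤ :=
  (Nat.card G.Edge : ℤ) - (Nat.card G.Vertex : ℤ) + 1

/-- The identifications that define the realization: the point at distance `s` from the origin
of `e` is the point at distance `d e - s` from the origin of the reverse of `e`, and directed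
edges emanating from the same vertex have the same origin. -/
inductive Glue (G : FiniteGraph.{u}) (d : G.Edge → ℝ) :
    (Σ e : G.Dart, Icc (0 : ℝ) (d (G.edge e))) →
    (Σ e : G.Dart, Icc (0 : ℝ) (d (G.edge e))) → Prop
  | flip (e : G.Dart) (s : Icc (0 : ℝ) (d (G.edge e)))
      (s' : Icc (0 : ℝ) (d (G.edge (G.rev e)))) (h : (s : ℝ) + s' = d (G.edge e)) :
      Glue G d ⟨e, s⟩ ⟨G.rev e, s'⟩
  | vertex (e e' : G.Dart) (s : Icc (0 : ℝ) (d (G.edge e)))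
      (s' : Icc (0 : ℝ) (d (G.edge e'))) (h : G.source e = G.source e')
      (hs : (s : ℝ) = 0) (hs' : (s' : ℝ) = 0) :
      Glue G d ⟨e, s⟩ ⟨e', s'⟩

/-- The metric graph `(G, d)` as a topological space: the intervals `[0, d e]`, glued. -/
def Realization (G : FiniteGraph.{u}) (d : G.Edge → ℝ) : Type u := Quot (G.Glue d)

instance (G : FiniteGraph.{u}) (d : G.Edge → ℝ) : TopologicalSpace (G.Realization d) :=
  inferInstanceAs (TopologicalSpace (Quot (G.Glue d)))

/-- The arc-length parametrization of a directed edge of the metric graph `(G, d)`. -/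
def edgePath (G : FiniteGraph.{u}) (d : G.Edge → ℝ) (e : G.Dart)
    (s : Icc (0 : ℝ) (d (G.edge e))) : G.Realization d :=
  Quot.mk (G.Glue d) ⟨e, s⟩

end FiniteGraph

/-! ### Closed hyperbolic surfaces -/

open scoped UpperHalfPlane MatrixGroups

/-- Self-maps of the hyperbolic plane that are locally orientation-preserving isometries,
that is, locally given by the action of `SL(2, ℝ)`. -/
noncomputable def hyperbolicPregroupoid : Pregroupoid ℍ where
  property f s := ∀ x ∈ s, ∃ g : SL(2, ℝ), ∀ᶠ y in 𝓝 x, f y = g • y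
  comp := by
    intro f f' s s' hf hf' _ _ _ x hx
    obtain ⟨g, hg⟩ := hf x hx.1
    obtain ⟨g', hg'⟩ := hf' (f x) hx.2
    have hc : ContinuousAt f x :=
      (continuous_const_smul g).continuousAt.congr (hg.mono fun _ h => h.symm)
    refine ⟨g' * g, ?_⟩
    filter_upwards [hg, hc.eventually hg'] with y h1 h2
    rw [Function.comp_apply, h2, h1, mul_smul]
  id_mem := fun x _ => ⟨1, by simp⟩
  locality := by
    intro f s _ h x hx
    obtain ⟨v, _, hxv, hf⟩ := h x hx
    exact hf x ⟨hx, hxv⟩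
  congr := by
    intro f f' s hs h hf x hx
    obtain ⟨g, hg⟩ := hf x hx
    refine ⟨g, ?_⟩
    filter_upwards [hg, hs.mem_nhds hx] with y h1 h2
    rw [h y h2, h1]

/-- The structure groupoid of local orientation-preserving isometries of the hyperbolic plane. -/
noncomputable def hyperbolicGroupoid : StructureGroupoid ℍ := hyperbolicPregroupoid.groupoid

/-- A closed (oriented, connected) hyperbolic surface: a compact connected Hausdorff space with
an atlas of charts in the hyperbolic plane whose coordinate changes are locally
orientation-preserving isometries. -/
class ClosedHyperbolicSurface (S : Type u) [TopologicalSpace S] [ChartedSpace ℍ S] : Prop where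
  t2 : T2Space S
  compact : CompactSpace S
  connected : ConnectedSpace S
  hasGroupoid : HasGroupoid S hyperbolicGroupoid

/-- A geodesic segment of length `L` (parametrized by arc length) on a hyperbolic surface: read
in charts, the path locally preserves distances. -/
def IsGeodesicSegment {S : Type u} [TopologicalSpace S] [ChartedSpace ℍ S] {L : ℝ}
    (γ : Icc (0 : ℝ) L → S) : Prop :=
  ∀ s, ∃ φ ∈ atlas ℍ S, ∃ U ∈ 𝓝 s, (∀ a ∈ U, γ a ∈ φ.source) ∧
    ∀ a ∈ U, ∀ b ∈ U, dist (φ (γ a)) (φ (γ b)) = dist a b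

/-! ### Euler characteristic and genus -/

/-- `X` has the homotopy type of a finite CW complex, and its Euler characteristic, the
alternating sum of the numbers of cells of such a complex, is `n`. -/
def HasEulerChar (X : Type u) [TopologicalSpace X] (n : ℤ) : Prop :=
  ∃ (Y : Type u) (_ : TopologicalSpace Y) (_ : T2Space Y) (_ : CWComplex (univ : Set Y)),
    RelCWComplex.Finite (univ : Set Y) ∧ Nonempty (ContinuousMap.HomotopyEquiv X Y) ∧
    ∑ᶠ k : ℕ, (-1 : ℤ) ^ k * (Nat.card (RelCWComplex.cell (univ : Set Y) k) : ℤ) = n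

/-- A closed connected oriented surface has genus `g` when its Euler characteristic
is `2 - 2 g`. -/
def HasGenus (S : Type u) [TopologicalSpace S] (g : ℕ) : Prop :=
  HasEulerChar S (2 - 2 * (g : ℤ))

/-! ### Essential isometric embeddings -/

/-- `Φ` embeds the metric graph `(G, d)` isometrically: it is a topological embedding, and each
edge `e` is mapped by arc length onto a geodesic segment of length `d e`. -/
structure IsIsometricEmbedding (G : FiniteGraph.{u}) (d : G.Edge → ℝ) {S : Type*}
    [TopologicalSpace S] [ChartedSpace ℍ S] (Φ : G.Realization d → S) : Prop where
  isEmbedding : IsEmbedding Φ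
  isGeodesicSegment : ∀ e : G.Dart, IsGeodesicSegment (fun s => Φ (G.edgePath d e s))

/-- A subset of a surface is essential when every connected component of its complement has
negative Euler characteristic. -/
def IsEssential {S : Type u} [TopologicalSpace S] (A : Set S) : Prop :=
  ∀ x ∈ Aᶜ, ∃ n : ℤ, n < 0 ∧ HasEulerChar (connectedComponentIn Aᶜ x) n

/-! The surface is assembled from hyperbolic pentagons ("tiles") with four right angles and one
angle `π / n`, where `n` is the degree of a vertex of the graph. Each directed edge `e` contributes
four tiles: one on either side of its first half, on a front sheet and on a back sheet. In the upper
half plane, side 0 of a tile is the leg, running up the imaginary axis from the vertex `m * I` to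
the midpoint of the edge. Side 1 lies on `|z|² = E` and meets the leg at the midpoint. Side 3 lies
on a fixed circle, side 2 on the common perpendicular of sides 1 and 3, and side 4 (the spoke) on
the perpendicular to side 3 through `m * I`. Tiles are glued by reflection: across sides 0 and 2 to
the tile on the other side of `e`, across 1 to the reversed edge, across 3 to the other sheet,
across 4 to a neighbouring directed edge at the vertex. In each sheet `2n` angles `π / n` close up
around a vertex, and four right angles close up at every other corner, so the result is a closed
hyperbolic surface. It is oriented because every crossing flips the sign `sgn`.

In one sheet the tiles around a vertex of degree `n` form a sphere with `n + 1` holes, one for each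
directed edge there and one bounded by sides 3. Hence the Euler characteristic of the surface is `2
Σ (1 - n) = 2|V| - 4|E|`, which means genus `|E| + β`. The legs of the front sheet form a copy of
the graph in which an edge has length `log E - log m - log m'`. The degree determines `m`, while `E`
may be any large number, so all lengths `t * d e` occur once `t` is large. Every tile can be reached
from every other without crossing a leg, so the complement of the graph is connected. It retracts
onto the back sheet together with sides 2 and 3 of the front tiles and has Euler characteristic `|V|
- 3|E|`, negative because `|V| ≤ 2|E|`.

The computations use the coordinates `(Re z, |z|²)`, in which geodesics are straight, tiles are
convex polygons and reflections act linearly up to scale. A point of the surface has the same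
coordinates in every tile that contains it, so gluing means identifying equal coordinates. The proof
rests on `exists_chart` with `exists_chart_of_perp` and `exists_chart_of_vertex` (charts),
`charts_compatible` (atlas), `hasEulerChar_part` (cell count), `goal_cross` (the retraction is well
defined), `isIsometricEmbedding_embed` and `exists_tileSystem` (choice of parameters). -/

namespace UpperHalfPlane

/-! ### Isometries, projective coordinates and reflections of the hyperbolic plane -/

open Matrix Complex

/-- An element of `GL(2, ℝ)` of positive determinant acts as an element of `SL(2, ℝ)`. -/
lemma exists_SL2_smul_eq (g : GL (Fin 2) ℝ) (hg : 0 < g.det.val) :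
    ∃ h : SL(2, ℝ), ∀ z : ℍ, g • z = h • z := by
  have hd : 0 < g 0 0 * g 1 1 - g 0 1 * g 1 0 := by
    have := hg
    rwa [GeneralLinearGroup.val_det_apply, Matrix.det_fin_two] at this
  set r := Real.sqrt (g 0 0 * g 1 1 - g 0 1 * g 1 0) with hr
  have hr0 : 0 < r := Real.sqrt_pos.2 hd
  have hrr : r * r = g 0 0 * g 1 1 - g 0 1 * g 1 0 := Real.mul_self_sqrt hd.le
  have hdet : Matrix.det !![g 0 0 / r, g 0 1 / r; g 1 0 / r, g 1 1 / r] = 1 := by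
    rw [Matrix.det_fin_two_of]
    field_simp
    nlinarith
  let h : SL(2, ℝ) := ⟨!![g 0 0 / r, g 0 1 / r; g 1 0 / r, g 1 1 / r], hdet⟩
  refine ⟨h, fun z => ?_⟩
  · ext1
    refine (coe_smul_of_det_pos hg z).trans (Eq.trans ?_ (coe_specialLinearGroup_apply h z).symm)
    have hrc : (r : ℂ) ≠ 0 := by exact_mod_cast hr0.ne'
    have h00 : h 0 0 = g 0 0 / r := rfl
    have h01 : h 0 1 = g 0 1 / r := rfl
    have h10 : h 1 0 = g 1 0 / r := rfl
    have h11 : h 1 1 = g 1 1 / r := rfl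
    rw [h00, h01, h10, h11]
    simp only [num, denom, Algebra.algebraMap_self, RingHom.id_apply, Complex.ofReal_div]
    rw [div_mul_eq_mul_div, div_mul_eq_mul_div, ← add_div, ← add_div, div_div_div_cancel_right₀ hrc]

lemma dist_J_smul (z w : ℍ) : dist (J • z) (J • w) = dist z w := by
  have him : ∀ z : ℍ, (J • z).im = z.im := fun z => by
    have := congrArg Complex.im (coe_J_smul z)
    simpa using this
  rw [dist_eq, dist_eq, him, him, coe_J_smul, coe_J_smul, dist_neg_neg, Complex.dist_conj_conj]

/-- `GL(2, ℝ)` acts on the hyperbolic plane by isometries. -/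
lemma dist_gl_smul (g : GL (Fin 2) ℝ) (z w : ℍ) : dist (g • z) (g • w) = dist z w := by
  rcases lt_or_gt_of_ne g.det.ne_zero with h | h
  · have hp : 0 < (J * g).det.val := by
      rw [map_mul, det_J]
      simpa using h
    obtain ⟨k, hk⟩ := exists_SL2_smul_eq _ hp
    rw [← dist_J_smul, ← mul_smul, ← mul_smul, hk, hk, dist_smul]
  · obtain ⟨k, hk⟩ := exists_SL2_smul_eq g h
    rw [hk, hk, dist_smul]

/-- The projective model: geodesics are straight in the coordinates `(Re z, |z|²)`. -/
noncomputable def klein (z : ℍ) : Fin 2 → ℝ := ![z.re, Complex.normSq z]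

@[simp] lemma klein_zero (z : ℍ) : klein z 0 = z.re := rfl

@[simp] lemma klein_one (z : ℍ) : klein z 1 = z.re ^ 2 + z.im ^ 2 := by
  simp [klein, Complex.normSq_apply, sq]

lemma continuous_klein : Continuous klein := by
  refine continuous_pi fun i => ?_
  fin_cases i
  · exact continuous_re
  · exact Complex.continuous_normSq.comp continuous_coe

/-- The inverse of the projective model. -/
noncomputable def unklein (p : Fin 2 → ℝ) : ℍ :=
  if h : 0 < p 1 - p 0 ^ 2 then ⟨⟨p 0, Real.sqrt (p 1 - p 0 ^ 2)⟩, Real.sqrt_pos.2 h⟩ else I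

lemma unklein_klein (z : ℍ) : unklein (klein z) = z := by
  have h : klein z 1 - klein z 0 ^ 2 = z.im ^ 2 := by simp
  have h0 : 0 < klein z 1 - klein z 0 ^ 2 := by rw [h]; exact pow_pos z.im_pos 2
  rw [unklein, dif_pos h0]
  refine ext_re_im rfl ?_
  change Real.sqrt _ = _
  rw [h, Real.sqrt_sq z.im_pos.le]

lemma klein_unklein {p : Fin 2 → ℝ} (h : p 0 ^ 2 < p 1) : klein (unklein p) = p := by
  have h0 : 0 < p 1 - p 0 ^ 2 := sub_pos.2 h
  rw [unklein, dif_pos h0]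
  ext i
  fin_cases i
  · rfl
  · change klein _ 1 = p 1
    rw [klein_one]
    change p 0 ^ 2 + Real.sqrt _ ^ 2 = _
    rw [Real.sq_sqrt h0.le]
    ring

lemma continuousOn_unklein : ContinuousOn unklein {p | p 0 ^ 2 < p 1} := by
  rw [isEmbedding_coe.continuousOn_iff]
  have h1 : Continuous fun p : Fin 2 → ℝ => (⟨p 0, Real.sqrt (p 1 - p 0 ^ 2)⟩ : ℂ) := by
    have : (fun p : Fin 2 → ℝ => (⟨p 0, Real.sqrt (p 1 - p 0 ^ 2)⟩ : ℂ)) =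
        fun p => ((p 0 : ℝ) : ℂ) + (Real.sqrt (p 1 - p 0 ^ 2) : ℝ) * Complex.I := by
      ext p
      exact Complex.mk_eq_add_mul_I _ _
    rw [this]
    fun_prop
  refine h1.continuousOn.congr fun p hp => ?_
  have h0 : 0 < p 1 - p 0 ^ 2 := sub_pos.2 hp
  simp only [Function.comp_apply]
  rw [unklein, dif_pos h0]

/-- The linear form with coefficients `l` in the coordinates of the projective model. -/
noncomputable def lineForm (l : ℝ × ℝ × ℝ) (p : Fin 2 → ℝ) : ℝ := l.1 * p 1 + l.2.1 * p 0 + l.2.2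

lemma continuous_lineForm (l : ℝ × ℝ × ℝ) : Continuous (lineForm l) := by
  unfold lineForm
  fun_prop

/-- The discriminant of a linear form, positive when it vanishes on a geodesic. -/
noncomputable def lineDisc (l : ℝ × ℝ × ℝ) : ℝ := l.2.1 ^ 2 / 4 - l.1 * l.2.2

/-- The polar form of the discriminant (up to a factor), zero for perpendicular geodesics. -/
noncomputable def linePairing (l l' : ℝ × ℝ × ℝ) : ℝ := l.1 * l'.2.2 + l'.1 * l.2.2 - l.2.1 * l'.2.1 / 2

/-- The reflection of the hyperbolic plane in the geodesic where a linear form vanishes. -/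
noncomputable def mirror (l : ℝ × ℝ × ℝ) : GL (Fin 2) ℝ :=
  if h : 0 < lineDisc l then
    .mkOfDetNeZero !![-(l.2.1 / 2), -l.2.2; l.1, l.2.1 / 2] (by
      rw [Matrix.det_fin_two_of]
      have h' := h
      unfold lineDisc at h'
      intro h0
      nlinarith)
  else 1

lemma det_mirror {l : ℝ × ℝ × ℝ} (h : 0 < lineDisc l) : (mirror l).det.val < 0 := by
  rw [mirror, dif_pos h, GeneralLinearGroup.val_det_apply]
  change Matrix.det !![-(l.2.1 / 2), -l.2.2; l.1, l.2.1 / 2] < 0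
  rw [Matrix.det_fin_two_of]
  unfold lineDisc at h
  nlinarith

/-- A matrix of negative determinant acts through the conjugate of `z`; this is how elements of
`GL(2, ℝ)` come to include the reflections. -/
lemma coe_mirror_smul {l : ℝ × ℝ × ℝ} (h : 0 < lineDisc l) (z : ℍ) :
    ((mirror l • z : ℍ) : ℂ) = (-(l.2.1 / 2 : ℝ) * (starRingEnd ℂ) z - (l.2.2 : ℝ)) /
      ((l.1 : ℝ) * (starRingEnd ℂ) z + (l.2.1 / 2 : ℝ)) := by
  have hd := det_mirror h
  rw [coe_smul, σ, if_neg (not_lt.2 hd.le), mirror, dif_pos h]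
  simp [num, denom, -Complex.ofReal_div, sub_eq_add_neg]

/-- Up to a positive factor that depends on `z` alone, a reflection is the usual linear reflection
on the space of forms, with respect to the polar form of the discriminant. All later facts about
mirrors follow by inserting suitable `l'`. -/
lemma lineForm_mirror_smul {l : ℝ × ℝ × ℝ} (h : 0 < lineDisc l) (z : ℍ) :
    ∃ c : ℝ, 0 < c ∧ ∀ l', lineForm l' (klein (mirror l • z)) * c =
      lineDisc l * lineForm l' (klein z) + linePairing l l' * lineForm l (klein z) := by
  set x := z.re with hx
  set y := z.im with hy
  have hy0 : 0 < y := z.im_pos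
  have hz : (starRingEnd ℂ) (z : ℂ) = ⟨x, -y⟩ := rfl
  set a := l.1 with ha
  set b := l.2.1 / 2 with hb
  set c := l.2.2 with hc
  have hdisc : lineDisc l = b ^ 2 - a * c := by rw [lineDisc, hb]; ring
  -- The factor is the squared modulus of the denominator `a * conj z + b` of the reflection.
  set q : ℝ := (a * x + b) ^ 2 + (a * y) ^ 2 with hq
  have hq0 : 0 < q := by
    rw [hdisc] at h
    by_contra hcon
    have h1 : a * y = 0 := by nlinarith [sq_nonneg (a * x + b), sq_nonneg (a * y)]
    have h2 : a = 0 := by simpa [hy0.ne'] using h1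
    rw [h2] at h hq
    nlinarith
  have hden : ((a : ℝ) : ℂ) * (starRingEnd ℂ) z + (b : ℝ) ≠ 0 := by
    rw [hz]
    intro h0
    have h1 := congrArg Complex.re h0
    have h2 := congrArg Complex.im h0
    simp at h1 h2
    rcases h2 with h2 | h2
    · rw [h2] at hq h1
      simp at h1
      rw [h1] at hq
      simp at hq
      exact hq0.ne' hq
    · exact hy0.ne' h2
  have hcoe := coe_mirror_smul h z
  rw [← ha, ← hb, ← hc, eq_div_iff hden, hz] at hcoe
  set X := (mirror l • z).re
  set Y := (mirror l • z).im
  have e1 := congrArg Complex.re hcoe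
  have e2 := congrArg Complex.im hcoe
  simp at e1 e2
  change X * (a * x + b) + Y * (a * y) = -(b * x) - c at e1
  change -(X * (a * y)) + Y * (a * x + b) = b * y at e2
  have eX : X * q = (a * x + b) * (-(b * x) - c) - a * b * y ^ 2 := by
    rw [hq]; linear_combination (a * x + b) * e1 - (a * y) * e2
  have eY : Y * q = b * y * (a * x + b) + a * y * (-(b * x) - c) := by
    rw [hq]; linear_combination (a * y) * e1 + (a * x + b) * e2
  have eN : (X ^ 2 + Y ^ 2) * q = (b * x + c) ^ 2 + b ^ 2 * y ^ 2 := by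
    apply mul_right_cancel₀ hq0.ne'
    have : (X ^ 2 + Y ^ 2) * q * q = (X * q) ^ 2 + (Y * q) ^ 2 := by ring
    rw [this, eX, eY, hq]
    ring
  refine ⟨q, hq0, fun l' => ?_⟩
  rw [hdisc, lineForm, lineForm, lineForm, linePairing, klein_zero, klein_one, klein_zero,
    klein_one, ← ha, ← hc]
  have hb2 : l.2.1 = 2 * b := by rw [hb]; ring
  rw [hb2]
  have : (l'.1 * (X ^ 2 + Y ^ 2) + l'.2.1 * X + l'.2.2) * q =
    l'.1 * ((X ^ 2 + Y ^ 2) * q) + l'.2.1 * (X * q) + l'.2.2 * q := by ring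
  rw [this, eN, eX, hq]
  ring

lemma lineForm_mirror_self {l : ℝ × ℝ × ℝ} (h : 0 < lineDisc l) (z : ℍ) :
    ∃ c : ℝ, 0 < c ∧ lineForm l (klein (mirror l • z)) = -(c * lineForm l (klein z)) := by
  obtain ⟨c, hc, H⟩ := lineForm_mirror_smul h z
  refine ⟨lineDisc l / c, div_pos h hc, ?_⟩
  have h1 := H l
  have h2 : linePairing l l = -(2 * lineDisc l) := by rw [linePairing, lineDisc]; ring
  rw [h2] at h1
  field_simp
  linarith

lemma lineForm_mirror_perp {l l' : ℝ × ℝ × ℝ} (h : 0 < lineDisc l) (hp : linePairing l l' = 0)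
    (z : ℍ) :
    ∃ c : ℝ, 0 < c ∧ lineForm l' (klein (mirror l • z)) = c * lineForm l' (klein z) := by
  obtain ⟨c, hc, H⟩ := lineForm_mirror_smul h z
  refine ⟨lineDisc l / c, div_pos h hc, ?_⟩
  have h1 := H l'
  rw [hp] at h1
  field_simp
  linarith

lemma mirror_smul_of_lineForm_eq_zero {l : ℝ × ℝ × ℝ} (h : 0 < lineDisc l) {z : ℍ}
    (hz : lineForm l (klein z) = 0) : mirror l • z = z := by
  obtain ⟨c, hc, H⟩ := lineForm_mirror_smul h z
  rw [← unklein_klein (mirror l • z)]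
  refine Eq.trans ?_ (unklein_klein z)
  -- The constant form `(0, 0, 1)` determines the factor; the forms `(0, 1, 0)` and `(1, 0, 0)` then
  -- read off the two coordinates.
  have h1 : lineDisc l = c := by
    have := H (0, 0, 1)
    rw [hz] at this
    simpa [lineForm] using this.symm
  have hX := H (0, 1, 0)
  have hN := H (1, 0, 0)
  rw [hz] at hX hN
  simp only [mul_zero, add_zero, h1, lineForm, zero_mul, zero_add, one_mul] at hX hN
  refine congrArg unklein (funext fun i => ?_)
  fin_cases i
  · exact mul_right_cancel₀ hc.ne' (hX.trans (mul_comm _ _))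
  · exact mul_right_cancel₀ hc.ne' (hN.trans (mul_comm _ _))

lemma mirror_mirror_smul {l : ℝ × ℝ × ℝ} (h : 0 < lineDisc l) (z : ℍ) :
    mirror l • mirror l • z = z := by
  obtain ⟨c, hc, H⟩ := lineForm_mirror_smul h z
  obtain ⟨c', hc', H'⟩ := lineForm_mirror_smul h (mirror l • z)
  have hl : linePairing l l = -(2 * lineDisc l) := by rw [linePairing, lineDisc]; ring
  have key : ∀ l', lineForm l' (klein (mirror l • mirror l • z)) * (c' * c) =
      lineDisc l ^ 2 * lineForm l' (klein z) := fun l' => by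
    have h1 := H' l'
    have h2 := H l'
    have h3 := H l
    rw [hl] at h3
    linear_combination c * h1 + lineDisc l * h2 + linePairing l l' * h3
  have h1 : c' * c = lineDisc l ^ 2 := by
    have := key (0, 0, 1)
    simpa [lineForm] using this
  have hX := key (0, 1, 0)
  have hN := key (1, 0, 0)
  simp only [h1, lineForm, zero_mul, zero_add, add_zero, one_mul] at hX hN
  have h0 : lineDisc l ^ 2 ≠ 0 := (pow_pos h 2).ne'
  rw [← unklein_klein (mirror l • mirror l • z)]
  conv_rhs => rw [← unklein_klein z]
  refine congrArg unklein (funext fun i => ?_)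
  fin_cases i
  · exact mul_right_cancel₀ h0 (hX.trans (mul_comm _ _))
  · exact mul_right_cancel₀ h0 (hN.trans (mul_comm _ _))

end UpperHalfPlane

/-! ### Geometry of the pentagonal tile -/

namespace UpperHalfPlane

/-- The five sides of the tile with parameters `E` and `M`. -/
noncomputable def side (E M : ℝ) : Fin 5 → ℝ × ℝ × ℝ :=
  -- Side 3 is the fixed circle `|z|² - 4 Re z + 1 = 0`. Orthogonality to sides 1 and 3 determines
  -- side 2; orthogonality to side 3 and passage through the point of height `√M` on the imaginary
  -- axis determine side 4. The signs make every form nonnegative on the tile.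
  ![(0, 1, 0), (-1, 0, E), (1, -((1 + E) / 2), E), (1, -4, 1), (1, -((1 - M) / 2), -M)]

/-- The tile with parameters `E` and `M`, in the projective model. -/
def pentagon (E M : ℝ) : Set (Fin 2 → ℝ) := {p | ∀ k, 0 ≤ lineForm (side E M k) p}

lemma side_form (E M : ℝ) (p : Fin 2 → ℝ) :
    lineForm (side E M 0) p = p 0 ∧ lineForm (side E M 1) p = E - p 1 ∧
    lineForm (side E M 2) p = p 1 + E - (1 + E) / 2 * p 0 ∧
    lineForm (side E M 3) p = p 1 + 1 - 4 * p 0 ∧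
    lineForm (side E M 4) p = p 1 - M - (1 - M) / 2 * p 0 := by
  simp only [side, lineForm, Matrix.cons_val]
  refine ⟨?_, ?_, ?_, ?_, ?_⟩ <;> ring

lemma fin_five_ne (k : Fin 5) : k + 4 ≠ k ∧ k + 4 ≠ k + 1 ∧ k + 1 ≠ k + 4 + 1 ∧ k + 4 + 1 = k ∧
    k + 1 ≠ k + 1 + 1 := by
  revert k
  decide

lemma forall_fin_five {P : Fin 5 → Prop} : (∀ k, P k) ↔ P 0 ∧ P 1 ∧ P 2 ∧ P 3 ∧ P 4 := by
  constructor
  · exact fun h => ⟨h 0, h 1, h 2, h 3, h 4⟩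
  · rintro ⟨h0, h1, h2, h3, h4⟩ k
    fin_cases k <;> assumption

lemma mem_pentagon_iff {E M : ℝ} {p : Fin 2 → ℝ} : p ∈ pentagon E M ↔
    0 ≤ p 0 ∧ p 1 ≤ E ∧ (1 + E) / 2 * p 0 ≤ p 1 + E ∧ 4 * p 0 ≤ p 1 + 1 ∧
      M + (1 - M) / 2 * p 0 ≤ p 1 := by
  obtain ⟨h0, h1, h2, h3, h4⟩ := side_form E M p
  change (∀ k, 0 ≤ lineForm (side E M k) p) ↔ _
  rw [forall_fin_five, h0, h1, h2, h3, h4]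
  constructor <;> rintro ⟨_, _, _, _, _⟩ <;> refine ⟨?_, ?_, ?_, ?_, ?_⟩ <;> linarith

lemma isClosed_pentagon (E M : ℝ) : IsClosed (pentagon E M) := by
  have : pentagon E M = ⋂ k, {p | 0 ≤ lineForm (side E M k) p} := by ext; simp [pentagon]
  rw [this]
  exact isClosed_iInter fun k => isClosed_le continuous_const (continuous_lineForm _)

lemma lineForm_combo (l : ℝ × ℝ × ℝ) (p q : Fin 2 → ℝ) {a b : ℝ} (hab : a + b = 1) :
    lineForm l (a • p + b • q) = a * lineForm l p + b * lineForm l q := by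
  simp only [lineForm, Pi.add_apply, Pi.smul_apply, smul_eq_mul]
  linear_combination -l.2.2 * hab

lemma convex_pentagon (E M : ℝ) : Convex ℝ (pentagon E M) := by
  intro p hp q hq a b ha hb hab k
  rw [lineForm_combo _ _ _ hab]
  exact add_nonneg (mul_nonneg ha (hp k)) (mul_nonneg hb (hq k))

/-- The corner where sides `k` and `k + 1` meet. -/
noncomputable def corner (E M : ℝ) : Fin 5 → Fin 2 → ℝ :=
  ![![0, E], ![4 * E / (1 + E), E], ![2 * (E - 1) / (E - 7), 4 * (2 * (E - 1) / (E - 7)) - 1],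
    ![2 * (1 + M) / (7 + M), 4 * (2 * (1 + M) / (7 + M)) - 1], ![0, M]]

section
variable {E M : ℝ} (hE : 100 ≤ E) (hM : 0 < M) (hM1 : M < 1)
include hE hM hM1

lemma side_disc_pos (k : Fin 5) : 0 < lineDisc (side E M k) := by
  fin_cases k <;> simp only [side, lineDisc, Fin.mk_zero, Fin.mk_one, Fin.reduceFinMk,
    Matrix.cons_val] <;> nlinarith

omit hE hM hM1 in
-- The exception `k = 4` is the corner of sides 4 and 0, which sits at a vertex of the graph and has
-- angle `π / n`.
lemma side_perp (k : Fin 5) (hk : k ≠ 4) :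
    linePairing (side E M k) (side E M (k + 1)) = 0 := by
  fin_cases k <;> simp only [side, linePairing, Fin.mk_zero, Fin.mk_one, Fin.reduceFinMk,
    Matrix.cons_val, Fin.reduceAdd, zero_add] <;> first | ring1 | exact absurd rfl hk

/-- The last inequality says that the tile lies inside the hyperbolic plane, the region above the
parabola in these coordinates. Side 4 keeps it there for `p 0 ≤ 1/2`, side 3 in the middle range,
and side 2 for `p 0` between 3 and 4. -/
lemma pentagon_bounds {p : Fin 2 → ℝ} (hp : p ∈ pentagon E M) :
    0 ≤ p 0 ∧ p 0 < 4 ∧ M ≤ p 1 ∧ p 1 ≤ E ∧ p 0 ^ 2 < p 1 := by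
  obtain ⟨h0, h1, h2, h3, h4⟩ := mem_pentagon_iff.1 hp
  have hX : p 0 < 4 := by nlinarith
  refine ⟨h0, hX, by nlinarith, h1, ?_⟩
  rcases le_or_gt (p 0) (1 / 2) with h | h
  · nlinarith
  rcases le_or_gt (p 0) 3 with h' | h'
  · nlinarith
  · nlinarith

lemma isCompact_pentagon : IsCompact (pentagon E M) := by
  refine IsCompact.of_isClosed_subset (isCompact_Icc (a := fun _ => 0) (b := fun _ => E + 4))
    (isClosed_pentagon E M) fun p hp => ?_
  obtain ⟨h0, h1, h2, h3, -⟩ := pentagon_bounds hE hM hM1 hp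
  constructor <;> intro i <;> fin_cases i <;> simp <;> linarith

/-- Non-adjacent sides do not meet in the tile, so at most two sides pass through any of its points.
This is what bounds the kinds of points for which charts are needed. -/
lemma adjacent_of_lineForm_eq_zero {p : Fin 2 → ℝ} (hp : p ∈ pentagon E M) {j k : Fin 5}
    (hj : lineForm (side E M j) p = 0) (hk : lineForm (side E M k) p = 0) :
    j = k ∨ k = j + 1 ∨ j = k + 1 := by
  have key : ∀ {j k : Fin 5}, j < k → lineForm (side E M j) p = 0 →
      lineForm (side E M k) p = 0 → k = j + 1 ∨ j = k + 1 := by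
    intro j k hjk hj hk
    obtain ⟨f0, f1, f2, f3, f4⟩ := side_form E M p
    obtain ⟨h0, h1, h2, h3, h4⟩ := mem_pentagon_iff.1 hp
    obtain ⟨b0, b1, b2, b3, -⟩ := pentagon_bounds hE hM hM1 hp
    -- The five pairs of non-adjacent sides are excluded one at a time.
    have h02 : ¬ (p 0 = 0 ∧ p 1 + E - (1 + E) / 2 * p 0 = 0) := by rintro ⟨a, b⟩; nlinarith
    have h03 : ¬ (p 0 = 0 ∧ p 1 + 1 - 4 * p 0 = 0) := by rintro ⟨a, b⟩; nlinarith
    have h13 : ¬ (E - p 1 = 0 ∧ p 1 + 1 - 4 * p 0 = 0) := by rintro ⟨a, b⟩; nlinarith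
    have h14 : ¬ (E - p 1 = 0 ∧ p 1 - M - (1 - M) / 2 * p 0 = 0) := by rintro ⟨a, b⟩; nlinarith
    have h24 : ¬ (p 1 + E - (1 + E) / 2 * p 0 = 0 ∧ p 1 - M - (1 - M) / 2 * p 0 = 0) := by
      rintro ⟨a, b⟩
      have : 2 * (p 1 + 1) * (1 + E) ≥ 16 * (p 1 + E) := by nlinarith
      have h7 : 3 < p 1 := by nlinarith
      nlinarith
    revert hjk hj hk
    fin_cases j <;> fin_cases k <;>
      simp only [Fin.mk_zero, Fin.mk_one, Fin.reduceFinMk, f0, f1, f2, f3, f4] <;>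
      intro hjk hj hk <;>
      first
        | (left; rfl) | (right; rfl) | exact absurd hjk (by decide) | exact (h02 ⟨hj, hk⟩).elim
        | exact (h03 ⟨hj, hk⟩).elim | exact (h13 ⟨hj, hk⟩).elim | exact (h14 ⟨hj, hk⟩).elim
        | exact (h24 ⟨hj, hk⟩).elim
  rcases lt_trichotomy j k with h | h | h
  · exact Or.inr (key h hj hk)
  · exact Or.inl h
  · exact Or.inr ((key h hk hj).symm)

lemma corner_mem_and_zero (k : Fin 5) : corner E M k ∈ pentagon E M ∧
    lineForm (side E M k) (corner E M k) = 0 ∧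
    lineForm (side E M (k + 1)) (corner E M k) = 0 := by
  obtain ⟨f0, f1, f2, f3, f4⟩ := side_form E M (corner E M k)
  rw [mem_pentagon_iff]
  revert f0 f1 f2 f3 f4
  fin_cases k
  · rintro f0 f1 - - -
    refine ⟨?_, f0.trans rfl, f1.trans (sub_self E)⟩
    change 0 ≤ (0 : ℝ) ∧ E ≤ E ∧ (1 + E) / 2 * 0 ≤ E + E ∧ 4 * 0 ≤ E + 1 ∧ M + (1 - M) / 2 * 0 ≤ E
    refine ⟨?_, ?_, ?_, ?_, ?_⟩ <;> linarith
  · rintro - f1 f2 - -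
    have e : (4 * E / (1 + E)) * (1 + E) = 4 * E := by field_simp
    have p : 0 < 4 * E / (1 + E) := by positivity
    have p' : 4 * E / (1 + E) < 4 := by rw [div_lt_iff₀] <;> linarith
    refine ⟨?_, f1.trans (sub_self E), f2.trans ?_⟩
    · change 0 ≤ 4 * E / (1 + E) ∧ E ≤ E ∧ (1 + E) / 2 * (4 * E / (1 + E)) ≤ E + E ∧
        4 * (4 * E / (1 + E)) ≤ E + 1 ∧ M + (1 - M) / 2 * (4 * E / (1 + E)) ≤ E
      generalize 4 * E / (1 + E) = x at *
      have := mul_pos hM p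
      refine ⟨?_, ?_, ?_, ?_, ?_⟩ <;> linarith
    · change E + E - (1 + E) / 2 * (4 * E / (1 + E)) = 0
      linarith
  · rintro - - f2 f3 -
    have e : (2 * (E - 1) / (E - 7)) * (E - 7) = 2 * (E - 1) := by
      have : E - 7 ≠ 0 := by linarith
      field_simp
    have p : 2 < 2 * (E - 1) / (E - 7) := by rw [lt_div_iff₀] <;> linarith
    have p' : 2 * (E - 1) / (E - 7) < 3 := by rw [div_lt_iff₀] <;> linarith
    refine ⟨?_, f2.trans ?_, f3.trans ?_⟩
    · change 0 ≤ 2 * (E - 1) / (E - 7) ∧ 4 * (2 * (E - 1) / (E - 7)) - 1 ≤ E ∧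
        (1 + E) / 2 * (2 * (E - 1) / (E - 7)) ≤ 4 * (2 * (E - 1) / (E - 7)) - 1 + E ∧
        4 * (2 * (E - 1) / (E - 7)) ≤ 4 * (2 * (E - 1) / (E - 7)) - 1 + 1 ∧
        M + (1 - M) / 2 * (2 * (E - 1) / (E - 7)) ≤ 4 * (2 * (E - 1) / (E - 7)) - 1
      generalize 2 * (E - 1) / (E - 7) = x at *
      have := mul_pos hM (lt_trans zero_lt_two p)
      refine ⟨?_, ?_, ?_, ?_, ?_⟩ <;> linarith
    · change 4 * (2 * (E - 1) / (E - 7)) - 1 + E - (1 + E) / 2 * (2 * (E - 1) / (E - 7)) = 0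
      linarith
    · change 4 * (2 * (E - 1) / (E - 7)) - 1 + 1 - 4 * (2 * (E - 1) / (E - 7)) = 0
      ring
  · rintro - - - f3 f4
    have e : (2 * (1 + M) / (7 + M)) * (7 + M) = 2 * (1 + M) := by field_simp
    have p : 0 < 2 * (1 + M) / (7 + M) := by positivity
    have p' : 2 * (1 + M) / (7 + M) ≤ 1 / 2 := by rw [div_le_iff₀] <;> linarith
    refine ⟨?_, f3.trans ?_, f4.trans ?_⟩
    · change 0 ≤ 2 * (1 + M) / (7 + M) ∧ 4 * (2 * (1 + M) / (7 + M)) - 1 ≤ E ∧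
        (1 + E) / 2 * (2 * (1 + M) / (7 + M)) ≤ 4 * (2 * (1 + M) / (7 + M)) - 1 + E ∧
        4 * (2 * (1 + M) / (7 + M)) ≤ 4 * (2 * (1 + M) / (7 + M)) - 1 + 1 ∧
        M + (1 - M) / 2 * (2 * (1 + M) / (7 + M)) ≤ 4 * (2 * (1 + M) / (7 + M)) - 1
      generalize 2 * (1 + M) / (7 + M) = x at *
      have := mul_le_mul_of_nonneg_left p' (show 0 ≤ E by linarith)
      refine ⟨?_, ?_, ?_, ?_, ?_⟩ <;> linarith
    · change 4 * (2 * (1 + M) / (7 + M)) - 1 + 1 - 4 * (2 * (1 + M) / (7 + M)) = 0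
      ring
    · change 4 * (2 * (1 + M) / (7 + M)) - 1 - M - (1 - M) / 2 * (2 * (1 + M) / (7 + M)) = 0
      linarith
  · rintro f0 - - - f4
    refine ⟨?_, f4.trans ?_, f0.trans rfl⟩
    · change 0 ≤ (0 : ℝ) ∧ M ≤ E ∧ (1 + E) / 2 * 0 ≤ M + E ∧ 4 * 0 ≤ M + 1 ∧
        M + (1 - M) / 2 * 0 ≤ M
      refine ⟨?_, ?_, ?_, ?_, ?_⟩ <;> linarith
    · change M - M - (1 - M) / 2 * 0 = 0
      ring

lemma eq_corner {p : Fin 2 → ℝ} {k : Fin 5} (h : lineForm (side E M k) p = 0)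
    (h' : lineForm (side E M (k + 1)) p = 0) : p = corner E M k := by
  obtain ⟨-, h2, h3⟩ := corner_mem_and_zero hE hM hM1 k
  obtain ⟨f0, f1, f2, f3, f4⟩ := side_form E M p
  obtain ⟨g0, g1, g2, g3, g4⟩ := side_form E M (corner E M k)
  suffices p 0 = corner E M k 0 ∧ p 1 = corner E M k 1 by
    ext i; fin_cases i
    · exact this.1
    · exact this.2
  revert h h' h2 h3 f0 f1 f2 f3 f4 g0 g1 g2 g3 g4
  generalize corner E M k = q
  fin_cases k <;> simp only [Fin.mk_zero, Fin.mk_one, Fin.reduceFinMk, Fin.reduceAdd, zero_add] <;>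
    intro h h' h2 h3 f0 f1 f2 f3 f4 g0 g1 g2 g3 g4 <;>
    simp only [f0, f1, f2, f3, f4, g0, g1, g2, g3, g4] at h h' h2 h3
  · exact ⟨by linarith, by linarith⟩
  · have : p 1 = q 1 := by linarith
    exact ⟨by nlinarith, this⟩
  · have : p 0 = q 0 := by
      apply mul_left_cancel₀ (show (7 - E) / 2 ≠ 0 by intro h; linarith)
      linarith
    exact ⟨this, by linarith⟩
  · have : p 0 = q 0 := by
      apply mul_left_cancel₀ (show (7 + M) / 2 ≠ 0 by intro h; linarith)
      linarith
    exact ⟨this, by linarith⟩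
  · have : p 0 = q 0 := by linarith
    exact ⟨this, by rw [this] at h; linarith⟩

lemma lineForm_corner_pos {j k : Fin 5} (h : j ≠ k) (h' : j ≠ k + 1) :
    0 < lineForm (side E M j) (corner E M k) := by
  obtain ⟨h1, h2, h3⟩ := corner_mem_and_zero hE hM hM1 k
  refine lt_of_le_of_ne (h1 j) fun h0 => ?_
  rcases adjacent_of_lineForm_eq_zero hE hM hM1 h1 h0.symm h2 with h4 | h4 | h4
  · exact h h4
  · rcases adjacent_of_lineForm_eq_zero hE hM hM1 h1 h0.symm h3 with h5 | h5 | h5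
    · exact h' h5
    · exact h (add_right_cancel h5).symm
    · rw [h4] at h5
      revert h5
      clear * -
      revert j
      decide
  · exact h' h4

omit hE hM hM1 in
lemma exists_affine_of_collinear {l : ℝ × ℝ × ℝ} {p q r : Fin 2 → ℝ} (hl : l.1 ≠ 0 ∨ l.2.1 ≠ 0)
    (hq : lineForm l q = 0) (hr : lineForm l r = 0) (hp : lineForm l p = 0) (hqr : q ≠ r) :
    ∃ t : ℝ, p = (1 - t) • q + t • r := by
  unfold lineForm at hq hr hp
  have h0 : l.1 * (r 1 - q 1) + l.2.1 * (r 0 - q 0) = 0 := by linarith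
  have h1 : l.1 * (p 1 - q 1) + l.2.1 * (p 0 - q 0) = 0 := by linarith
  have hdet : (p 0 - q 0) * (r 1 - q 1) = (p 1 - q 1) * (r 0 - q 0) := by
    rcases hl with hl | hl <;> apply mul_left_cancel₀ hl
    · linear_combination (p 0 - q 0) * h0 - (r 0 - q 0) * h1
    · linear_combination -(p 1 - q 1) * h0 + (r 1 - q 1) * h1
  by_cases hx : r 0 - q 0 = 0
  · have hy : r 1 - q 1 ≠ 0 := fun hy => hqr (by
      ext i; fin_cases i
      · exact (sub_eq_zero.1 hx).symm
      · exact (sub_eq_zero.1 hy).symm)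
    refine ⟨(p 1 - q 1) / (r 1 - q 1), ?_⟩
    have hp0 : p 0 - q 0 = 0 := by
      rw [hx, mul_zero] at hdet
      exact (mul_eq_zero.1 hdet).resolve_right hy
    ext i; fin_cases i
    · simp; field_simp; linear_combination (r 1 - q 1) * hp0 - (p 1 - q 1) * hx
    · simp; field_simp; ring
  · refine ⟨(p 0 - q 0) / (r 0 - q 0), ?_⟩
    ext i; fin_cases i
    · simp; field_simp; ring
    · simp; field_simp; linear_combination -hdet

omit hE hM hM1 in
lemma side_ne_zero (k : Fin 5) : (side E M k).1 ≠ 0 ∨ (side E M k).2.1 ≠ 0 := by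
  fin_cases k <;> simp [side]

lemma corner_ne (k : Fin 5) : corner E M (k + 4) ≠ corner E M k := by
  intro h
  have h1 := lineForm_corner_pos hE hM hM1 (j := k + 1) (k := k + 4)
    (fin_five_ne k).2.1.symm (fin_five_ne k).2.2.1
  rw [h, (corner_mem_and_zero hE hM hM1 k).2.2] at h1
  exact lt_irrefl _ h1

lemma lineForm_corner_prev (k : Fin 5) : lineForm (side E M k) (corner E M (k + 4)) = 0 := by
  have := (corner_mem_and_zero hE hM hM1 (k + 4)).2.2
  rwa [(fin_five_ne k).2.2.2.1] at this

lemma exists_side_param {p : Fin 2 → ℝ} {k : Fin 5} (hp : p ∈ pentagon E M)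
    (h : lineForm (side E M k) p = 0) :
    ∃ t ∈ Icc (0 : ℝ) 1, p = (1 - t) • corner E M (k + 4) + t • corner E M k := by
  obtain ⟨t, ht⟩ := exists_affine_of_collinear (side_ne_zero k)
    (lineForm_corner_prev hE hM hM1 k) (corner_mem_and_zero hE hM hM1 k).2.1 h
    (corner_ne hE hM hM1 k)
  refine ⟨t, ⟨?_, ?_⟩, ht⟩
  · have h1 := hp (k + 4)
    rw [ht, lineForm_combo _ _ _ (by ring), (corner_mem_and_zero hE hM hM1 (k + 4)).2.1] at h1
    have h2 := lineForm_corner_pos hE hM hM1 (j := k + 4) (k := k)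
      (fin_five_ne k).1 (fin_five_ne k).2.1
    nlinarith
  · have h1 := hp (k + 1)
    rw [ht, lineForm_combo _ _ _ (by ring), (corner_mem_and_zero hE hM hM1 k).2.2] at h1
    have h2 := lineForm_corner_pos hE hM hM1 (j := k + 1) (k := k + 4)
      (fin_five_ne k).2.1.symm (fin_five_ne k).2.2.1
    nlinarith

lemma lineForm_side_param_pos {j k : Fin 5} (hjk : j ≠ k) {t : ℝ} (ht : t ∈ Ioo (0 : ℝ) 1) :
    0 < lineForm (side E M j) ((1 - t) • corner E M (k + 4) + t • corner E M k) := by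
  rw [lineForm_combo _ _ _ (by ring)]
  by_cases h : j = k + 1
  · have h1 := lineForm_corner_pos hE hM hM1 (j := j) (k := k + 4)
      (h ▸ (fin_five_ne k).2.1.symm) (h ▸ (fin_five_ne k).2.2.1)
    have h2 := (corner_mem_and_zero hE hM hM1 k).1 j
    have := mul_pos (sub_pos.2 ht.2) h1
    have := mul_nonneg ht.1.le h2
    linarith
  · have h1 := lineForm_corner_pos hE hM hM1 hjk h
    have h2 := (corner_mem_and_zero hE hM hM1 (k + 4)).1 j
    have := mul_pos ht.1 h1
    have := mul_nonneg (sub_pos.2 ht.2).le h2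
    linarith

omit hE hM hM1 in
lemma interior_pentagon : interior (pentagon E M) = {p | ∀ k, 0 < lineForm (side E M k) p} := by
  apply Subset.antisymm
  · intro p hp k
    have hpm := interior_subset hp k
    refine lt_of_le_of_ne hpm fun h0 => ?_
    -- The direction is minus the gradient of the form, so a small step from a point of side `k`
    -- leaves the tile.
    obtain ⟨v, hv⟩ : ∃ v : Fin 2 → ℝ, (side E M k).1 * v 1 + (side E M k).2.1 * v 0 < 0 := by
      refine ⟨![-(side E M k).2.1, -(side E M k).1], ?_⟩
      simp only [Matrix.cons_val_one, Matrix.cons_val_zero]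
      rcases side_ne_zero (E := E) (M := M) k with h | h
      · nlinarith [sq_nonneg (side E M k).2.1, sq_pos_of_ne_zero h]
      · nlinarith [sq_nonneg (side E M k).1, sq_pos_of_ne_zero h]
    have hc : Continuous fun s : ℝ => p + s • v := by fun_prop
    have hev : ∀ᶠ s in 𝓝 (0 : ℝ), p + s • v ∈ pentagon E M := by
      refine hc.continuousAt.eventually_mem ?_
      simpa using mem_interior_iff_mem_nhds.1 hp
    obtain ⟨s, hs, hs0⟩ := ((hev.filter_mono nhdsWithin_le_nhds).and
      (self_mem_nhdsWithin : Ioi (0 : ℝ) ∈ 𝓝[>] 0)).exists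
    have h1 := hs k
    simp only [lineForm, Pi.add_apply, Pi.smul_apply, smul_eq_mul] at h1 h0
    have : s * ((side E M k).1 * v 1 + (side E M k).2.1 * v 0) < 0 :=
      mul_neg_of_pos_of_neg hs0 hv
    nlinarith
  · refine interior_maximal (fun p hp k => (hp k).le) ?_
    have : {p | ∀ k, 0 < lineForm (side E M k) p} = ⋂ k, {p | 0 < lineForm (side E M k) p} := by
      ext; simp
    rw [this]
    exact isOpen_iInter_of_finite fun k => isOpen_lt continuous_const (continuous_lineForm _)

lemma interior_pentagon_nonempty : (interior (pentagon E M)).Nonempty := by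
  rw [interior_pentagon]
  refine ⟨![1, 50], ?_⟩
  change ∀ k, 0 < lineForm (side E M k) ![1, 50]
  obtain ⟨f0, f1, f2, f3, f4⟩ := side_form E M ![1, 50]
  rw [forall_fin_five, f0, f1, f2, f3, f4]
  simp
  exact ⟨by linarith, by linarith, by linarith, by linarith⟩

end

end UpperHalfPlane

/-! ### Dependence of the tile on its two parameters -/

namespace UpperHalfPlane

/-- The parameter `M` of the vertex enters only side 4, and the parameter `E` of the edge only sides
1 and 2. This is what lets tiles with different parameters be glued by equality of coordinates. -/
lemma side_congr_right {E M M' : ℝ} {j : Fin 5} (h : j ≠ 4) : side E M j = side E M' j := by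
  fin_cases j <;> simp [side] at h ⊢

lemma side_congr_left {E E' M : ℝ} {j : Fin 5} (h : j ≠ 1) (h' : j ≠ 2) :
    side E M j = side E' M j := by
  fin_cases j <;> simp [side] at h h' ⊢

/-- On side 1 the second coordinate is `E`, so large that the constraint of side 4 holds for every
admissible `M`. Thus side 1 is the same segment in both tiles. -/
lemma mem_pentagon_of_side_one {E M M' : ℝ} (hE : 100 ≤ E) (hM : 0 < M) (hM1 : M < 1)
    (hM' : 0 < M') (hM1' : M' < 1) {p : Fin 2 → ℝ} (hp : p ∈ pentagon E M)
    (h : lineForm (side E M 1) p = 0) : p ∈ pentagon E M' := by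
  obtain ⟨b0, b1, b2, b3, -⟩ := pentagon_bounds hE hM hM1 hp
  obtain ⟨h0, h1, h2, h3, h4⟩ := mem_pentagon_iff.1 hp
  rw [(side_form E M p).2.1] at h
  refine mem_pentagon_iff.2 ⟨h0, h1, h2, h3, ?_⟩
  nlinarith

/-- Side 3 cuts side 4 off at `p 0 ≤ 1/2`, where sides 1 and 2 impose nothing, whatever the edge. -/
lemma mem_pentagon_of_side_four {E E' M : ℝ} (hE' : 100 ≤ E') (hM : 0 < M) (hM1 : M < 1)
    {p : Fin 2 → ℝ} (hp : p ∈ pentagon E M)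
    (h : lineForm (side E M 4) p = 0) : p ∈ pentagon E' M := by
  obtain ⟨h0, h1, h2, h3, h4⟩ := mem_pentagon_iff.1 hp
  rw [(side_form E M p).2.2.2.2] at h
  have hX : p 0 ≤ 1 / 2 := by nlinarith
  refine mem_pentagon_iff.2 ⟨h0, ?_, ?_, h3, h4⟩ <;> nlinarith

end UpperHalfPlane

/-! ### The surface glued from the tiles -/

namespace FiniteGraph

open UpperHalfPlane

/-- A cyclic order at each vertex of a graph, together with the parameters that determine the
hyperbolic tiles from which a surface is assembled. -/
structure TileSystem (G : FiniteGraph.{0}) where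
  /-- The next directed edge around the initial vertex. -/
  next : Equiv.Perm G.Dart
  /-- The position of a directed edge around its initial vertex. -/
  pos : G.Dart → ℤ
  source_next : ∀ e, G.source (next e) = G.source e
  pos_next : ∀ e, pos (next e) ≡ pos e + 1 [ZMOD G.degree (G.source e)]
  eq_of_pos : ∀ e e', G.source e = G.source e' →
    pos e ≡ pos e' [ZMOD G.degree (G.source e)] → e = e'
  three_le_degree : ∀ v, 3 ≤ G.degree v
  /-- The height of the vertex on its legs. -/
  rad : G.Vertex → ℝ
  rad_pos : ∀ v, 0 < rad v
  rad_lt_one : ∀ v, rad v < 1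
  -- This is the condition that sides 4 and 0 meet at angle `π / deg v`.
  rad_eq : ∀ v, Real.sin (Real.pi / G.degree v) * (1 - rad v ^ 2) =
    4 * rad v * Real.cos (Real.pi / G.degree v)
  /-- The square of the height of the midpoint of the central part of an edge. -/
  width : G.Edge → ℝ
  -- The bound 100 is generous: it only guarantees that the five lines bound a pentagon of the
  -- intended shape.
  width_ge : ∀ e, 100 ≤ width e

/-- A tile: a directed edge, the side of it on which the tile lies, and the sheet. -/
abbrev Tile (G : FiniteGraph.{0}) : Type := G.Dart × Bool × Bool

instance (G : FiniteGraph.{u}) : Finite G.Dart := G.finite_dart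
instance (G : FiniteGraph.{u}) : Finite G.Edge := Quotient.finite _

lemma edge_rev (G : FiniteGraph.{u}) (e : G.Dart) : G.edge (G.rev e) = G.edge e :=
  (Quotient.sound (Or.inr rfl : G.edgeSetoid e (G.rev e))).symm

lemma edge_eq_iff (G : FiniteGraph.{u}) {e e' : G.Dart} :
    G.edge e = G.edge e' ↔ e' = e ∨ e' = G.rev e :=
  Quotient.eq (r := G.edgeSetoid)

namespace TileSystem

variable {G : FiniteGraph.{0}} (T : G.TileSystem)

/-- The linear forms that cut out a tile. -/
noncomputable def form (t : G.Tile) (k : Fin 5) : ℝ × ℝ × ℝ :=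
  side (T.width (G.edge t.1)) (T.rad (G.source t.1) ^ 2) k

/-- The polygon of a tile in the projective model. -/
def poly (t : G.Tile) : Set (Fin 2 → ℝ) :=
  pentagon (T.width (G.edge t.1)) (T.rad (G.source t.1) ^ 2)

/-- The neighbour of a tile across a side. -/
def cross (k : Fin 5) (t : G.Tile) : G.Tile :=
  match k with
  | 0 => (t.1, !t.2.1, t.2.2)
  | 1 => (G.rev t.1, !t.2.1, t.2.2)
  | 2 => (t.1, !t.2.1, t.2.2)
  | 3 => (t.1, t.2.1, !t.2.2)
  -- The two sides of a dart turn in opposite senses around the vertex, which makes the crossing an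
  -- involution.
  | 4 => (if t.2.1 then T.next t.1 else T.next.symm t.1, !t.2.1, t.2.2)

/-- The orientation of a tile. -/
def sgn (t : G.Tile) : Bool := xor t.2.1 t.2.2

lemma sq_rad_pos (v : G.Vertex) : 0 < T.rad v ^ 2 := pow_pos (T.rad_pos v) 2

lemma sq_rad_lt_one (v : G.Vertex) : T.rad v ^ 2 < 1 := by
  have h1 := T.rad_lt_one v
  have h2 := T.rad_pos v
  nlinarith

lemma source_next_symm (e : G.Dart) : G.source (T.next.symm e) = G.source e := by
  conv_rhs => rw [← T.next.apply_symm_apply e, T.source_next]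

@[simp] lemma cross_cross (k : Fin 5) (t : G.Tile) : T.cross k (T.cross k t) = t := by
  obtain ⟨e, a, ε⟩ := t
  fin_cases k <;> simp [cross, G.rev_rev]
  cases a <;> simp

@[simp] lemma sgn_cross (k : Fin 5) (t : G.Tile) : sgn (T.cross k t) = !sgn t := by
  obtain ⟨e, a, ε⟩ := t
  fin_cases k <;> cases a <;> cases ε <;> rfl

lemma source_cross_four (t : G.Tile) : G.source (T.cross 4 t).1 = G.source t.1 := by
  obtain ⟨e, a, ε⟩ := t
  cases a
  · exact T.source_next_symm e
  · exact T.source_next e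

lemma fst_cross {k : Fin 5} (h1 : k ≠ 1) (h4 : k ≠ 4) (t : G.Tile) : (T.cross k t).1 = t.1 := by
  fin_cases k
  · rfl
  · exact absurd rfl h1
  · rfl
  · rfl
  · exact absurd rfl h4

/-- Crossing side 1 may change the vertex, hence only side 4, which is not adjacent to side 1.
Crossing side 4 may change the edge, hence only sides 1 and 2, which are not adjacent to side 4. The
other crossings keep the dart. -/
lemma form_cross (t : G.Tile) {j k : Fin 5} (h : j = k ∨ k = j + 1 ∨ j = k + 1) :
    T.form (T.cross k t) j = T.form t j := by
  unfold form
  rcases eq_or_ne k 1 with rfl | h1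
  · rw [show (T.cross 1 t).1 = G.rev t.1 from rfl, G.edge_rev]
    refine side_congr_right (fun h4 => ?_)
    rw [h4] at h
    exact absurd h (by decide)
  rcases eq_or_ne k 4 with rfl | h4
  · rw [T.source_cross_four]
    refine side_congr_left (fun h4 => ?_) (fun h4 => ?_) <;>
      · rw [h4] at h
        exact absurd h (by decide)
  rw [T.fst_cross h1 h4]

lemma mem_poly_cross {t : G.Tile} {k : Fin 5} {p : Fin 2 → ℝ} (hp : p ∈ T.poly t)
    (h : lineForm (T.form t k) p = 0) : p ∈ T.poly (T.cross k t) := by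
  rcases eq_or_ne k 1 with rfl | h1
  · unfold poly
    rw [show (T.cross 1 t).1 = G.rev t.1 from rfl, G.edge_rev]
    exact mem_pentagon_of_side_one (T.width_ge _) (T.sq_rad_pos _) (T.sq_rad_lt_one _)
      (T.sq_rad_pos _) (T.sq_rad_lt_one _) hp h
  rcases eq_or_ne k 4 with rfl | h4
  · unfold poly
    rw [T.source_cross_four]
    exact mem_pentagon_of_side_four (T.width_ge _) (T.sq_rad_pos _) (T.sq_rad_lt_one _) hp h
  unfold poly
  rw [T.fst_cross h1 h4]
  exact hp

lemma adjacent {t : G.Tile} {p : Fin 2 → ℝ} (hp : p ∈ T.poly t) {j k : Fin 5}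
    (hj : lineForm (T.form t j) p = 0) (hk : lineForm (T.form t k) p = 0) :
    j = k ∨ k = j + 1 ∨ j = k + 1 :=
  adjacent_of_lineForm_eq_zero (T.width_ge _) (T.sq_rad_pos _) (T.sq_rad_lt_one _) hp hj hk

/-- The sides on which a point lies. -/
def zeros (t : G.Tile) (p : Fin 2 → ℝ) : Set (Fin 5) := {k | lineForm (T.form t k) p = 0}

lemma zeros_cross {t : G.Tile} {k : Fin 5} {p : Fin 2 → ℝ} (hp : p ∈ T.poly t)
    (h : k ∈ T.zeros t p) : T.zeros (T.cross k t) p = T.zeros t p := by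
  have hle : ∀ {t : G.Tile}, p ∈ T.poly t → k ∈ T.zeros t p →
      T.zeros t p ⊆ T.zeros (T.cross k t) p := by
    intro t hp h j hj
    change lineForm (T.form _ j) p = 0
    rw [T.form_cross t (T.adjacent hp hj h)]
    exact hj
  -- The other inclusion is the same statement for the neighbour, since crossing is an involution.
  refine Subset.antisymm ?_ (hle hp h)
  have h1 := hle (T.mem_poly_cross hp h) (hle hp h h)
  rwa [cross_cross] at h1

/-- Two tiles are linked when one gets from one to the other by crossing sides in `J`. -/
def Linked (J : Set (Fin 5)) : G.Tile → G.Tile → Prop :=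
  Relation.ReflTransGen fun t t' => ∃ k ∈ J, t' = T.cross k t

variable {T}

lemma Linked.refl (J : Set (Fin 5)) (t : G.Tile) : T.Linked J t t := Relation.ReflTransGen.refl

lemma Linked.cross {J : Set (Fin 5)} {k : Fin 5} (hk : k ∈ J) (t : G.Tile) :
    T.Linked J t (T.cross k t) := Relation.ReflTransGen.single ⟨k, hk, rfl⟩

lemma Linked.trans {J : Set (Fin 5)} {a b c : G.Tile} (h : T.Linked J a b) (h' : T.Linked J b c) :
    T.Linked J a c := Relation.ReflTransGen.trans h h'

lemma Linked.symm {J : Set (Fin 5)} {a b : G.Tile} (h : T.Linked J a b) : T.Linked J b a := by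
  induction h with
  | refl => exact Linked.refl _ _
  | @tail b c hab hbc ih =>
    obtain ⟨k, hk, rfl⟩ := hbc
    refine Linked.trans ?_ ih
    have h1 := Linked.cross (T := T) hk (T.cross k b)
    rwa [cross_cross] at h1

lemma Linked.mono {J J' : Set (Fin 5)} (hJ : J ⊆ J') {a b : G.Tile} (h : T.Linked J a b) :
    T.Linked J' a b :=
  Relation.ReflTransGen.mono (fun _ _ ⟨k, hk, e⟩ => ⟨k, hJ hk, e⟩) _ _ h

/-- Properties preserved by crossing sides in `J` are preserved by links. -/
lemma Linked.induct {J : Set (Fin 5)} {P : G.Tile → Prop} {a b : G.Tile} (h : T.Linked J a b)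
    (ha : P a) (step : ∀ t, T.Linked J a t → P t → ∀ k ∈ J, P (T.cross k t)) : P b := by
  induction h with
  | refl => exact ha
  | tail hab hbc ih =>
    obtain ⟨k, hk, rfl⟩ := hbc
    exact step _ hab ih k hk

/-- The set of sides through a point is constant along links at that point. Hence the gluing
relation, which refers to the sides of the first tile only, is symmetric and transitive. -/
lemma Linked.mem_poly_and_zeros {a b : G.Tile} {p : Fin 2 → ℝ} (h : T.Linked (T.zeros a p) a b)
    (hp : p ∈ T.poly a) : p ∈ T.poly b ∧ T.zeros b p = T.zeros a p := by
  refine h.induct (P := fun b => p ∈ T.poly b ∧ T.zeros b p = T.zeros a p) ⟨hp, rfl⟩ ?_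
  rintro t - ⟨h1, h2⟩ k hk
  rw [← h2] at hk
  exact ⟨T.mem_poly_cross h1 hk, (T.zeros_cross h1 hk).trans h2⟩

lemma Linked.form_eq {a b : G.Tile} {p : Fin 2 → ℝ} (h : T.Linked (T.zeros a p) a b)
    (hp : p ∈ T.poly a) {j : Fin 5} (hj : j ∈ T.zeros a p) : T.form b j = T.form a j := by
  refine h.induct (P := fun b => T.form b j = T.form a j) rfl ?_
  rintro t ht h1 k hk
  obtain ⟨h2, h3⟩ := ht.mem_poly_and_zeros hp
  rw [← h3] at hk hj
  exact (T.form_cross t (T.adjacent h2 hj hk)).trans h1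

variable (T)

/-- The gluing: points with equal coordinates in tiles linked across the sides they lie on. -/
def setoid : Setoid (Σ t : G.Tile, T.poly t) where
  r x y := (x.2 : Fin 2 → ℝ) = y.2 ∧ T.Linked (T.zeros x.1 x.2) x.1 y.1
  iseqv :=
    { refl := fun x => ⟨rfl, Linked.refl _ _⟩
      symm := fun {x y} ⟨h1, h2⟩ => ⟨h1.symm, by
        rw [← h1, (h2.mem_poly_and_zeros x.2.2).2]
        exact h2.symm⟩
      trans := fun {x y z} ⟨h1, h2⟩ ⟨h3, h4⟩ => ⟨h1.trans h3, by
        rw [← h1, (h2.mem_poly_and_zeros x.2.2).2] at h4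
        exact h2.trans h4⟩ }

/-- The surface glued from the tiles. -/
def Surface : Type := Quotient T.setoid

instance : TopologicalSpace T.Surface := inferInstanceAs (TopologicalSpace (Quotient T.setoid))

/-- The point of the surface with given coordinates in a given tile. -/
def pt (t : G.Tile) (p : T.poly t) : T.Surface := Quotient.mk T.setoid ⟨t, p⟩

lemma pt_eq_iff {t t' : G.Tile} {p : T.poly t} {p' : T.poly t'} : T.pt t p = T.pt t' p' ↔
    (p : Fin 2 → ℝ) = p' ∧ T.Linked (T.zeros t p) t t' :=
  Quotient.eq (r := T.setoid)

lemma exists_pt (q : T.Surface) : ∃ t p, T.pt t p = q := by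
  obtain ⟨⟨t, p⟩, h⟩ := Quotient.exists_rep q
  exact ⟨t, p, h⟩

lemma continuous_pt (t : G.Tile) : Continuous (T.pt t) :=
  continuous_quotient_mk'.comp continuous_sigmaMk

lemma isCompact_poly (t : G.Tile) : IsCompact (T.poly t) :=
  isCompact_pentagon (T.width_ge _) (T.sq_rad_pos _) (T.sq_rad_lt_one _)

instance (t : G.Tile) : CompactSpace (T.poly t) := isCompact_iff_compactSpace.1 (T.isCompact_poly t)

instance : CompactSpace T.Surface :=
  inferInstanceAs (CompactSpace (Quotient T.setoid))

/-- The map that remembers only the coordinates. -/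
def fold : T.Surface → Fin 2 → ℝ := Quotient.lift (fun x => (x.2 : Fin 2 → ℝ)) fun _ _ h => h.1

@[simp] lemma fold_pt (t : G.Tile) (p : T.poly t) : T.fold (T.pt t p) = p := rfl

lemma isOpen_iff {U : Set T.Surface} : IsOpen U ↔ ∀ t, IsOpen (T.pt t ⁻¹' U) := by
  exact (isQuotientMap_quotient_mk' (s := T.setoid)).isOpen_preimage.symm.trans isOpen_sigma_iff

lemma continuous_fold : Continuous T.fold := by
  refine continuous_def.2 fun U hU => T.isOpen_iff.2 fun t => ?_
  exact hU.preimage continuous_subtype_val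

/-- Coordinates so close to `p` that in the tiles linked to `t` at `p` only sides through `p`
can be hit. -/
def near (t : G.Tile) (p : Fin 2 → ℝ) : Set (Fin 2 → ℝ) :=
  {q | ∀ t', T.Linked (T.zeros t p) t t' → ∀ k ∉ T.zeros t p, 0 < lineForm (T.form t' k) q}

lemma isOpen_near (t : G.Tile) (p : Fin 2 → ℝ) : IsOpen (T.near t p) := by
  have : T.near t p = ⋂ t' : G.Tile, ⋂ k : Fin 5, {q | T.Linked (T.zeros t p) t t' →
      k ∉ T.zeros t p → 0 < lineForm (T.form t' k) q} := by
    ext q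
    simp only [near, mem_ofPred_eq, mem_iInter]
    exact ⟨fun h t' k h1 h2 => h t' h1 k h2, fun h t' h1 k h2 => h t' k h1 h2⟩
  rw [this]
  refine isOpen_iInter_of_finite fun t' => isOpen_iInter_of_finite fun k => ?_
  by_cases h : T.Linked (T.zeros t p) t t' ∧ k ∉ T.zeros t p
  · simp only [h.1, h.2, true_imp_iff, not_false_eq_true]
    exact isOpen_lt continuous_const (continuous_lineForm _)
  · convert isOpen_univ
    exact eq_univ_of_forall fun q h1 h2 => absurd ⟨h1, h2⟩ h

variable {T}

lemma mem_near {t : G.Tile} {p : Fin 2 → ℝ} (hp : p ∈ T.poly t) : p ∈ T.near t p := by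
  intro t' ht' k hk
  obtain ⟨h1, h2⟩ := ht'.mem_poly_and_zeros hp
  rw [← h2] at hk
  exact lt_of_le_of_ne (h1 k) (Ne.symm hk)

lemma zeros_subset_of_near {t t' : G.Tile} {p q : Fin 2 → ℝ} (h : T.Linked (T.zeros t p) t t')
    (hq : q ∈ T.near t p) : T.zeros t' q ⊆ T.zeros t p := by
  intro k hk
  by_contra hk'
  exact (hq t' h k hk').ne' hk

variable (T)

/-- The points of the surface with coordinates in `O`, in the tiles linked to `t` at `p`. -/
def patch (t : G.Tile) (p : Fin 2 → ℝ) (O : Set (Fin 2 → ℝ)) : Set T.Surface :=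
  {x | ∃ t', T.Linked (T.zeros t p) t t' ∧ ∃ q : T.poly t', (q : Fin 2 → ℝ) ∈ O ∧ T.pt t' q = x}

variable {T}

/-- Within `near t p` a point is identified only across sides that already pass through `p`.
Membership in a patch therefore does not depend on the representative, and patches of open sets are
open. -/
lemma pt_mem_patch {t : G.Tile} {p : Fin 2 → ℝ} {O : Set (Fin 2 → ℝ)} (hO : O ⊆ T.near t p)
    {t' : G.Tile} {q : T.poly t'} :
    T.pt t' q ∈ T.patch t p O ↔ T.Linked (T.zeros t p) t t' ∧ (q : Fin 2 → ℝ) ∈ O := by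
  constructor
  · rintro ⟨s, hs, r, hr, h⟩
    obtain ⟨h1, h2⟩ := T.pt_eq_iff.1 h
    exact ⟨hs.trans (h2.mono (zeros_subset_of_near hs (hO hr))), h1 ▸ hr⟩
  · rintro ⟨h1, h2⟩
    exact ⟨t', h1, q, h2, rfl⟩

lemma isOpen_patch {t : G.Tile} {p : Fin 2 → ℝ} {O : Set (Fin 2 → ℝ)} (hO : O ⊆ T.near t p)
    (hO' : IsOpen O) : IsOpen (T.patch t p O) := by
  refine T.isOpen_iff.2 fun t' => ?_
  by_cases h : T.Linked (T.zeros t p) t t'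
  · have : T.pt t' ⁻¹' T.patch t p O = Subtype.val ⁻¹' O := by
      ext q
      rw [mem_preimage, pt_mem_patch hO]
      exact and_iff_right h
    rw [this]
    exact hO'.preimage continuous_subtype_val
  · have : T.pt t' ⁻¹' T.patch t p O = ∅ := by
      ext q
      rw [mem_preimage, pt_mem_patch hO]
      simp [h]
    rw [this]
    exact isOpen_empty

/-- Points with different coordinates are separated by `fold`. For equal coordinates, a common point
of the two patches would link the two tiles across sides through the point, and so identify the
points. -/
instance : T2Space T.Surface := by
  refine ⟨fun x y hxy => ?_⟩
  obtain ⟨t, p, rfl⟩ := T.exists_pt x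
  obtain ⟨t', p', rfl⟩ := T.exists_pt y
  by_cases hp : (p : Fin 2 → ℝ) = p'
  · have h1 := mem_near p.2
    have h2 : (p' : Fin 2 → ℝ) ∈ T.near t' p' := mem_near p'.2
    refine ⟨T.patch t p (T.near t p), T.patch t' p' (T.near t' p'),
      isOpen_patch subset_rfl (T.isOpen_near _ _), isOpen_patch subset_rfl (T.isOpen_near _ _),
      (pt_mem_patch subset_rfl).2 ⟨Linked.refl _ _, h1⟩,
      (pt_mem_patch subset_rfl).2 ⟨Linked.refl _ _, h2⟩, ?_⟩
    refine Set.disjoint_left.2 fun z hz hz' => hxy ?_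
    obtain ⟨s, q, rfl⟩ := T.exists_pt z
    have h3 := ((pt_mem_patch subset_rfl).1 hz).1
    have h4 := ((pt_mem_patch subset_rfl).1 hz').1
    refine T.pt_eq_iff.2 ⟨hp, h3.trans ?_⟩
    rw [← (h3.mem_poly_and_zeros p.2).2, hp, (h4.mem_poly_and_zeros p'.2).2]
    exact h4.symm
  · obtain ⟨U, V, hU, hV, h1, h2, h3⟩ := t2_separation hp
    exact ⟨T.fold ⁻¹' U, T.fold ⁻¹' V, hU.preimage T.continuous_fold,
      hV.preimage T.continuous_fold, h1, h2, h3.preimage _⟩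

end TileSystem

end FiniteGraph

/-! ### The hyperbolic atlas and a criterion for charts -/

namespace FiniteGraph.TileSystem

open UpperHalfPlane

variable {G : FiniteGraph.{0}} (T : G.TileSystem)

lemma disc_form_pos (t : G.Tile) (k : Fin 5) : 0 < lineDisc (T.form t k) :=
  side_disc_pos (T.width_ge _) (T.sq_rad_pos _) (T.sq_rad_lt_one _) k

lemma sq_lt_of_mem_poly {t : G.Tile} {p : Fin 2 → ℝ} (hp : p ∈ T.poly t) : p 0 ^ 2 < p 1 :=
  (pentagon_bounds (T.width_ge _) (T.sq_rad_pos _) (T.sq_rad_lt_one _) hp).2.2.2.2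

/-- Isometries `D t`, one for each tile that contains a point `p` of the surface, that are
compatible with the reflections in the sides through `p` and with the orientations. -/
structure IsUnfolding (t₀ : G.Tile) (p : Fin 2 → ℝ) (D : G.Tile → GL (Fin 2) ℝ) : Prop where
  det_pos : ∀ t, T.Linked (T.zeros t₀ p) t₀ t → sgn t = true → 0 < (D t).det.val
  det_neg : ∀ t, T.Linked (T.zeros t₀ p) t₀ t → sgn t = false → (D t).det.val < 0
  cross : ∀ t, T.Linked (T.zeros t₀ p) t₀ t → ∀ k ∈ T.zeros t₀ p, ∀ z : ℍ,
    D (T.cross k t) • z = D t • mirror (T.form t₀ k) • z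

/-- A map to the hyperbolic plane is, near a point `p`, given by the isometries `D`. -/
def IsGivenBy (t₀ : G.Tile) (p : Fin 2 → ℝ) (D : G.Tile → GL (Fin 2) ℝ) (φ : T.Surface → ℍ) :
    Prop :=
  ∀ t, T.Linked (T.zeros t₀ p) t₀ t → ∀ᶠ q in 𝓝 p, ∀ hq : q ∈ T.poly t,
    φ (T.pt t ⟨q, hq⟩) = D t • unklein q

/-- The charts of the surface. -/
def charts : Set (OpenPartialHomeomorph T.Surface ℍ) :=
  {φ | ∀ t p, T.pt t p ∈ φ.source → ∃ D, T.IsUnfolding t p D ∧ T.IsGivenBy t p D φ}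

variable {T}

/-- A reflection fixes the points of its line, so the isometries of tiles linked across sides
through `z` agree at `z`. This makes the chart defined by `D` independent of the tile. -/
lemma IsUnfolding.smul_eq {t₀ : G.Tile} {p : Fin 2 → ℝ} {D : G.Tile → GL (Fin 2) ℝ}
    (hD : T.IsUnfolding t₀ p D) {t t' : G.Tile} (ht : T.Linked (T.zeros t₀ p) t₀ t)
    {J : Set (Fin 5)} (hJ : J ⊆ T.zeros t₀ p) (h : T.Linked J t t') {z : ℍ}
    (hz : ∀ k ∈ J, lineForm (T.form t₀ k) (klein z) = 0) : D t' • z = D t • z := by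
  refine h.induct (P := fun t' => D t' • z = D t • z) rfl ?_
  intro s hs h1 k hk
  rw [hD.cross s (ht.trans (hs.mono hJ)) k (hJ hk),
    mirror_smul_of_lineForm_eq_zero (T.disc_form_pos _ _) (hz k hk), h1]

/-- Two unfoldings at the same point obey the same recursion under crossings, so `D' t * (D t)⁻¹`
acts in the same way for all tiles at the point and is the coordinate change. Its determinant is
positive because the signs of `D t` and `D' t` are both given by `sgn t`. -/
lemma charts_compatible {φ φ' : OpenPartialHomeomorph T.Surface ℍ} (hφ : φ ∈ T.charts)
    (hφ' : φ' ∈ T.charts) :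
    hyperbolicPregroupoid.property (φ.symm.trans φ') (φ.symm.trans φ').source := by
  intro x hx
  rw [OpenPartialHomeomorph.trans_source, OpenPartialHomeomorph.symm_source] at hx
  obtain ⟨hx1, hx2⟩ := hx
  obtain ⟨t, p, hq⟩ := T.exists_pt (φ.symm x)
  obtain ⟨D, hD, hg⟩ := hφ t p (hq ▸ φ.map_target hx1)
  obtain ⟨D', hD', hg'⟩ := hφ' t p (hq ▸ hx2)
  have hpos : 0 < (D' t * (D t)⁻¹).det.val := by
    rw [map_mul, map_inv, Units.val_mul, Units.val_inv_eq_inv_val]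
    cases hs : sgn t
    · exact mul_pos_of_neg_of_neg (hD'.det_neg t (Linked.refl _ _) hs)
        (inv_lt_zero.2 (hD.det_neg t (Linked.refl _ _) hs))
    · exact mul_pos (hD'.det_pos t (Linked.refl _ _) hs)
        (inv_pos.2 (hD.det_pos t (Linked.refl _ _) hs))
  have hall : ∀ t', T.Linked (T.zeros t p) t t' → ∀ z : ℍ,
      D' t' • z = (D' t * (D t)⁻¹) • D t' • z := by
    intro t' ht'
    refine ht'.induct (P := fun t' => ∀ z : ℍ, D' t' • z = (D' t * (D t)⁻¹) • D t' • z) ?_ ?_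
    · intro z
      rw [← mul_smul, inv_mul_cancel_right]
    · intro s hs h1 k hk z
      rw [hD.cross s hs k hk, hD'.cross s hs k hk, h1]
  have hev : ∀ᶠ q in 𝓝 (T.pt t p), φ' q = (D' t * (D t)⁻¹) • φ q := by
    have h1 : ∀ᶠ q in 𝓝 (p : Fin 2 → ℝ), ∀ t', T.Linked (T.zeros t p) t t' →
        ∀ hq : q ∈ T.poly t', φ (T.pt t' ⟨q, hq⟩) = D t' • unklein q ∧
          φ' (T.pt t' ⟨q, hq⟩) = D' t' • unklein q := by
      refine Filter.eventually_all.2 fun t' => ?_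
      by_cases ht' : T.Linked (T.zeros t p) t t'
      · filter_upwards [hg t' ht', hg' t' ht'] with q h1 h2 _ hq
        exact ⟨h1 hq, h2 hq⟩
      · exact Filter.Eventually.of_forall fun q h => absurd h ht'
    obtain ⟨O, hO, hOo, hpO⟩ := eventually_nhds_iff.1
      (h1.and ((T.isOpen_near t p).eventually_mem (mem_near p.2)))
    have hsub : O ⊆ T.near t p := fun q hq => (hO q hq).2
    filter_upwards [(isOpen_patch hsub hOo).mem_nhds ((pt_mem_patch hsub).2 ⟨Linked.refl _ _, hpO⟩)]
      with q hq
    obtain ⟨t', ht', r, hr, rfl⟩ := hq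
    obtain ⟨e1, e2⟩ := (hO r hr).1 t' ht' r.2
    rw [e1, e2, hall t' ht']
  obtain ⟨h, hh⟩ := exists_SL2_smul_eq _ hpos
  refine ⟨h, ?_⟩
  rw [hq] at hev
  filter_upwards [(φ.symm.continuousAt (x := x) hx1).eventually hev,
    φ.open_target.mem_nhds hx1] with y hy hyt
  rw [OpenPartialHomeomorph.coe_trans, Function.comp_apply, hy, φ.right_inv hyt, hh]

lemma charts_trans_mem {φ φ' : OpenPartialHomeomorph T.Surface ℍ} (hφ : φ ∈ T.charts)
    (hφ' : φ' ∈ T.charts) : φ.symm.trans φ' ∈ hyperbolicGroupoid := by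
  refine (mem_groupoid_of_pregroupoid (PG := hyperbolicPregroupoid)).2
    ⟨charts_compatible hφ hφ', ?_⟩
  have h := charts_compatible hφ' hφ
  rw [← OpenPartialHomeomorph.symm_source, OpenPartialHomeomorph.trans_symm_eq_symm_trans_symm,
    OpenPartialHomeomorph.symm_symm]
  exact h

/-- A chart exists near `p` when the images of the sector at `p` under the unfolding isometries
cover the hyperbolic plane and overlap only along the sides. -/
lemma exists_chart {t₀ : G.Tile} (p₀ : T.poly t₀) {D : G.Tile → GL (Fin 2) ℝ}
    (hD : T.IsUnfolding t₀ p₀ D)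
    (hcover : ∀ y : ℍ, ∃ t, T.Linked (T.zeros t₀ p₀) t₀ t ∧
      ∀ k ∈ T.zeros t₀ p₀, 0 ≤ lineForm (T.form t₀ k) (klein ((D t)⁻¹ • y)))
    (hinj : ∀ t t', T.Linked (T.zeros t₀ p₀) t₀ t → T.Linked (T.zeros t₀ p₀) t₀ t' →
      ∀ z z' : ℍ, (∀ k ∈ T.zeros t₀ p₀, 0 ≤ lineForm (T.form t₀ k) (klein z)) →
      (∀ k ∈ T.zeros t₀ p₀, 0 ≤ lineForm (T.form t₀ k) (klein z')) → D t • z = D t' • z' →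
      z = z' ∧
        T.Linked {k ∈ T.zeros t₀ p₀ | lineForm (T.form t₀ k) (klein z) = 0} t t') :
    ∃ φ ∈ T.charts, T.pt t₀ p₀ ∈ φ.source := by
  classical
  set Z := T.zeros t₀ p₀ with hZ
  set z₀ := unklein (p₀ : Fin 2 → ℝ) with hz₀
  have hp₀ := T.sq_lt_of_mem_poly p₀.2
  have hkz₀ : klein z₀ = p₀ := klein_unklein hp₀
  -- In a ball of this radius only sides through `p₀` can be hit, so the tile coincides there with
  -- its sector at `p₀`.
  obtain ⟨r, hr, hball⟩ : ∃ r > 0, ∀ z : ℍ, dist z z₀ < r → klein z ∈ T.near t₀ p₀ := by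
    have : ∀ᶠ z in 𝓝 z₀, klein z ∈ T.near t₀ p₀ :=
      continuous_klein.continuousAt.eventually_mem
        ((T.isOpen_near t₀ p₀).mem_nhds (by rw [hkz₀]; exact mem_near p₀.2))
    obtain ⟨r, hr, h⟩ := Metric.eventually_nhds_iff.1 this
    exact ⟨r, hr, fun z hz => h hz⟩
  set y₀ := D t₀ • z₀ with hy₀
  -- All the isometries send `z₀` to the same point `y₀`, so each carries the ball around `z₀` onto
  -- the ball around `y₀` of the same radius. The latter ball is the target of the chart.
  have hDz₀ : ∀ t, T.Linked Z t₀ t → D t • z₀ = y₀ := fun t ht =>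
    hD.smul_eq (Linked.refl _ _) subset_rfl ht fun k hk => by rw [hkz₀]; exact hk
  have hdist : ∀ t, T.Linked Z t₀ t → ∀ z : ℍ, dist (D t • z) y₀ = dist z z₀ := fun t ht z => by
    rw [← hDz₀ t ht, dist_gl_smul]
  have hdist' : ∀ t, T.Linked Z t₀ t → ∀ y : ℍ, dist ((D t)⁻¹ • y) z₀ = dist y y₀ :=
    fun t ht y => by rw [← hdist t ht, smul_inv_smul]
  set O : Set (Fin 2 → ℝ) := {q | q 0 ^ 2 < q 1} ∩ unklein ⁻¹' Metric.ball z₀ r with hO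
  have hdom : IsOpen {q : Fin 2 → ℝ | q 0 ^ 2 < q 1} := isOpen_lt (by fun_prop) (by fun_prop)
  have hOo : IsOpen O := continuousOn_unklein.isOpen_inter_preimage hdom Metric.isOpen_ball
  have hOn : O ⊆ T.near t₀ p₀ := fun q hq => by
    have := hball (unklein q) hq.2
    rwa [klein_unklein hq.1] at this
  have hform : ∀ {t}, T.Linked Z t₀ t → ∀ {k}, k ∈ Z → T.form t k = T.form t₀ k := fun ht k hk =>
    ht.form_eq p₀.2 hk
  have hmem : ∀ {t}, T.Linked Z t₀ t → ∀ {z : ℍ}, dist z z₀ < r →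
      (∀ k ∈ Z, 0 ≤ lineForm (T.form t₀ k) (klein z)) → klein z ∈ T.poly t := by
    intro t ht z hz h k
    by_cases hk : k ∈ Z
    · have := h k hk
      rwa [← hform ht hk] at this
    · exact (hball z hz t ht k hk).le
  -- The chart and its inverse choose a tile; `hF` and `hGi` show that the choice is irrelevant
  -- where it matters, and the default values lie outside the domains.
  let F : T.Surface → ℍ := fun x =>
    if h : ∃ t, T.Linked Z t₀ t ∧ ∃ q, T.pt t q = x then D h.choose • unklein (T.fold x) else I
  have hF : ∀ t, T.Linked Z t₀ t → ∀ q : T.poly t, (q : Fin 2 → ℝ) ∈ T.near t₀ p₀ →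
      F (T.pt t q) = D t • unklein q := by
    intro t ht q hq
    have h : ∃ t', T.Linked Z t₀ t' ∧ ∃ q', T.pt t' q' = T.pt t q := ⟨t, ht, q, rfl⟩
    have hc := h.choose_spec
    change (if h : ∃ t', T.Linked Z t₀ t' ∧ ∃ q', T.pt t' q' = T.pt t q then
      D h.choose • unklein (T.fold (T.pt t q)) else I) = _
    rw [dif_pos h, fold_pt]
    obtain ⟨q', hq'⟩ := hc.2
    obtain ⟨e1, e2⟩ := T.pt_eq_iff.1 hq'.symm
    refine hD.smul_eq ht (zeros_subset_of_near ht hq) e2 fun k hk => ?_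
    rw [klein_unklein (T.sq_lt_of_mem_poly q.2), ← hform ht (zeros_subset_of_near ht hq hk)]
    exact hk
  let Gi : ℍ → T.Surface := fun y =>
    if h : ∃ t, T.Linked Z t₀ t ∧ ∃ hq : klein ((D t)⁻¹ • y) ∈ T.poly t, True then
      T.pt h.choose ⟨_, h.choose_spec.2.choose⟩ else T.pt t₀ p₀
  have hGi : ∀ y, dist y y₀ < r → ∀ t, T.Linked Z t₀ t →
      ∀ hq : klein ((D t)⁻¹ • y) ∈ T.poly t, Gi y = T.pt t ⟨_, hq⟩ := by
    intro y hy t ht hq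
    have h : ∃ t, T.Linked Z t₀ t ∧ ∃ hq : klein ((D t)⁻¹ • y) ∈ T.poly t, True :=
      ⟨t, ht, hq, trivial⟩
    change (if h : ∃ t, T.Linked Z t₀ t ∧ ∃ hq : klein ((D t)⁻¹ • y) ∈ T.poly t, True then
      T.pt h.choose ⟨_, h.choose_spec.2.choose⟩ else T.pt t₀ p₀) = _
    rw [dif_pos h]
    have ht' := h.choose_spec.1
    have hq' := h.choose_spec.2.choose
    have hpos : ∀ t, T.Linked Z t₀ t → klein ((D t)⁻¹ • y) ∈ T.poly t →
        ∀ k ∈ Z, 0 ≤ lineForm (T.form t₀ k) (klein ((D t)⁻¹ • y)) := fun t ht hq k hk => by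
      rw [← hform ht hk]
      exact hq k
    obtain ⟨e1, e2⟩ := hinj _ _ ht' ht _ _ (hpos _ ht' hq') (hpos _ ht hq)
      (by rw [smul_inv_smul, smul_inv_smul])
    refine T.pt_eq_iff.2 ⟨congrArg klein e1, e2.mono ?_⟩
    rintro k ⟨hk, hk'⟩
    change lineForm (T.form _ k) _ = 0
    rw [hform ht' hk]
    exact hk'
  have hcov : ∀ y, dist y y₀ < r → ∃ t, T.Linked Z t₀ t ∧ klein ((D t)⁻¹ • y) ∈ T.poly t := by
    intro y hy
    obtain ⟨t, ht, h⟩ := hcover y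
    exact ⟨t, ht, hmem ht (by rw [hdist' t ht]; exact hy) h⟩
  have hkO : ∀ z : ℍ, dist z z₀ < r → klein z ∈ O := fun z hz =>
    ⟨by
      have : klein z 1 - klein z 0 ^ 2 = z.im ^ 2 := by simp
      have h2 := pow_pos z.im_pos 2
      change klein z 0 ^ 2 < klein z 1
      linarith, by
      change unklein (klein z) ∈ Metric.ball z₀ r
      rw [unklein_klein]
      exact hz⟩
  let φ : OpenPartialHomeomorph T.Surface ℍ :=
    { toFun := F
      invFun := Gi
      source := T.patch t₀ p₀ O
      target := Metric.ball y₀ r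
      map_source' := by
        rintro _ ⟨t, ht, q, hq, rfl⟩
        rw [hF t ht q (hOn hq), Metric.mem_ball, hdist t ht]
        exact hq.2
      map_target' := by
        intro y hy
        obtain ⟨t, ht, hq⟩ := hcov y hy
        rw [hGi y hy t ht hq]
        exact ⟨t, ht, _, hkO _ (by rw [hdist' t ht]; exact hy), rfl⟩
      left_inv' := by
        rintro _ ⟨t, ht, q, hq, rfl⟩
        rw [hF t ht q (hOn hq)]
        have h1 : klein ((D t)⁻¹ • D t • unklein (q : Fin 2 → ℝ)) = q := by
          rw [inv_smul_smul, klein_unklein hq.1]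
        rw [hGi _ (by rw [hdist t ht]; exact hq.2) t ht (by rw [h1]; exact q.2)]
        exact congrArg (T.pt t) (Subtype.ext h1)
      right_inv' := by
        intro y hy
        obtain ⟨t, ht, hq⟩ := hcov y hy
        rw [hGi y hy t ht hq, hF t ht _ (hOn (hkO _ (by rw [hdist' t ht]; exact hy))),
          unklein_klein, smul_inv_smul]
      open_source := isOpen_patch hOn hOo
      open_target := Metric.isOpen_ball
      continuousOn_toFun := by
        refine (continuousOn_open_iff (isOpen_patch hOn hOo)).2 fun A hA => T.isOpen_iff.2
          fun t => ?_
        by_cases ht : T.Linked Z t₀ t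
        · have : T.pt t ⁻¹' (T.patch t₀ p₀ O ∩ F ⁻¹' A) =
              Subtype.val ⁻¹' (O ∩ (fun q => D t • unklein q) ⁻¹' A) := by
            ext q
            rw [mem_preimage, mem_inter_iff, pt_mem_patch hOn, mem_preimage]
            constructor
            · rintro ⟨⟨-, h1⟩, h2⟩
              rw [hF t ht q (hOn h1)] at h2
              exact ⟨h1, h2⟩
            · rintro ⟨h1, h2⟩
              rw [hF t ht q (hOn h1)]
              exact ⟨⟨ht, h1⟩, h2⟩
          rw [this]
          refine IsOpen.preimage continuous_subtype_val ?_
          refine ContinuousOn.isOpen_inter_preimage ?_ hOo hA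
          exact (continuous_const_smul (D t)).comp_continuousOn
            (continuousOn_unklein.mono inter_subset_left)
        · have : T.pt t ⁻¹' (T.patch t₀ p₀ O ∩ F ⁻¹' A) = ∅ := by
            ext q
            rw [mem_preimage, mem_inter_iff, pt_mem_patch hOn]
            exact iff_of_false (fun h => ht h.1.1) (notMem_empty _)
          rw [this]
          exact isOpen_empty
      continuousOn_invFun := by
        -- The target is a finite union of relatively closed pieces, one for each tile, and on each
        -- piece the inverse is a composition of continuous maps.
        have hU : Metric.ball y₀ r = ⋃ t : {t // T.Linked Z t₀ t},
            {y | dist y y₀ < r ∧ klein ((D t)⁻¹ • y) ∈ T.poly t} := by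
          ext y
          simp only [mem_iUnion, Metric.mem_ball]
          constructor
          · intro hy
            obtain ⟨t, ht, hq⟩ := hcov y hy
            exact ⟨⟨t, ht⟩, hy, hq⟩
          · rintro ⟨t, ht⟩
            exact ht.1
        intro y hy
        rw [hU]
        unfold ContinuousWithinAt
        rw [nhdsWithin_iUnion, Filter.tendsto_iSup]
        rintro ⟨t, ht⟩
        by_cases hq : klein ((D t)⁻¹ • y) ∈ T.poly t
        · have hc : ContinuousOn Gi {y | dist y y₀ < r ∧ klein ((D t)⁻¹ • y) ∈ T.poly t} := by
            rw [continuousOn_iff_continuous_domRestrict]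
            have h1 : Continuous fun w : {y | dist y y₀ < r ∧ klein ((D t)⁻¹ • y) ∈ T.poly t} =>
                T.pt t ⟨klein ((D t)⁻¹ • (w : ℍ)), w.2.2⟩ := by
              refine (T.continuous_pt t).comp (Continuous.subtype_mk ?_ _)
              exact continuous_klein.comp ((continuous_const_smul _).comp continuous_subtype_val)
            refine h1.congr fun w => ?_
            exact (hGi w w.2.1 t ht w.2.2).symm
          exact hc y ⟨hy, hq⟩
        · have h1 : IsClosed {y : ℍ | klein ((D t)⁻¹ • y) ∈ T.poly t} :=
            (isClosed_pentagon _ _).preimage (continuous_klein.comp (continuous_const_smul _))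
          have h2 : 𝓝[{y | dist y y₀ < r ∧ klein ((D t)⁻¹ • y) ∈ T.poly t}] y = ⊥ := by
            rw [← notMem_closure_iff_nhdsWithin_eq_bot]
            intro h
            exact hq (closure_minimal (fun w hw => hw.2) h1 h)
          rw [h2]
          exact Filter.tendsto_bot }
  refine ⟨φ, ?_, ?_⟩
  · rintro t p ⟨t', ht', p', hp', hpp⟩
    obtain ⟨e1, e2⟩ := T.pt_eq_iff.1 hpp
    have hsub := zeros_subset_of_near ht' (hOn hp')
    have ht : T.Linked Z t₀ t := ht'.trans (e2.mono hsub)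
    have hpO : (p : Fin 2 → ℝ) ∈ O := e1 ▸ hp'
    have hsub' : T.zeros t p ⊆ Z := zeros_subset_of_near ht (hOn hpO)
    refine ⟨D, ⟨fun s hs => hD.det_pos s (ht.trans (hs.mono hsub')),
      fun s hs => hD.det_neg s (ht.trans (hs.mono hsub')), fun s hs k hk z => ?_⟩, fun s hs => ?_⟩
    · rw [hform ht (hsub' hk)]
      exact hD.cross s (ht.trans (hs.mono hsub')) k (hsub' hk) z
    · filter_upwards [hOo.mem_nhds hpO] with q hq hqs
      exact hF s (ht.trans (hs.mono hsub')) ⟨q, hqs⟩ (hOn hq)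
  · refine ⟨t₀, Linked.refl _ _, p₀, ⟨hp₀, ?_⟩, rfl⟩
    change dist z₀ z₀ < r
    rw [dist_self]
    exact hr

end FiniteGraph.TileSystem

/-! ### Charts at interior points, on sides and at right-angled corners -/

namespace UpperHalfPlane

lemma eq_of_lineForm_proportional {z w : ℍ} {a b : ℝ} (ha : a ≠ 0)
    (h : ∀ l, lineForm l (klein z) * a = lineForm l (klein w) * b) : z = w := by
  have h1 : a = b := by simpa [lineForm] using h (0, 0, 1)
  have hX := h (0, 1, 0)
  have hN := h (1, 0, 0)
  rw [← h1] at hX hN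
  simp only [lineForm, zero_mul, zero_add, add_zero, one_mul] at hX hN
  rw [← unklein_klein z, ← unklein_klein w]
  refine congrArg unklein (funext fun i => ?_)
  fin_cases i
  · exact mul_right_cancel₀ ha hX
  · exact mul_right_cancel₀ ha hN

/-- The formula for the action on forms is symmetric in the two reflections once the mixed pairing
vanishes, so both compositions give proportional, hence equal, coordinates. -/
lemma mirror_comm {l l' : ℝ × ℝ × ℝ} (h : 0 < lineDisc l) (h' : 0 < lineDisc l')
    (hp : linePairing l l' = 0) (z : ℍ) :
    mirror l • mirror l' • z = mirror l' • mirror l • z := by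
  have hp' : linePairing l' l = 0 := by rw [← hp, linePairing, linePairing]; ring
  obtain ⟨c, hc, H⟩ := lineForm_mirror_smul h z
  obtain ⟨c', hc', H'⟩ := lineForm_mirror_smul h' z
  obtain ⟨d, hd, K⟩ := lineForm_mirror_smul h (mirror l' • z)
  obtain ⟨d', hd', K'⟩ := lineForm_mirror_smul h' (mirror l • z)
  refine eq_of_lineForm_proportional (a := d * c') (b := d' * c) (mul_pos hd hc').ne' fun f => ?_
  have e1 := H l'
  have e2 := H' l
  rw [hp] at e1
  rw [hp'] at e2
  linear_combination c' * K f + lineDisc l * H' f + linePairing l f * e2 - c * K' f -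
    lineDisc l' * H f - linePairing l' f * e1

lemma mirror_inv_smul {l : ℝ × ℝ × ℝ} (h : 0 < lineDisc l) (z : ℍ) :
    (mirror l)⁻¹ • z = mirror l • z := by
  rw [inv_smul_eq_iff, mirror_mirror_smul h]

end UpperHalfPlane

namespace FiniteGraph.TileSystem

open UpperHalfPlane

variable {G : FiniteGraph.{0}} {T : G.TileSystem}

/-- An isometry with prescribed effect on orientations. -/
noncomputable def orient (b : Bool) : GL (Fin 2) ℝ := if b then 1 else J

lemma orient_det_pos {b : Bool} (h : b = true) : 0 < (orient b).det.val := by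
  simp [orient, h]

lemma orient_det_neg {b : Bool} (h : b = false) : (orient b).det.val < 0 := by
  simp [orient, h]

lemma linked_empty {t t' : G.Tile} (h : T.Linked ∅ t t') : t' = t :=
  h.induct (P := fun t' => t' = t) rfl fun _ _ _ _ hk => absurd hk (notMem_empty _)

lemma exists_chart_of_empty {t₀ : G.Tile} (p₀ : T.poly t₀) (hZ : T.zeros t₀ p₀ = ∅) :
    ∃ φ ∈ T.charts, T.pt t₀ p₀ ∈ φ.source := by
  refine exists_chart p₀ (D := fun _ => orient (sgn t₀)) ⟨?_, ?_, ?_⟩ ?_ ?_ <;> rw [hZ]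
  · intro t ht h
    rw [linked_empty ht] at h
    exact orient_det_pos h
  · intro t ht h
    rw [linked_empty ht] at h
    exact orient_det_neg h
  · intro t _ k hk
    exact absurd hk (notMem_empty _)
  · exact fun y => ⟨t₀, Linked.refl _ _, fun k hk => absurd hk (notMem_empty _)⟩
  · intro t t' ht ht' z z' _ _ h
    rw [linked_empty ht, linked_empty ht']
    exact ⟨MulAction.injective _ h, Linked.refl _ _⟩

lemma cross_ne_self (k : Fin 5) (t : G.Tile) : T.cross k t ≠ t := fun h => by
  have := congrArg sgn h
  rw [sgn_cross] at this
  exact Bool.not_ne_self _ this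

/-- Composition with the reflection in a line when `b` is true. -/
noncomputable def mirrorIf (b : Bool) (l : ℝ × ℝ × ℝ) : GL (Fin 2) ℝ := if b then mirror l else 1

lemma mirrorIf_inv_smul {l : ℝ × ℝ × ℝ} (h : 0 < lineDisc l) (b : Bool) (z : ℍ) :
    (mirrorIf b l)⁻¹ • z = mirrorIf b l • z := by
  cases b
  · simp [mirrorIf]
  · exact mirror_inv_smul h z

lemma mirrorIf_not_smul {l : ℝ × ℝ × ℝ} (h : 0 < lineDisc l) (b : Bool) (z : ℍ) :
    mirrorIf (!b) l • z = mirrorIf b l • mirror l • z := by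
  cases b
  · simp [mirrorIf]
  · simp [mirrorIf, mirror_mirror_smul h]

lemma mirrorIf_comm {l l' : ℝ × ℝ × ℝ} (h : 0 < lineDisc l) (h' : 0 < lineDisc l')
    (hp : linePairing l l' = 0) (b b' : Bool) (z : ℍ) :
    mirrorIf b l • mirrorIf b' l' • z = mirrorIf b' l' • mirrorIf b l • z := by
  cases b <;> cases b' <;> simp [mirrorIf, mirror_comm h h' hp]

lemma lineForm_mirrorIf_perp {l l' : ℝ × ℝ × ℝ} (h : 0 < lineDisc l) (hp : linePairing l l' = 0)
    (b : Bool) (z : ℍ) :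
    ∃ c : ℝ, 0 < c ∧ lineForm l' (klein (mirrorIf b l • z)) = c * lineForm l' (klein z) := by
  cases b
  · exact ⟨1, one_pos, by simp [mirrorIf]⟩
  · exact lineForm_mirror_perp h hp z

lemma lineForm_mirrorIf_self {l : ℝ × ℝ × ℝ} (h : 0 < lineDisc l) (b : Bool) (z : ℍ) :
    ∃ c : ℝ, 0 < c ∧ lineForm l (klein (mirrorIf b l • z)) =
      (if b then -1 else 1) * (c * lineForm l (klein z)) := by
  cases b
  · exact ⟨1, one_pos, by simp [mirrorIf]⟩
  · obtain ⟨c, hc, H⟩ := lineForm_mirror_self h z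
    exact ⟨c, hc, by simp [mirrorIf, H]⟩

lemma mirrorIf_smul_of_eq_zero {l : ℝ × ℝ × ℝ} (h : 0 < lineDisc l) (b : Bool) {z : ℍ}
    (hz : lineForm l (klein z) = 0) : mirrorIf b l • z = z := by
  cases b
  · simp [mirrorIf]
  · exact mirror_smul_of_lineForm_eq_zero h hz

lemma det_mirrorIf {l : ℝ × ℝ × ℝ} (h : 0 < lineDisc l) (b : Bool) :
    0 < (if b then -1 else 1) * (mirrorIf b l).det.val := by
  cases b
  · simp [mirrorIf]
  · have := det_mirror h
    simp only [mirrorIf]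
    simp only [if_true]
    linarith

/-- If `z` and `z'` lie on the same side of a line and become equal after reflecting only one of
them, they lie on the line. -/
lemma eq_zero_of_mirrorIf {l : ℝ × ℝ × ℝ} (h : 0 < lineDisc l) {b b' : Bool} (hb : b ≠ b')
    {z z' w w' : ℍ} (hz : 0 ≤ lineForm l (klein z)) (hz' : 0 ≤ lineForm l (klein z'))
    (hw : ∃ c : ℝ, 0 < c ∧ lineForm l (klein w) = c * lineForm l (klein z))
    (hw' : ∃ c : ℝ, 0 < c ∧ lineForm l (klein w') = c * lineForm l (klein z'))
    (he : mirrorIf b l • w = mirrorIf b' l • w') :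
    lineForm l (klein z) = 0 ∧ lineForm l (klein z') = 0 := by
  obtain ⟨c, hc, e⟩ := hw
  obtain ⟨c', hc', e'⟩ := hw'
  obtain ⟨d, hd, f⟩ := lineForm_mirrorIf_self h b w
  obtain ⟨d', hd', f'⟩ := lineForm_mirrorIf_self h b' w'
  rw [he, f', e', e, ← mul_assoc, ← mul_assoc] at f
  have h1 := mul_pos hd hc
  have h2 := mul_pos hd' hc'
  have h3 := mul_nonneg h1.le hz
  have h4 := mul_nonneg h2.le hz'
  have h5 : d * c * lineForm l (klein z) = 0 ∧ d' * c' * lineForm l (klein z') = 0 := by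
    revert f hb
    cases b <;> cases b' <;> simp only [ne_eq, not_true_eq_false, false_imp_iff, if_true,
      not_false_eq_true, true_imp_iff, reduceCtorEq, Bool.false_eq_true, if_false] <;> intro f <;>
      constructor <;> linarith
  exact ⟨(mul_eq_zero.1 h5.1).resolve_left h1.ne', (mul_eq_zero.1 h5.2).resolve_left h2.ne'⟩

/-- The orientation character of a product of reflections. -/
lemma det_orient_mul {l l' : ℝ × ℝ × ℝ} (h : 0 < lineDisc l) (h' : 0 < lineDisc l')
    (b s s' : Bool) : 0 < (if xor b (xor s s') then 1 else -1) *
      (orient b * (mirrorIf s l * mirrorIf s' l')).det.val := by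
  have h1 := det_mirrorIf h s
  have h2 := det_mirrorIf h' s'
  have h3 : 0 < (if b then 1 else -1) * (orient b).det.val := by
    cases b <;> simp [orient]
  simp only [map_mul, Units.val_mul]
  have := mul_pos h3 (mul_pos h1 h2)
  refine this.trans_eq ?_
  cases b <;> cases s <;> cases s' <;> simp

/-- Charts at points that lie on one side, or at corners with a right angle. The functions `s` and
`s'` count the crossings of the two sides modulo 2. -/
lemma exists_chart_of_perp {t₀ : G.Tile} (p₀ : T.poly t₀) {k k' : Fin 5} {Z : Set (Fin 5)}
    (hZ : T.zeros t₀ p₀ = Z) (hk : ∀ j ∈ Z, j = k ∨ j = k') (hkk : k ≠ k')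
    (hperp : linePairing (T.form t₀ k) (T.form t₀ k') = 0) (s s' : G.Tile → Bool)
    (hs₀ : s t₀ = false) (hs₀' : s' t₀ = false)
    (hs : ∀ t, T.Linked Z t₀ t → k ∈ Z → s (T.cross k t) = (!s t) ∧ s' (T.cross k t) = s' t)
    (hs' : ∀ t, T.Linked Z t₀ t → k' ∈ Z → s (T.cross k' t) = s t ∧ s' (T.cross k' t) = !s' t)
    (hcross : ∀ t t', T.Linked Z t₀ t → T.Linked Z t₀ t' → s t = s t' → s' t = s' t' → t = t') :
    ∃ φ ∈ T.charts, T.pt t₀ p₀ ∈ φ.source := by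
  have hd := T.disc_form_pos t₀ k
  have hd' := T.disc_form_pos t₀ k'
  have hperp' : linePairing (T.form t₀ k') (T.form t₀ k) = 0 := by
    rw [← hperp, linePairing, linePairing]; ring
  set l := T.form t₀ k with hl
  set l' := T.form t₀ k' with hl'
  have hval : ∀ t, T.Linked Z t₀ t → sgn t = xor (sgn t₀) (xor (s t) (s' t)) ∧
      (k ∉ Z → s t = false) ∧ (k' ∉ Z → s' t = false) := by
    intro t ht
    refine ht.induct (P := fun t => sgn t = xor (sgn t₀) (xor (s t) (s' t)) ∧
      (k ∉ Z → s t = false) ∧ (k' ∉ Z → s' t = false)) ?_ ?_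
    · simp [hs₀, hs₀']
    · rintro r hr ⟨h1, h2, h3⟩ j hj
      rcases hk j hj with rfl | rfl
      · obtain ⟨e1, e2⟩ := hs r hr hj
        rw [sgn_cross, e1, e2, h1]
        refine ⟨?_, fun h => absurd hj h, h3⟩
        cases sgn t₀ <;> cases s r <;> cases s' r <;> rfl
      · obtain ⟨e1, e2⟩ := hs' r hr hj
        rw [sgn_cross, e1, e2, h1]
        refine ⟨?_, h2, fun h => absurd hj h⟩
        cases sgn t₀ <;> cases s r <;> cases s' r <;> rfl
  -- The two reflections commute, so the parities `s`, `s'` of the crossings describe the whole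
  -- unfolding; the orientation factor corrects the sign at the starting tile.
  refine exists_chart p₀ (D := fun t => orient (sgn t₀) * (mirrorIf (s t) l * mirrorIf (s' t) l'))
    ⟨?_, ?_, ?_⟩ ?_ ?_ <;> rw [hZ]
  · intro t ht h
    have h1 := det_orient_mul hd hd' (sgn t₀) (s t) (s' t)
    rw [← (hval t ht).1, h, if_pos rfl, one_mul] at h1
    exact h1
  · intro t ht h
    have h1 := det_orient_mul hd hd' (sgn t₀) (s t) (s' t)
    rw [← (hval t ht).1, h, if_neg (by decide), neg_one_mul] at h1
    exact neg_pos.1 h1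
  · intro t ht j hj z
    rcases hk j hj with rfl | rfl
    · obtain ⟨e1, e2⟩ := hs t ht hj
      rw [e1, e2, mul_smul, mul_smul, mirrorIf_not_smul hd, ← hl, mul_smul, mul_smul]
      congr 2
      have := mirrorIf_comm hd hd' hperp true (s' t) z
      simpa [mirrorIf] using this
    · obtain ⟨e1, e2⟩ := hs' t ht hj
      rw [e1, e2, mul_smul, mul_smul, mirrorIf_not_smul hd', ← hl', mul_smul, mul_smul]
  · intro y
    set w := (orient (sgn t₀))⁻¹ • y with hw
    -- realize the required crossings
    obtain ⟨t, ht, e1, e2⟩ : ∃ t, T.Linked Z t₀ t ∧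
        (k ∈ Z → s t = decide (lineForm l (klein w) < 0)) ∧
        (k' ∈ Z → s' t = decide (lineForm l' (klein w) < 0)) := by
      obtain ⟨t₁, ht₁, f1, f2⟩ : ∃ t, T.Linked Z t₀ t ∧
          (k ∈ Z → s t = decide (lineForm l (klein w) < 0)) ∧ s' t = false := by
        by_cases hkZ : k ∈ Z
        · by_cases hneg : lineForm l (klein w) < 0
          · obtain ⟨g1, g2⟩ := hs t₀ (Linked.refl _ _) hkZ
            exact ⟨_, Linked.cross hkZ t₀, fun _ => by rw [g1, hs₀]; simp [hneg], by rw [g2, hs₀']⟩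
          · exact ⟨t₀, Linked.refl _ _, fun _ => by rw [hs₀]; simp [hneg], hs₀'⟩
        · exact ⟨t₀, Linked.refl _ _, fun h => absurd h hkZ, hs₀'⟩
      by_cases hkZ : k' ∈ Z
      · by_cases hneg : lineForm l' (klein w) < 0
        · obtain ⟨g1, g2⟩ := hs' t₁ ht₁ hkZ
          exact ⟨_, ht₁.trans (Linked.cross hkZ t₁), fun h => by rw [g1, f1 h],
            fun _ => by rw [g2, f2]; simp [hneg]⟩
        · exact ⟨t₁, ht₁, f1, fun _ => by rw [f2]; simp [hneg]⟩
      · exact ⟨t₁, ht₁, f1, fun h => absurd h hkZ⟩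
    refine ⟨t, ht, fun j hj => ?_⟩
    have hinv : (orient (sgn t₀) * (mirrorIf (s t) l * mirrorIf (s' t) l'))⁻¹ • y =
        mirrorIf (s' t) l' • mirrorIf (s t) l • w := by
      rw [mul_inv_rev, mul_inv_rev, mul_smul, mul_smul, mirrorIf_inv_smul hd,
        mirrorIf_inv_smul hd']
    rw [hinv]
    rcases hk j hj with rfl | rfl
    · obtain ⟨c, hc, E1⟩ := lineForm_mirrorIf_perp hd' hperp' (s' t) (mirrorIf (s t) l • w)
      obtain ⟨c', hc', E2⟩ := lineForm_mirrorIf_self hd (s t) w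
      rw [← hl, E1, E2, e1 hj]
      refine mul_nonneg hc.le ?_
      by_cases hneg : lineForm l (klein w) < 0
      · simp only [hneg, decide_true, if_true]
        nlinarith
      · simp only [hneg, decide_false, Bool.false_eq_true, if_false, one_mul]
        exact mul_nonneg hc'.le (not_lt.1 hneg)
    · rw [← mirrorIf_comm hd hd' hperp]
      obtain ⟨c, hc, E1⟩ := lineForm_mirrorIf_perp hd hperp (s t) (mirrorIf (s' t) l' • w)
      obtain ⟨c', hc', E2⟩ := lineForm_mirrorIf_self hd' (s' t) w
      rw [← hl', E1, E2, e2 hj]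
      refine mul_nonneg hc.le ?_
      by_cases hneg : lineForm l' (klein w) < 0
      · simp only [hneg, decide_true, if_true]
        nlinarith
      · simp only [hneg, decide_false, Bool.false_eq_true, if_false, one_mul]
        exact mul_nonneg hc'.le (not_lt.1 hneg)
  · intro t t' ht ht' z z' hz hz' h
    rw [mul_smul, mul_smul, mul_smul, mul_smul] at h
    have h1 := MulAction.injective _ h
    have key : ∀ (t₁ : G.Tile), T.Linked Z t₀ t₁ → k ∈ Z → s t₁ ≠ s t' → s' t₁ = s' t' →
        T.cross k t₁ = t' := fun t₁ ht₁ hkZ hne heq => by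
      obtain ⟨g1, g2⟩ := hs t₁ ht₁ hkZ
      refine hcross _ _ (ht₁.trans (Linked.cross hkZ t₁)) ht' ?_ (g2.trans heq)
      rw [g1]
      revert hne
      cases s t₁ <;> cases s t' <;> simp
    have key' : ∀ (t₁ : G.Tile), T.Linked Z t₀ t₁ → k' ∈ Z → s t₁ = s t' → s' t₁ ≠ s' t' →
        T.cross k' t₁ = t' := fun t₁ ht₁ hkZ heq hne => by
      obtain ⟨g1, g2⟩ := hs' t₁ ht₁ hkZ
      refine hcross _ _ (ht₁.trans (Linked.cross hkZ t₁)) ht' (g1.trans heq) ?_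
      rw [g2]
      revert hne
      cases s' t₁ <;> cases s' t' <;> simp
    have hkZ : s t ≠ s t' → k ∈ Z := fun hne => by
      by_contra hcon
      exact hne (((hval t ht).2.1 hcon).trans ((hval t' ht').2.1 hcon).symm)
    have hkZ' : s' t ≠ s' t' → k' ∈ Z := fun hne => by
      by_contra hcon
      exact hne (((hval t ht).2.2 hcon).trans ((hval t' ht').2.2 hcon).symm)
    -- If both parities agree, the tiles coincide. If one differs, the point lies on that line and a
    -- crossing there links the tiles. If both differ, the point lies on both lines and two
    -- crossings link them.
    by_cases hb : s t = s t'
    · rw [hb] at h1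
      have h2 := MulAction.injective _ h1
      by_cases hb' : s' t = s' t'
      · rw [hb'] at h2
        rw [hcross t t' ht ht' hb hb']
        exact ⟨MulAction.injective _ h2, Linked.refl _ _⟩
      · have hZ' := hkZ' hb'
        obtain ⟨g1, g2⟩ := eq_zero_of_mirrorIf hd' hb' (hz k' hZ') (hz' k' hZ')
          ⟨1, one_pos, (one_mul _).symm⟩ ⟨1, one_pos, (one_mul _).symm⟩ h2
        rw [mirrorIf_smul_of_eq_zero hd' _ g1, mirrorIf_smul_of_eq_zero hd' _ g2] at h2
        rw [← key' t ht hZ' hb hb']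
        exact ⟨h2, Linked.cross
          (J := {j ∈ Z | lineForm (T.form t₀ j) (klein z) = 0}) ⟨hZ', g1⟩ t⟩
    · have hZk := hkZ hb
      obtain ⟨g1, g2⟩ := eq_zero_of_mirrorIf hd hb (hz k hZk) (hz' k hZk)
        (lineForm_mirrorIf_perp hd' hperp' (s' t) z) (lineForm_mirrorIf_perp hd' hperp' (s' t') z')
        h1
      rw [mirrorIf_comm hd hd' hperp, mirrorIf_comm hd hd' hperp,
        mirrorIf_smul_of_eq_zero hd _ g1, mirrorIf_smul_of_eq_zero hd _ g2] at h1
      by_cases hb' : s' t = s' t'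
      · rw [hb'] at h1
        rw [← key t ht hZk hb hb']
        exact ⟨MulAction.injective _ h1, Linked.cross
          (J := {j ∈ Z | lineForm (T.form t₀ j) (klein z) = 0}) ⟨hZk, g1⟩ t⟩
      · have hZ' := hkZ' hb'
        obtain ⟨g3, g4⟩ := eq_zero_of_mirrorIf hd' hb' (hz k' hZ') (hz' k' hZ')
          ⟨1, one_pos, (one_mul _).symm⟩ ⟨1, one_pos, (one_mul _).symm⟩ h1
        rw [mirrorIf_smul_of_eq_zero hd' _ g3, mirrorIf_smul_of_eq_zero hd' _ g4] at h1
        obtain ⟨f1, f2⟩ := hs' t ht hZ'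
        have h3 : s' (T.cross k' t) = s' t' := by
          rw [f2]
          revert hb'
          cases s' t <;> cases s' t' <;> simp
        rw [← key _ (ht.trans (Linked.cross hZ' t)) hZk (f1.symm ▸ hb) h3]
        exact ⟨h1, (Linked.cross (T := T)
          (J := {j ∈ Z | lineForm (T.form t₀ j) (klein z) = 0}) ⟨hZ', g3⟩ t).trans
          (Linked.cross
          (J := {j ∈ Z | lineForm (T.form t₀ j) (klein z) = 0}) ⟨hZk, g1⟩ _)⟩

/-- Around a right-angled corner the tiles close up after four steps. -/
lemma cross_comm {k : Fin 5} (hk : k ≠ 4) (t : G.Tile) :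
    T.cross k (T.cross (k + 1) t) = T.cross (k + 1) (T.cross k t) := by
  obtain ⟨e, a, ε⟩ := t
  fin_cases k
  · rfl
  · rfl
  · rfl
  · rfl
  · exact absurd rfl hk

lemma cross_ne_cross {k : Fin 5} (hk : k ≠ 4) (t : G.Tile) :
    T.cross k t ≠ T.cross (k + 1) t := by
  obtain ⟨e, a, ε⟩ := t
  intro h
  fin_cases k
  · exact G.rev_ne e (congrArg Prod.fst h).symm
  · exact G.rev_ne e (congrArg Prod.fst h)
  · have := congrArg (fun t => t.2.1) h
    revert this
    cases a <;> simp [cross]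
  · have := congrArg (fun t => t.2.1) h
    revert this
    cases a <;> simp [cross]
  · exact hk rfl

/-- Only `k` is ever crossed; `k'` is an auxiliary perpendicular side that brings this case under
the statement for two sides, with second parity constantly `false`. -/
lemma exists_chart_of_singleton {t₀ : G.Tile} (p₀ : T.poly t₀) {k k' : Fin 5} (hk1 : k ≠ k')
    (hperp : linePairing (T.form t₀ k) (T.form t₀ k') = 0) (hZ : T.zeros t₀ p₀ = {k}) : ∃ φ ∈ T.charts, T.pt t₀ p₀ ∈ φ.source := by
  classical
  have hclass : ∀ t, T.Linked {k} t₀ t → t = t₀ ∨ t = T.cross k t₀ := by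
    intro t ht
    refine ht.induct (P := fun t => t = t₀ ∨ t = T.cross k t₀) (Or.inl rfl) ?_
    rintro s - (rfl | rfl) j rfl
    · exact Or.inr rfl
    · exact Or.inl (T.cross_cross _ _)
  have hne := cross_ne_self (T := T) k t₀
  refine exists_chart_of_perp p₀ (k := k) (k' := k') hZ (fun j hj => Or.inl hj)
    hk1 hperp (fun t => decide (t ≠ t₀)) (fun _ => false)
    (by simp) rfl ?_ ?_ ?_
  · intro t ht _
    rcases hclass t ht with rfl | rfl
    · simp [hne]
    · simp [hne]
  · intro t _ h
    exact absurd (mem_singleton_iff.1 h).symm hk1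
  · intro t t' ht ht' h _
    rcases hclass t ht with rfl | rfl <;> rcases hclass t' ht' with rfl | rfl <;> simp_all

/-- The tiles at the corner are `t₀`, its two neighbours `a`, `b` and the opposite tile `c`. They
are distinct and permuted by a Klein four-group, so the two parities separate them. -/
lemma exists_chart_of_pair {t₀ : G.Tile} (p₀ : T.poly t₀) {k : Fin 5} (hk4 : k ≠ 4)
    (hZ : T.zeros t₀ p₀ = {k, k + 1}) : ∃ φ ∈ T.charts, T.pt t₀ p₀ ∈ φ.source := by
  classical
  have hk1 : k ≠ k + 1 := by clear hZ hk4; revert k; decide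
  obtain ⟨a, ha⟩ : ∃ a, T.cross k t₀ = a := ⟨_, rfl⟩
  obtain ⟨b, hb⟩ : ∃ b, T.cross (k + 1) t₀ = b := ⟨_, rfl⟩
  obtain ⟨c, hc⟩ : ∃ c, T.cross k b = c := ⟨_, rfl⟩
  have hca : T.cross (k + 1) a = c := by rw [← ha, ← cross_comm hk4, hb, hc]
  have hka : T.cross k a = t₀ := by rw [← ha, T.cross_cross]
  have hkb : T.cross (k + 1) b = t₀ := by rw [← hb, T.cross_cross]
  have hkc : T.cross k c = b := by rw [← hc, T.cross_cross]
  have hkc' : T.cross (k + 1) c = a := by rw [← hca, T.cross_cross]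
  have hclass : ∀ t, T.Linked {k, k + 1} t₀ t → t = t₀ ∨ t = a ∨ t = b ∨ t = c := by
    intro t ht
    refine ht.induct (P := fun t => t = t₀ ∨ t = a ∨ t = b ∨ t = c) (Or.inl rfl) ?_
    rintro s - hs j (rfl | rfl) <;> rcases hs with rfl | rfl | rfl | rfl <;>
      simp only [ha, hb, hc, hca, hka, hkb, hkc, hkc', true_or, or_true]
  have h1 : a ≠ t₀ := ha ▸ cross_ne_self _ _
  have h2 : b ≠ t₀ := hb ▸ cross_ne_self _ _
  have h3 : c ≠ b := hc ▸ cross_ne_self _ _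
  have h4 : c ≠ a := hca ▸ cross_ne_self _ _
  have h5 : a ≠ b := by rw [← ha, ← hb]; exact cross_ne_cross hk4 _
  have h6 : c ≠ t₀ := fun h => h5 (by rw [← ha, ← h, hkc])
  refine exists_chart_of_perp p₀ (k := k) (k' := k + 1) hZ (fun j hj => hj)
    hk1 (side_perp k hk4) (fun t => decide (t = a ∨ t = c))
    (fun t => decide (t = b ∨ t = c)) (by simp [h1.symm, h6.symm]) (by simp [h2.symm, h6.symm])
    ?_ ?_ ?_
  · intro t ht _
    rcases hclass t ht with h | h | h | h <;> rw [h] <;>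
      simp [ha, hc, hka, hkc, h1.symm, h2.symm, h3, h4, h5, h3.symm, h4.symm, h5.symm, h6.symm]
  · intro t ht _
    rcases hclass t ht with h | h | h | h <;> rw [h] <;>
      simp [hb, hca, hkb, hkc', h1.symm, h2.symm, h3, h4, h5, h3.symm, h4.symm, h5.symm, h6.symm]
  · intro t t' ht ht' e1 e2
    rcases hclass t ht with h | h | h | h <;> rcases hclass t' ht' with h' | h' | h' | h' <;>
      rw [h, h'] at e1 e2 ⊢ <;> simp [h3, h4, h5, h1.symm, h2.symm, h3.symm,
      h4.symm, h5.symm, h6.symm] at e1 e2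

end FiniteGraph.TileSystem

/-! ### The disc model: rotations and dihedral sectors -/

namespace UpperHalfPlane

/-- The coordinate in the disc model centred at `m * I`. -/
noncomputable def disc (m : ℝ) (z : ℍ) : ℂ := (z - m * Complex.I) / (z + m * Complex.I)

lemma add_mul_I_ne_zero {m : ℝ} (hm : 0 < m) (z : ℍ) : (z : ℂ) + m * Complex.I ≠ 0 := fun h => by
  have h1 := congrArg Complex.im h
  have h2 := z.im_pos
  simp at h1
  linarith

lemma disc_injective {m : ℝ} (hm : 0 < m) : Function.Injective (disc m) := fun z w h => by
  have hz := add_mul_I_ne_zero hm z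
  have hw := add_mul_I_ne_zero hm w
  rw [disc, disc, div_eq_div_iff hz hw] at h
  have h1 : (2 * m * Complex.I) * ((z : ℂ) - w) = 0 := by linear_combination h
  have h2 : (2 * m * Complex.I : ℂ) ≠ 0 := by simp [hm.ne']
  exact UpperHalfPlane.ext (sub_eq_zero.1 ((mul_eq_zero.1 h1).resolve_left h2))

/-- The rotation by `α` around `m * I`. -/
noncomputable def rot (m α : ℝ) : GL (Fin 2) ℝ :=
  if h : 0 < m then
    .mkOfDetNeZero !![Real.cos (α / 2), m * Real.sin (α / 2);
      -(Real.sin (α / 2) / m), Real.cos (α / 2)] (by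
      have : Real.cos (α / 2) * Real.cos (α / 2) - m * Real.sin (α / 2) * -(Real.sin (α / 2) / m)
          = 1 := by
        field_simp
        linarith [Real.sin_sq_add_cos_sq (α / 2)]
      rw [Matrix.det_fin_two_of, this]
      exact one_ne_zero)
  else 1

lemma det_rot (m α : ℝ) : (rot m α).det.val = 1 := by
  by_cases h : 0 < m
  · rw [rot, dif_pos h, Matrix.GeneralLinearGroup.val_det_apply]
    change Matrix.det !![_, _; _, _] = _
    rw [Matrix.det_fin_two_of]
    field_simp
    linarith [Real.sin_sq_add_cos_sq (α / 2)]
  · simp [rot, h]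

lemma disc_rot_smul {m : ℝ} (hm : 0 < m) (α : ℝ) (z : ℍ) :
    disc m (rot m α • z) = Complex.exp (α * Complex.I) * disc m z := by
  have hd : 0 < (rot m α).det.val := by rw [det_rot]; exact one_pos
  have hz := add_mul_I_ne_zero hm z
  set c := Real.cos (α / 2) with hc
  set s := Real.sin (α / 2) with hs
  have hden : denom (rot m α) z ≠ 0 := denom_ne_zero _ z
  have hcoe : ((rot m α • z : ℍ) : ℂ) = (c * z + m * s) / (-(s / m) * z + c) := by
    rw [coe_smul, σ, if_pos hd, rot, dif_pos hm]
    simp [num, denom, hc, hs]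
  have hden' : (-(s / m) * z + c : ℂ) ≠ 0 := by
    rw [rot, dif_pos hm] at hden
    simpa [denom, hc, hs] using hden
  have hexp : Complex.exp (α * Complex.I) = (c + s * Complex.I) ^ 2 := by
    rw [hc, hs, Complex.ofReal_cos, Complex.ofReal_sin, ← Complex.exp_mul_I, ← Complex.exp_nat_mul]
    congr 1
    push_cast
    ring
  have hone : (c + s * Complex.I : ℂ) * (c - s * Complex.I) = 1 := by
    have : ((c ^ 2 + s ^ 2 : ℝ) : ℂ) = 1 := by
      rw [hc, hs, add_comm, Real.sin_sq_add_cos_sq]; simp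
    push_cast at this
    linear_combination this - s ^ 2 * Complex.I_sq
  have hm' : (m : ℂ) ≠ 0 := by exact_mod_cast hm.ne'
  have hz' := add_mul_I_ne_zero hm (rot m α • z)
  rw [eq_div_iff hden'] at hcoe
  set w := ((rot m α • z : ℍ) : ℂ)
  have e0 : (s / m : ℂ) * m = s := by field_simp
  -- Up to a common factor the rotation multiplies numerator and denominator of the disc coordinate
  -- by `c + s * I` and by its inverse `c - s * I`, hence the quotient by `(c + s * I) ^ 2`.
  have e1 : (w - m * Complex.I) * (-(s / m) * z + c) =
      (c + s * Complex.I) * (z - m * Complex.I) := by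
    linear_combination hcoe + z * Complex.I * e0 + m * s * Complex.I_sq
  have e2 : (w + m * Complex.I) * (-(s / m) * z + c) =
      (c - s * Complex.I) * (z + m * Complex.I) := by
    linear_combination hcoe - z * Complex.I * e0 + m * s * Complex.I_sq
  rw [disc, disc, hexp, mul_div_assoc', div_eq_div_iff hz' hz]
  refine mul_right_cancel₀ hden' ?_
  linear_combination (z + m * Complex.I) * e1 -
    (c + s * Complex.I) ^ 2 * (z - m * Complex.I) * e2 -
    (c + s * Complex.I) * (z - m * Complex.I) * (z + m * Complex.I) * hone

lemma disc_J_smul {m : ℝ} (z : ℍ) : disc m (J • z) = (starRingEnd ℂ) (disc m z) := by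
  rw [disc, disc, coe_J_smul, map_div₀]
  simp only [map_sub, map_add, map_mul, Complex.conj_ofReal, Complex.conj_I]
  rw [← neg_div_neg_eq]
  congr 1 <;> ring

lemma disc_mirror_leg_smul {m E M : ℝ} (z : ℍ) :
    disc m (mirror (side E M 0) • z) = (starRingEnd ℂ) (disc m z) := by
  rw [← disc_J_smul, disc, disc]
  have h : ((mirror (side E M 0) • z : ℍ) : ℂ) = (J • z : ℍ) := by
    rw [coe_mirror_smul (by norm_num [side, lineDisc]), coe_J_smul]
    simp [side]
    ring
  rw [h]

/-- In the disc centred at `m * I` the leg is the real diameter. The relation `hrel` says that side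
4 is the diameter in direction `exp (-φ * I)`, and reflecting in that diameter is conjugation
followed by rotation through `-2φ`. -/
lemma disc_mirror_spoke_smul {m E φ : ℝ} (hm : 0 < m) (hφ : 0 < Real.sin φ)
    (hrel : Real.sin φ * (1 - m ^ 2) = 4 * m * Real.cos φ) (z : ℍ) :
    disc m (mirror (side E (m ^ 2) 4) • z) =
      Complex.exp (-(2 * φ : ℝ) * Complex.I) * (starRingEnd ℂ) (disc m z) := by
  have hd : 0 < lineDisc (side E (m ^ 2) 4) := by
    have : 0 < m ^ 2 := by positivity
    simp only [side, lineDisc, Matrix.cons_val]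
    nlinarith [sq_nonneg (-((1 - m ^ 2) / 2))]
  set C := Real.cos φ with hC
  set S := Real.sin φ with hS
  set k : ℝ := (1 - m ^ 2) / 4 with hk
  have hSk : (S : ℂ) * k = m * C := by
    norm_cast
    rw [hk]
    linarith
  have hone : (C : ℂ) ^ 2 + S ^ 2 = 1 := by
    norm_cast
    rw [add_comm]
    exact Real.sin_sq_add_cos_sq φ
  have hexp : Complex.exp (-(2 * φ : ℝ) * Complex.I) = (C - S * Complex.I) ^ 2 := by
    have : (C - S * Complex.I : ℂ) = Complex.exp ((-φ : ℝ) * Complex.I) := by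
      rw [Complex.exp_mul_I, ← Complex.ofReal_cos, ← Complex.ofReal_sin, Real.cos_neg,
        Real.sin_neg, hC, hS]
      push_cast
      ring
    rw [this, ← Complex.exp_nat_mul]
    congr 1
    push_cast
    ring
  have hcoe := coe_mirror_smul hd z
  have hz := add_mul_I_ne_zero hm z
  have hzc : (starRingEnd ℂ) (z : ℂ) - m * Complex.I ≠ 0 := fun h => hz (by
    have := congrArg (starRingEnd ℂ) h
    simpa using this)
  have hz' := add_mul_I_ne_zero hm (mirror (side E (m ^ 2) 4) • z)
  have hden : (starRingEnd ℂ) (z : ℂ) - k ≠ 0 := fun h => by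
    have h1 := congrArg Complex.im h
    have h2 := z.im_pos
    simp at h1
    linarith
  set w := ((mirror (side E (m ^ 2) 4) • z : ℍ) : ℂ)
  set v := (starRingEnd ℂ) (z : ℂ)
  have hcoe' : w * (v - k) = k * v + m ^ 2 := by
    rw [← eq_div_iff hden, hcoe, hk]
    simp only [side, Matrix.cons_val]
    push_cast
    congr 1 <;> ring
  have e1 : (w - m * Complex.I) * (v - k) = (k - m * Complex.I) * (v + m * Complex.I) := by
    linear_combination hcoe' + m ^ 2 * Complex.I_sq
  have e2 : (w + m * Complex.I) * (v - k) = (k + m * Complex.I) * (v - m * Complex.I) := by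
    linear_combination hcoe' + m ^ 2 * Complex.I_sq
  -- By `hrel`, `k + m * I` is a positive multiple of `C + S * I`; the identity compares it with its
  -- conjugate.
  have e3 : (k - m * Complex.I : ℂ) = (C - S * Complex.I) ^ 2 * (k + m * Complex.I) := by
    have hS0 : (S : ℂ) ≠ 0 := by exact_mod_cast hφ.ne'
    refine mul_left_cancel₀ hS0 ?_
    linear_combination (1 - (C - S * Complex.I) ^ 2) * hSk -
      m * (C - S * Complex.I) * hone + m * (C - S * Complex.I) * S ^ 2 * Complex.I_sq
  rw [disc, disc, hexp, map_div₀]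
  simp only [map_sub, map_add, map_mul, Complex.conj_ofReal, Complex.conj_I]
  rw [mul_neg, sub_neg_eq_add, ← sub_eq_add_neg, mul_div_assoc', div_eq_div_iff hz' hzc]
  refine mul_right_cancel₀ hden ?_
  linear_combination (v - m * Complex.I) * e1 -
    (C - S * Complex.I) ^ 2 * (v + m * Complex.I) * e2 +
    (v + m * Complex.I) * (v - m * Complex.I) * e3

lemma disc_re_im {m : ℝ} (hm : 0 < m) (z : ℍ) : ∃ q : ℝ, 0 < q ∧
    (disc m z).re * q = z.re ^ 2 + z.im ^ 2 - m ^ 2 ∧ (disc m z).im * q = -(2 * m * z.re) := by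
  have hz := add_mul_I_ne_zero hm z
  have hy := z.im_pos
  have h : disc m z * (z + m * Complex.I) = z - m * Complex.I := by
    rw [disc, div_mul_cancel₀ _ hz]
  set ζ := disc m z
  have h1 := congrArg Complex.re h
  have h2 := congrArg Complex.im h
  simp at h1 h2
  refine ⟨z.re ^ 2 + (z.im + m) ^ 2, by positivity, ?_, ?_⟩
  · linear_combination z.re * h1 + (z.im + m) * h2
  · linear_combination z.re * h2 - (z.im + m) * h1

lemma lineForm_leg_klein {m E M : ℝ} (hm : 0 < m) (z : ℍ) :
    ∃ q : ℝ, 0 < q ∧ (disc m z).im = -(q * lineForm (side E M 0) (klein z)) := by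
  obtain ⟨q, hq, -, h⟩ := disc_re_im hm z
  refine ⟨2 * m / q, by positivity, ?_⟩
  rw [(side_form _ _ _).1, klein_zero]
  field_simp
  linarith

lemma lineForm_spoke_klein {m E φ : ℝ} (hm : 0 < m) (hφ : 0 < Real.sin φ)
    (hrel : Real.sin φ * (1 - m ^ 2) = 4 * m * Real.cos φ) (z : ℍ) :
    ∃ q : ℝ, 0 < q ∧ (Complex.exp (φ * Complex.I) * disc m z).im =
      q * lineForm (side E (m ^ 2) 4) (klein z) := by
  obtain ⟨q, hq, h1, h2⟩ := disc_re_im hm z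
  refine ⟨Real.sin φ / q, by positivity, ?_⟩
  rw [(side_form _ _ _).2.2.2.2, klein_zero, klein_one, Complex.mul_im, Complex.exp_ofReal_mul_I_re,
    Complex.exp_ofReal_mul_I_im]
  field_simp
  linear_combination 2 * Real.cos φ * h2 + 2 * Real.sin φ * h1 + z.re * hrel

/-- The sector in the disc model that is covered by a tile near the vertex. -/
def sector (φ : ℝ) : Set ℂ := {ζ | ζ.im ≤ 0 ∧ 0 ≤ (Complex.exp (φ * Complex.I) * ζ).im}

lemma exp_mul_I_mul (x y r : ℝ) : Complex.exp (x * Complex.I) * (r * Complex.exp (y * Complex.I)) =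
    r * Complex.exp ((x + y : ℝ) * Complex.I) := by
  rw [mul_left_comm, ← Complex.exp_add]
  push_cast
  ring_nf

lemma im_mul_exp (r y : ℝ) : (r * Complex.exp (y * Complex.I)).im = r * Real.sin y := by
  rw [Complex.im_ofReal_mul, Complex.exp_ofReal_mul_I_im]

lemma exists_of_mem_sector {φ : ℝ} (h0 : 0 < φ) (h1 : φ < Real.pi / 2) {ζ : ℂ} (hζ : ζ ∈ sector φ) :
    ∃ r y : ℝ, 0 ≤ r ∧ -φ ≤ y ∧ y ≤ 0 ∧ ζ = r * Complex.exp (y * Complex.I) := by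
  obtain ⟨hi, hs⟩ := hζ
  rcases eq_or_ne ζ 0 with rfl | hne
  · exact ⟨0, 0, le_rfl, by linarith, le_rfl, by simp⟩
  have hr : 0 < ‖ζ‖ := norm_pos_iff.2 hne
  have he := Complex.norm_mul_exp_arg_mul_I ζ
  have a1 := Complex.neg_pi_lt_arg ζ
  have a2 := Complex.arg_le_pi ζ
  rw [← he, im_mul_exp] at hi
  rw [← he, exp_mul_I_mul, im_mul_exp] at hs
  have hi' : Real.sin ζ.arg ≤ 0 := by
    by_contra hcon
    exact absurd hi (not_le.2 (mul_pos hr (not_le.1 hcon)))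
  have hs' : 0 ≤ Real.sin (φ + ζ.arg) := by
    by_contra hcon
    exact absurd hs (not_le.2 (mul_neg_of_pos_of_neg hr (not_le.1 hcon)))
  refine ⟨‖ζ‖, ζ.arg, hr.le, ?_, ?_, he.symm⟩
  · by_contra hcon
    exact absurd hs' (not_le.2 (Real.sin_neg_of_neg_of_neg_pi_lt (by linarith) (by linarith)))
  · by_contra hcon
    rcases lt_or_eq_of_le a2 with h | h
    · exact absurd hi' (not_le.2 (Real.sin_pos_of_pos_of_lt_pi (not_le.1 hcon) h))
    · rw [h] at hs'
      exact absurd hs' (not_le.2 (by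
        rw [Real.sin_add_pi, neg_lt_zero]
        exact Real.sin_pos_of_pos_of_lt_pi h0 (by linarith [Real.pi_pos])))

lemma mem_sector {φ r y : ℝ} (h1 : φ < Real.pi / 2) (hr : 0 ≤ r) (hy : -φ ≤ y)
    (hy0 : y ≤ 0) : (r * Complex.exp (y * Complex.I) : ℂ) ∈ sector φ := by
  constructor
  · rw [im_mul_exp]
    exact mul_nonpos_of_nonneg_of_nonpos hr
      (Real.sin_nonpos_of_nonpos_of_neg_pi_le hy0 (by linarith [Real.pi_pos]))
  · rw [exp_mul_I_mul, im_mul_exp]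
    exact mul_nonneg hr (Real.sin_nonneg_of_nonneg_of_le_pi (by linarith)
      (by linarith [Real.pi_pos]))

lemma conj_mul_exp (r y : ℝ) : (starRingEnd ℂ) (r * Complex.exp (y * Complex.I)) =
    r * Complex.exp ((-y : ℝ) * Complex.I) := by
  rw [map_mul, Complex.conj_ofReal, ← Complex.exp_conj, map_mul, Complex.conj_ofReal,
    Complex.conj_I]
  push_cast
  ring_nf

/-- Rotations by multiples of `2 * φ` and reflections move any point into the sector. -/
lemma exists_rot_mem_sector {φ : ℝ} (h0 : 0 < φ) (h1 : φ < Real.pi / 2) (ζ : ℂ) :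
    ∃ j : ℤ, Complex.exp ((2 * φ * j : ℝ) * Complex.I) * ζ ∈ sector φ ∨
      (starRingEnd ℂ) (Complex.exp ((2 * φ * j : ℝ) * Complex.I) * ζ) ∈ sector φ := by
  have he := Complex.norm_mul_exp_arg_mul_I ζ
  -- Rotating by the nearest multiple of `2 * φ` brings the argument into `[-φ, φ]`; a conjugation
  -- then brings it into `[-φ, 0]` if necessary.
  set j : ℤ := -round (ζ.arg / (2 * φ)) with hj
  have hround := abs_le.1 (abs_sub_round (ζ.arg / (2 * φ)))
  have hy : 2 * φ * j + ζ.arg = 2 * φ * (ζ.arg / (2 * φ) - round (ζ.arg / (2 * φ))) := by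
    rw [hj]
    push_cast
    field_simp
    ring
  have hy1 : -φ ≤ 2 * φ * j + ζ.arg := by rw [hy]; nlinarith
  have hy2 : 2 * φ * j + ζ.arg ≤ φ := by rw [hy]; nlinarith
  refine ⟨j, ?_⟩
  rw [← he, exp_mul_I_mul]
  rcases le_total (2 * φ * j + ζ.arg) 0 with h | h
  · exact Or.inl (mem_sector h1 (norm_nonneg _) hy1 h)
  · right
    rw [conj_mul_exp]
    exact mem_sector h1 (norm_nonneg _) (by linarith) (by linarith)

lemma eq_of_mul_exp {r r' y y' : ℝ} (hr : 0 < r) (hr' : 0 ≤ r')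
    (h : (r * Complex.exp (y * Complex.I) : ℂ) = r' * Complex.exp (y' * Complex.I)) :
    r = r' ∧ ∃ k : ℤ, y = y' + 2 * Real.pi * k := by
  have hn := congrArg norm h
  rw [norm_mul, norm_mul, Complex.norm_exp_ofReal_mul_I, Complex.norm_exp_ofReal_mul_I,
    Complex.norm_real, Complex.norm_real, Real.norm_of_nonneg hr.le, Real.norm_of_nonneg hr',
    mul_one, mul_one] at hn
  refine ⟨hn, ?_⟩
  rw [← hn] at h
  have hr0 : (r : ℂ) ≠ 0 := by exact_mod_cast hr.ne'
  obtain ⟨k, hk⟩ := Complex.exp_eq_exp_iff_exists_int.1 (mul_left_cancel₀ hr0 h)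
  refine ⟨k, ?_⟩
  have := congrArg Complex.im hk
  simpa [mul_comm, mul_left_comm] using this

/-- The sector has opening `π / n`, smaller than the rotation step `2π / n`, so off the centre only
the trivial rotation can map one of its points into it. -/
lemma rot_sector_inj {n : ℕ} (hn : 3 ≤ n) {ζ ζ' : ℂ} (hζ : ζ ∈ sector (Real.pi / n))
    (hζ' : ζ' ∈ sector (Real.pi / n)) {j : ℤ}
    (h : ζ' = Complex.exp ((2 * (Real.pi / n) * j : ℝ) * Complex.I) * ζ) :
    ζ = ζ' ∧ (ζ = 0 ∨ (n : ℤ) ∣ j) := by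
  have hn0 : (0 : ℝ) < n := by exact_mod_cast (by omega : 0 < n)
  have hn3 : (3 : ℝ) ≤ n := by exact_mod_cast hn
  have h0 : 0 < Real.pi / n := by positivity
  have h1 : Real.pi / n < Real.pi / 2 := by
    have := Real.pi_pos
    gcongr
    linarith
  obtain ⟨r, y, hr, hy1, hy2, e⟩ := exists_of_mem_sector h0 h1 hζ
  obtain ⟨r', y', hr', hy1', hy2', e'⟩ := exists_of_mem_sector h0 h1 hζ'
  rcases hr.eq_or_lt with rfl | hr
  · simp only [Complex.ofReal_zero, zero_mul] at e
    rw [h, e]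
    simp
  rw [e, e', exp_mul_I_mul] at h
  obtain ⟨rfl, k, hk⟩ := eq_of_mul_exp hr hr' h.symm
  have hj : j - n * k = 0 := by
    have h2 : y' - y = 2 * (Real.pi / n) * (j - n * k) := by
      have : Real.pi / n * n = Real.pi := by field_simp
      linear_combination -hk + 2 * k * this
    have h3 : ((j - n * k : ℤ) : ℝ) < 1 := by
      push_cast
      nlinarith
    have h4 : (-1 : ℝ) < ((j - n * k : ℤ) : ℝ) := by
      push_cast
      nlinarith
    have h5 : j - n * k < 1 := by exact_mod_cast h3
    have h6 : -1 < j - n * k := by exact_mod_cast h4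
    omega
  refine ⟨?_, Or.inr ⟨k, by linarith⟩⟩
  have h2 : y' = y := by
    have : ((j - n * k : ℤ) : ℝ) = 0 := by rw [hj]; simp
    push_cast at this
    have h3 : Real.pi / n * n = Real.pi := by field_simp
    linear_combination -hk + 2 * (Real.pi / n) * this + 2 * k * h3
  rw [e, e', h2]

/-- The two arguments add up to a multiple of `2π / n` in `[-2π / n, 0]`. Hence both are `0` or both
are `-π / n`, and the point lies on one of the two edges of the sector, the leg or the spoke. -/
lemma refl_sector_inj {n : ℕ} (hn : 3 ≤ n) {ζ ζ' : ℂ} (hζ : ζ ∈ sector (Real.pi / n))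
    (hζ' : ζ' ∈ sector (Real.pi / n)) {j : ℤ}
    (h : ζ' = Complex.exp ((2 * (Real.pi / n) * j : ℝ) * Complex.I) * (starRingEnd ℂ) ζ) :
    ζ = ζ' ∧ (ζ = 0 ∨ (ζ.im = 0 ∧ (n : ℤ) ∣ j) ∨
      ((Complex.exp ((Real.pi / n : ℝ) * Complex.I) * ζ).im = 0 ∧ (n : ℤ) ∣ j + 1)) := by
  have hn0 : (0 : ℝ) < n := by exact_mod_cast (by omega : 0 < n)
  have hn3 : (3 : ℝ) ≤ n := by exact_mod_cast hn
  have h0 : 0 < Real.pi / n := by positivity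
  have h1 : Real.pi / n < Real.pi / 2 := by
    have := Real.pi_pos
    gcongr
    linarith
  obtain ⟨r, y, hr, hy1, hy2, e⟩ := exists_of_mem_sector h0 h1 hζ
  obtain ⟨r', y', hr', hy1', hy2', e'⟩ := exists_of_mem_sector h0 h1 hζ'
  rcases hr.eq_or_lt with rfl | hr
  · simp only [Complex.ofReal_zero, zero_mul] at e
    rw [h, e]
    simp
  rw [e, e', conj_mul_exp, exp_mul_I_mul] at h
  obtain ⟨rfl, k, hk⟩ := eq_of_mul_exp hr hr' h.symm
  have h3 : Real.pi / n * n = Real.pi := by field_simp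
  have h2 : y' + y = 2 * (Real.pi / n) * (j - n * k) := by
    linear_combination -hk + 2 * k * h3
  have hj : j - n * k = 0 ∨ j - n * k = -1 := by
    have h3 : ((j - n * k : ℤ) : ℝ) < 1 := by
      push_cast
      nlinarith
    have h4 : (-2 : ℝ) < ((j - n * k : ℤ) : ℝ) := by
      push_cast
      nlinarith
    have h5 : j - n * k < 1 := by exact_mod_cast h3
    have h6 : -2 < j - n * k := by exact_mod_cast h4
    omega
  rcases hj with hj | hj
  · have h5 : ((j - n * k : ℤ) : ℝ) = 0 := by rw [hj]; simp
    push_cast at h5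
    rw [h5, mul_zero] at h2
    have e1 : y = 0 := by linarith
    have e2 : y' = 0 := by linarith
    refine ⟨by rw [e, e', e1, e2], Or.inr (Or.inl ⟨?_, k, by linarith⟩)⟩
    rw [e, im_mul_exp, e1, Real.sin_zero, mul_zero]
  · have h5 : ((j - n * k : ℤ) : ℝ) = -1 := by rw [hj]; simp
    push_cast at h5
    rw [h5] at h2
    have e1 : y = -(Real.pi / n) := by linarith
    have e2 : y' = -(Real.pi / n) := by linarith
    refine ⟨by rw [e, e', e1, e2], Or.inr (Or.inr ⟨?_, k, by linarith⟩)⟩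
    rw [e, exp_mul_I_mul, im_mul_exp, e1, add_neg_cancel, Real.sin_zero, mul_zero]

end UpperHalfPlane

/-! ### Charts at the vertices of the graph -/

namespace UpperHalfPlane

/-- The `j`-th power of the primitive `n`-th root of unity with least positive argument. -/
noncomputable def unitRoot (n : ℕ) (j : ℤ) : ℂ :=
  Complex.exp ((2 * (Real.pi / n) * j : ℝ) * Complex.I)

lemma unitRoot_add (n : ℕ) (i j : ℤ) : unitRoot n (i + j) = unitRoot n i * unitRoot n j := by
  rw [unitRoot, unitRoot, unitRoot, ← Complex.exp_add]
  push_cast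
  ring_nf

lemma unitRoot_zero (n : ℕ) : unitRoot n 0 = 1 := by simp [unitRoot]

lemma conj_unitRoot (n : ℕ) (j : ℤ) : (starRingEnd ℂ) (unitRoot n j) = unitRoot n (-j) := by
  rw [unitRoot, unitRoot, ← Complex.exp_conj, map_mul, Complex.conj_ofReal, Complex.conj_I]
  push_cast
  ring_nf

lemma unitRoot_congr {n : ℕ} (hn : n ≠ 0) {i j : ℤ} (h : i ≡ j [ZMOD n]) :
    unitRoot n i = unitRoot n j := by
  obtain ⟨k, hk⟩ := h.symm.dvd
  rw [sub_eq_iff_eq_add.1 hk, unitRoot_add]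
  have : unitRoot n (n * k) = 1 := by
    rw [unitRoot, Complex.exp_eq_one_iff]
    refine ⟨k, ?_⟩
    have hn' : (n : ℂ) ≠ 0 := by exact_mod_cast hn
    push_cast
    field_simp
  rw [this, one_mul]

end UpperHalfPlane

namespace FiniteGraph.TileSystem

open UpperHalfPlane

variable {G : FiniteGraph.{0}} {T : G.TileSystem}

lemma source_zpow (j : ℤ) (e : G.Dart) : G.source ((T.next ^ j) e) = G.source e := by
  induction j using Int.induction_on with
  | zero => rfl
  | succ i ih => rw [add_comm, zpow_add, zpow_one, Equiv.Perm.mul_apply, T.source_next, ih]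
  | pred i ih =>
    rw [sub_eq_add_neg, add_comm, zpow_add, zpow_neg_one, Equiv.Perm.mul_apply]
    exact (T.source_next_symm _).trans ih

lemma pos_zpow (j : ℤ) (e : G.Dart) :
    T.pos ((T.next ^ j) e) ≡ T.pos e + j [ZMOD G.degree (G.source e)] := by
  induction j using Int.induction_on with
  | zero => simp
  | succ i ih =>
    have h := T.pos_next ((T.next ^ (i : ℤ)) e)
    rw [source_zpow] at h
    rw [add_comm (i : ℤ), zpow_add, zpow_one, Equiv.Perm.mul_apply]
    refine h.trans ((ih.add_right 1).trans ?_)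
    rw [add_assoc, add_comm (i : ℤ)]
  | pred i ih =>
    have h := T.pos_next ((T.next ^ (-(i : ℤ) - 1)) e)
    rw [source_zpow, ← Equiv.Perm.mul_apply, ← zpow_one_add, add_sub_cancel] at h
    have h1 := (h.symm.trans ih).sub_right 1
    rw [add_sub_cancel_right] at h1
    refine h1.trans ?_
    rw [add_sub_assoc]

lemma zpow_eq {e e' : G.Dart} (h : G.source e = G.source e') {j : ℤ}
    (hj : T.pos e' ≡ T.pos e + j [ZMOD G.degree (G.source e)]) : (T.next ^ j) e = e' := by
  refine T.eq_of_pos _ _ ((source_zpow j e).trans h) ?_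
  rw [source_zpow]
  exact (pos_zpow j e).trans hj.symm

lemma linked_leg (e : G.Dart) (a a' ε : Bool) : T.Linked {4, 0} (e, a, ε) (e, a', ε) := by
  have h : T.Linked {4, 0} (e, true, ε) (e, false, ε) :=
    Linked.cross (T := T) (k := 0) (by simp) (e, true, ε)
  cases a <;> cases a'
  · exact Linked.refl _ _
  · exact h.symm
  · exact h
  · exact Linked.refl _ _

lemma linked_zpow (j : ℤ) (e : G.Dart) (a a' ε : Bool) :
    T.Linked {4, 0} (e, a, ε) ((T.next ^ j) e, a', ε) := by
  have step : ∀ e : G.Dart, T.Linked {4, 0} (e, true, ε) (T.next e, true, ε) := fun e =>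
    (Linked.cross (T := T) (k := 4) (by simp) (e, true, ε)).trans (linked_leg _ _ _ _)
  refine ((linked_leg e a true ε).trans ?_).trans (linked_leg _ true a' ε)
  induction j using Int.induction_on with
  | zero => exact Linked.refl _ _
  | succ i ih =>
    rw [add_comm, zpow_add, zpow_one, Equiv.Perm.mul_apply]
    exact ih.trans (step _)
  | pred i ih =>
    refine ih.trans (Linked.symm ?_)
    have := step ((T.next ^ (-(i : ℤ) - 1)) e)
    rwa [← Equiv.Perm.mul_apply, ← zpow_one_add, add_sub_cancel] at this

/-- Sides 4 and 0 never lead to another sheet or vertex. Conversely, since positions are distinct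
modulo the degree, a power of `next` takes any dart to any other with the same source. -/
lemma linked_vertex_iff {t t' : G.Tile} : T.Linked {4, 0} t t' ↔
    G.source t.1 = G.source t'.1 ∧ t.2.2 = t'.2.2 := by
  constructor
  · intro h
    refine h.induct (P := fun t' => G.source t.1 = G.source t'.1 ∧ t.2.2 = t'.2.2) ⟨rfl, rfl⟩ ?_
    rintro s - ⟨h1, h2⟩ k (rfl | rfl)
    · exact ⟨h1.trans (T.source_cross_four s).symm, h2⟩
    · exact ⟨h1, h2⟩
  · obtain ⟨e, a, ε⟩ := t
    obtain ⟨e', a', ε'⟩ := t'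
    rintro ⟨h1, h2⟩
    obtain rfl : ε = ε' := h2
    have h3 : (T.next ^ (T.pos e' - T.pos e)) e = e' := zpow_eq h1 (by rw [add_sub_cancel])
    rw [← h3]
    exact linked_zpow _ _ _ _ _

lemma disc_orient_smul {m : ℝ} (b : Bool) (z : ℍ) :
    disc m (orient b • z) = if b then disc m z else (starRingEnd ℂ) (disc m z) := by
  cases b
  · exact disc_J_smul z
  · simp [orient]

/-- The unfolding isometries around a vertex of the graph. -/
noncomputable def vertexUnfolding (T : G.TileSystem) (t₀ t : G.Tile) : GL (Fin 2) ℝ :=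
  orient (!t₀.2.2) * (rot (T.rad (G.source t₀.1))
    (2 * (Real.pi / G.degree (G.source t₀.1)) * (-T.pos t.1 : ℤ)) * orient t.2.1)

lemma disc_vertexUnfolding_smul (t₀ t : G.Tile) (z : ℍ) :
    disc (T.rad (G.source t₀.1)) ((orient (!t₀.2.2))⁻¹ • vertexUnfolding T t₀ t • z) =
      unitRoot (G.degree (G.source t₀.1)) (-T.pos t.1) *
        if t.2.1 then disc (T.rad (G.source t₀.1)) z
        else (starRingEnd ℂ) (disc (T.rad (G.source t₀.1)) z) := by
  rw [vertexUnfolding, mul_smul, inv_smul_smul, mul_smul, disc_rot_smul (T.rad_pos _),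
    disc_orient_smul]
  rfl

lemma sin_angle_pos (T : G.TileSystem) (v : G.Vertex) :
    0 < Real.sin (Real.pi / G.degree v) := by
  have h := T.three_le_degree v
  have hn3 : (3 : ℝ) ≤ G.degree v := by exact_mod_cast h
  refine Real.sin_pos_of_pos_of_lt_pi (by positivity) ?_
  rw [div_lt_iff₀ (by linarith)]
  nlinarith [Real.pi_pos]

lemma angle_lt (T : G.TileSystem) (v : G.Vertex) : Real.pi / G.degree v < Real.pi / 2 := by
  have h := T.three_le_degree v
  have hn3 : (3 : ℝ) ≤ G.degree v := by exact_mod_cast h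
  have := Real.pi_pos
  gcongr
  linarith

lemma exists_leg (t : G.Tile) (z : ℍ) : ∃ q : ℝ, 0 < q ∧
    (disc (T.rad (G.source t.1)) z).im = -(q * lineForm (T.form t 0) (klein z)) :=
  lineForm_leg_klein (T.rad_pos _) z

lemma exists_spoke (t : G.Tile) (z : ℍ) : ∃ q : ℝ, 0 < q ∧
    (Complex.exp ((Real.pi / G.degree (G.source t.1) : ℝ) * Complex.I) *
      disc (T.rad (G.source t.1)) z).im = q * lineForm (T.form t 4) (klein z) :=
  lineForm_spoke_klein (T.rad_pos _) (sin_angle_pos T _) (T.rad_eq _) z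

lemma mem_sector_iff {t : G.Tile} {z : ℍ} :
    disc (T.rad (G.source t.1)) z ∈ sector (Real.pi / G.degree (G.source t.1)) ↔
      ∀ k ∈ ({4, 0} : Set (Fin 5)), 0 ≤ lineForm (T.form t k) (klein z) := by
  obtain ⟨q, hq, h⟩ := exists_leg (T := T) t z
  obtain ⟨q', hq', h'⟩ := exists_spoke (T := T) t z
  rw [sector, mem_ofPred_eq, h, h', neg_nonpos, mul_nonneg_iff_of_pos_left hq,
    mul_nonneg_iff_of_pos_left hq']
  simp [and_comm]

/-- In the disc model the unfolding is by the dihedral group of order `2n`: `pos` gives the rotation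
and the side of the dart decides whether to conjugate. The sector of angle `π / n` is a fundamental
domain, which is the covering and overlap condition of `exists_chart`. -/
lemma exists_chart_of_vertex {t₀ : G.Tile} (p₀ : T.poly t₀) (hZ : T.zeros t₀ p₀ = {4, 0}) :
    ∃ φ ∈ T.charts, T.pt t₀ p₀ ∈ φ.source := by
  set v := G.source t₀.1 with hv
  set n := G.degree v with hn
  set m := T.rad v with hm
  have hm0 : 0 < m := T.rad_pos v
  have hn3 : 3 ≤ n := T.three_le_degree v
  have hn0 : n ≠ 0 := by omega
  have hdisc := disc_injective hm0
  have hang : 0 < Real.pi / n := by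
    have := Real.pi_pos
    have : (0 : ℝ) < n := by exact_mod_cast (by omega : 0 < n)
    positivity
  have hdet : ∀ t, T.Linked {4, 0} t₀ t → 0 < (if sgn t then 1 else -1) *
      (vertexUnfolding T t₀ t).det.val := by
    intro t ht
    obtain ⟨-, hε⟩ := linked_vertex_iff.1 ht
    rw [vertexUnfolding, map_mul, map_mul, Units.val_mul, Units.val_mul, det_rot, sgn, ← hε]
    cases t₀.2.2 <;> cases t.2.1 <;> simp [orient]
  have hsector : ∀ {z : ℍ}, disc m z ∈ sector (Real.pi / n) ↔
      ∀ k ∈ ({4, 0} : Set (Fin 5)), 0 ≤ lineForm (T.form t₀ k) (klein z) := mem_sector_iff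
  have hsmul : ∀ t (z : ℍ), disc m ((orient (!t₀.2.2))⁻¹ • vertexUnfolding T t₀ t • z) =
      unitRoot n (-T.pos t.1) * if t.2.1 then disc m z else (starRingEnd ℂ) (disc m z) :=
    fun t z => disc_vertexUnfolding_smul t₀ t z
  refine exists_chart p₀ (D := vertexUnfolding T t₀) ⟨?_, ?_, ?_⟩ ?_ ?_ <;> rw [hZ]
  · intro t ht h
    have := hdet t ht
    rwa [h, if_pos rfl, one_mul] at this
  · intro t ht h
    have := hdet t ht
    rwa [h, if_neg (by decide), neg_one_mul, neg_pos] at this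
  · intro t ht k hk z
    obtain ⟨hs, -⟩ := linked_vertex_iff.1 ht
    refine MulAction.injective (orient (!t₀.2.2))⁻¹ (hdisc ?_)
    rw [hsmul, hsmul]
    obtain ⟨e, a, ε⟩ := t
    rcases hk with rfl | rfl
    -- Crossing the spoke changes `pos` by one, which matches the rotation through `-2π / n`
    -- contained in the reflection in side 4.
    · have h4 : disc m (mirror (T.form t₀ 4) • z) =
          unitRoot n (-1) * (starRingEnd ℂ) (disc m z) := by
        refine (disc_mirror_spoke_smul hm0 (sin_angle_pos T v) (T.rad_eq v) z).trans ?_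
        rw [unitRoot]
        congr 3
        push_cast
        ring
      rw [h4, map_mul, conj_unitRoot, Complex.conj_conj, neg_neg]
      cases a
      · have h5 : -T.pos (T.next.symm e) ≡ -T.pos e + 1 [ZMOD n] := by
          have := T.pos_next (T.next.symm e)
          rw [T.next.apply_symm_apply, T.source_next_symm, ← hs] at this
          have h6 := (this.neg).add_right 1
          rw [neg_add, neg_add_cancel_right] at h6
          exact h6.symm
        change unitRoot n (-T.pos (T.next.symm e)) * disc m z =
          unitRoot n (-T.pos e) * (unitRoot n 1 * disc m z)
        rw [unitRoot_congr hn0 h5, unitRoot_add, mul_assoc]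
      · have h5 : -T.pos (T.next e) ≡ -T.pos e + -1 [ZMOD n] := by
          have := T.pos_next e
          rw [← hs] at this
          rw [← neg_add]
          exact this.neg
        change unitRoot n (-T.pos (T.next e)) * (starRingEnd ℂ) (disc m z) =
          unitRoot n (-T.pos e) * (unitRoot n (-1) * (starRingEnd ℂ) (disc m z))
        rw [unitRoot_congr hn0 h5, unitRoot_add, mul_assoc]
    · have h0 : disc m (mirror (T.form t₀ 0) • z) = (starRingEnd ℂ) (disc m z) :=
        disc_mirror_leg_smul z
      rw [h0, Complex.conj_conj]
      cases a <;> rfl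
  · intro y
    obtain ⟨j, hj⟩ := exists_rot_mem_sector hang (angle_lt T v)
      (unitRoot n (T.pos t₀.1) * disc m ((orient (!t₀.2.2))⁻¹ • y))
    have hj' : unitRoot n j * (unitRoot n (T.pos t₀.1) * disc m ((orient (!t₀.2.2))⁻¹ • y)) ∈
        sector (Real.pi / n) ∨ (starRingEnd ℂ) (unitRoot n j * (unitRoot n (T.pos t₀.1) *
          disc m ((orient (!t₀.2.2))⁻¹ • y))) ∈ sector (Real.pi / n) := hj
    have hinv : ∀ a : Bool, unitRoot n j * (unitRoot n (T.pos t₀.1) *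
        disc m ((orient (!t₀.2.2))⁻¹ • y)) = if a then
          disc m ((vertexUnfolding T t₀ ((T.next ^ j) t₀.1, a, t₀.2.2))⁻¹ • y) else
          (starRingEnd ℂ)
            (disc m ((vertexUnfolding T t₀ ((T.next ^ j) t₀.1, a, t₀.2.2))⁻¹ • y)) := by
      intro a
      have h1 := hsmul ((T.next ^ j) t₀.1, a, t₀.2.2)
        ((vertexUnfolding T t₀ ((T.next ^ j) t₀.1, a, t₀.2.2))⁻¹ • y)
      rw [smul_inv_smul] at h1
      rw [h1, ← mul_assoc, ← mul_assoc, ← unitRoot_add, ← unitRoot_add]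
      have h2 : j + T.pos t₀.1 + -T.pos ((T.next ^ j) t₀.1) ≡ 0 [ZMOD n] := by
        have := ((pos_zpow (T := T) j t₀.1).neg).add_left (j + T.pos t₀.1)
        rw [add_comm (T.pos t₀.1) j, add_neg_cancel] at this
        exact this
      rw [unitRoot_congr hn0 h2, unitRoot_zero, one_mul]
    rcases hj' with hj' | hj'
    · refine ⟨((T.next ^ j) t₀.1, true, t₀.2.2), linked_zpow _ _ _ _ _, hsector.1 ?_⟩
      rw [hinv true] at hj'
      exact hj'
    · refine ⟨((T.next ^ j) t₀.1, false, t₀.2.2), linked_zpow _ _ _ _ _, hsector.1 ?_⟩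
      rw [hinv false, if_neg (by decide), Complex.conj_conj] at hj'
      exact hj'
  · intro t t' ht ht' z z' hz hz' h
    obtain ⟨e, a, ε⟩ := t
    obtain ⟨e', a', ε'⟩ := t'
    obtain ⟨hs, hε⟩ := linked_vertex_iff.1 ht
    obtain ⟨hs', hε'⟩ := linked_vertex_iff.1 ht'
    change G.source t₀.1 = G.source e at hs
    change G.source t₀.1 = G.source e' at hs'
    obtain rfl : t₀.2.2 = ε := hε
    obtain rfl : t₀.2.2 = ε' := hε'
    have hζ := hsector.2 hz
    have hζ' := hsector.2 hz'
    have h1 := hsmul (e, a, t₀.2.2) z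
    rw [h, hsmul] at h1
    change unitRoot n (-T.pos e') * (if a' then _ else _) =
      unitRoot n (-T.pos e) * (if a then _ else _) at h1
    have hcancel : ∀ {x w : ℂ}, unitRoot n (-T.pos e') * x = unitRoot n (-T.pos e) * w →
        x = unitRoot n (T.pos e' - T.pos e) * w := fun {x w} hxw => by
      rw [sub_eq_add_neg, unitRoot_add, mul_assoc, ← hxw, ← mul_assoc, ← unitRoot_add,
        add_neg_cancel, unitRoot_zero, one_mul]
    have hall : disc m z = 0 → T.Linked {k ∈ ({4, 0} : Set (Fin 5)) |
        lineForm (T.form t₀ k) (klein z) = 0} (e, a, t₀.2.2) (e', a', t₀.2.2) := fun h0 => by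
      refine (ht.symm.trans ht').mono ?_
      obtain ⟨q, hq, f⟩ := exists_leg (T := T) t₀ z
      obtain ⟨q', hq', f'⟩ := exists_spoke (T := T) t₀ z
      rw [← hv, ← hm, h0] at f f'
      rintro k (rfl | rfl)
      · refine ⟨Or.inl rfl, ?_⟩
        simpa [hq'.ne'] using f'.symm
      · refine ⟨Or.inr rfl, ?_⟩
        simpa [hq.ne'] using f.symm
    have hleg : (disc m z).im = 0 → T.Linked {k ∈ ({4, 0} : Set (Fin 5)) |
        lineForm (T.form t₀ k) (klein z) = 0} (e, a, t₀.2.2) (e, !a, t₀.2.2) := fun h0 => by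
      obtain ⟨q, hq, f⟩ := exists_leg (T := T) t₀ z
      rw [← hv, ← hm, h0] at f
      exact Linked.cross (T := T) (k := 0) (J := {k ∈ ({4, 0} : Set (Fin 5)) |
        lineForm (T.form t₀ k) (klein z) = 0}) ⟨by simp, by simpa [hq.ne'] using f.symm⟩
        (e, a, t₀.2.2)
    have hspoke : (Complex.exp ((Real.pi / n : ℝ) * Complex.I) * disc m z).im = 0 →
        ∀ t₁ : G.Tile, T.Linked {k ∈ ({4, 0} : Set (Fin 5)) |
        lineForm (T.form t₀ k) (klein z) = 0} t₁ (T.cross 4 t₁) := fun h0 t₁ => by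
      obtain ⟨q, hq, f⟩ := exists_spoke (T := T) t₀ z
      rw [← hv, ← hm, h0] at f
      exact Linked.cross (T := T) (k := 4) (J := {k ∈ ({4, 0} : Set (Fin 5)) |
        lineForm (T.form t₀ k) (klein z) = 0}) ⟨by simp, by simpa [hq.ne'] using f.symm⟩ t₁
    have hee : (n : ℤ) ∣ T.pos e' - T.pos e → e = e' := fun hd =>
      T.eq_of_pos e e' (hs.symm.trans hs') (by
        rw [← hs]
        exact Int.modEq_iff_dvd.2 hd)
    have hdneg : (n : ℤ) ∣ T.pos e - T.pos e' → e = e' := fun hd =>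
      hee (by rw [← neg_sub]; exact (dvd_neg).2 hd)
    -- Tiles on like sides of their darts differ by a rotation, and coincide unless the point is the
    -- centre. Tiles on unlike sides differ by a reflection, and the point lies on the leg or on the
    -- spoke that separates them, or is the centre.
    cases a <;> cases a'
    · have h2 := hcancel h1
      rw [if_neg (by decide), if_neg (by decide)] at h2
      have h3 := congrArg (starRingEnd ℂ) h2
      rw [map_mul, Complex.conj_conj, Complex.conj_conj, conj_unitRoot, neg_sub] at h3
      obtain ⟨e1, e2⟩ := rot_sector_inj hn3 hζ hζ' h3
      refine ⟨hdisc e1, ?_⟩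
      rcases e2 with e2 | e2
      · exact hall e2
      · rw [hdneg e2]
        exact Linked.refl _ _
    · have h2 := hcancel h1
      rw [if_pos rfl, if_neg (by decide)] at h2
      obtain ⟨e1, e2⟩ := refl_sector_inj hn3 hζ hζ' h2
      refine ⟨hdisc e1, ?_⟩
      rcases e2 with e2 | ⟨e2, e3⟩ | ⟨e2, e3⟩
      · exact hall e2
      · rw [← hee e3]
        exact hleg e2
      · have : T.next.symm e = e' := by
          rw [Equiv.symm_apply_eq]
          refine T.eq_of_pos _ _ ?_ ?_
          · rw [T.source_next, ← hs, hs']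
          · rw [← hs]
            have h4 := T.pos_next e'
            rw [← hs'] at h4
            refine Int.ModEq.trans ?_ h4.symm
            refine Int.modEq_iff_dvd.2 ?_
            convert e3 using 1
            ring
        rw [← this]
        exact hspoke e2 (e, false, t₀.2.2)
    · have h2 := hcancel h1
      rw [if_pos rfl, if_neg (by decide)] at h2
      have h3 := congrArg (starRingEnd ℂ) h2
      rw [map_mul, Complex.conj_conj, conj_unitRoot, neg_sub] at h3
      obtain ⟨e1, e2⟩ := refl_sector_inj hn3 hζ hζ' h3
      refine ⟨hdisc e1, ?_⟩
      rcases e2 with e2 | ⟨e2, e3⟩ | ⟨e2, e3⟩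
      · exact hall e2
      · rw [← hdneg e3]
        exact hleg e2
      · have : T.next e = e' := by
          refine T.eq_of_pos _ _ ?_ ?_
          · rw [T.source_next, ← hs, hs']
          · rw [T.source_next, ← hs]
            have h4 := T.pos_next e
            rw [← hs] at h4
            refine h4.trans (Int.ModEq.symm (Int.modEq_iff_dvd.2 ?_))
            convert e3 using 1
            ring
        rw [← this]
        exact hspoke e2 (e, true, t₀.2.2)
    · have h2 := hcancel h1
      rw [if_pos rfl, if_pos rfl] at h2
      obtain ⟨e1, e2⟩ := rot_sector_inj hn3 hζ hζ' h2
      refine ⟨hdisc e1, ?_⟩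
      rcases e2 with e2 | e2
      · exact hall e2
      · rw [hee e2]
        exact Linked.refl _ _

/-- The sides through a point are pairwise equal or cyclically adjacent, and a pentagon has no three
pairwise adjacent sides. -/
lemma zeros_cases {t : G.Tile} {p : Fin 2 → ℝ} (hp : p ∈ T.poly t) :
    T.zeros t p = ∅ ∨ (∃ k, T.zeros t p = {k}) ∨ ∃ k, T.zeros t p = {k, k + 1} := by
  rcases (T.zeros t p).eq_empty_or_nonempty with h | ⟨k, hk⟩
  · exact Or.inl h
  right
  have hadj : ∀ i ∈ T.zeros t p, ∀ j ∈ T.zeros t p, i = j ∨ j = i + 1 ∨ i = j + 1 :=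
    fun i hi j hj => T.adjacent hp hi hj
  by_cases h1 : k + 1 ∈ T.zeros t p
  · right
    refine ⟨k, Subset.antisymm (fun j hj => ?_) (insert_subset hk (singleton_subset_iff.2 h1))⟩
    have e1 := hadj k hk j hj
    have e2 := hadj (k + 1) h1 j hj
    change j = k ∨ j = k + 1
    clear hk h1 hj
    revert k j
    decide
  by_cases h2 : k - 1 ∈ T.zeros t p
  · right
    refine ⟨k - 1, Subset.antisymm (fun j hj => ?_)
      (insert_subset h2 (singleton_subset_iff.2 (by rwa [sub_add_cancel])))⟩
    have e1 := hadj k hk j hj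
    have e2 := hadj (k - 1) h2 j hj
    change j = k - 1 ∨ j = k - 1 + 1
    clear hk h1 h2 hj
    revert k j
    decide
  · left
    refine ⟨k, Subset.antisymm (fun j hj => ?_) (singleton_subset_iff.2 hk)⟩
    rcases hadj k hk j hj with rfl | rfl | rfl
    · rfl
    · exact absurd hj h1
    · rw [add_sub_cancel_right] at h2
      exact absurd hj h2

lemma exists_mem_charts (x : T.Surface) : ∃ φ ∈ T.charts, x ∈ φ.source := by
  obtain ⟨t, p, rfl⟩ := T.exists_pt x
  rcases zeros_cases p.2 with h | ⟨k, h⟩ | ⟨k, h⟩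
  · exact exists_chart_of_empty p h
  · by_cases hk : k = 4
    · subst hk
      refine exists_chart_of_singleton p (k' := 3) (by decide) ?_ h
      rw [← side_perp 3 (by decide), linePairing, linePairing]
      change _ = (T.form t 3).1 * (T.form t 4).2.2 + (T.form t 4).1 * (T.form t 3).2.2 -
        (T.form t 3).2.1 * (T.form t 4).2.1 / 2
      ring
    · exact exists_chart_of_singleton p (k' := k + 1) (by clear h hk; revert k; decide)
        (side_perp k hk) h
  · by_cases hk : k = 4
    · subst hk
      exact exists_chart_of_vertex p h
    · exact exists_chart_of_pair p hk h

noncomputable instance : ChartedSpace ℍ T.Surface where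
  atlas := T.charts
  chartAt x := (exists_mem_charts x).choose
  mem_chart_source x := (exists_mem_charts x).choose_spec.2
  chart_mem_atlas x := (exists_mem_charts x).choose_spec.1

instance : HasGroupoid T.Surface hyperbolicGroupoid :=
  ⟨fun he he' => charts_trans_mem he he'⟩

end FiniteGraph.TileSystem

/-! ### Euler characteristic of finite complexes with embedded closed cells -/

lemma HasEulerChar.of_homotopyEquiv {X Y : Type u} [TopologicalSpace X] [TopologicalSpace Y]
    {n : ℤ} (h : HasEulerChar X n) (e : ContinuousMap.HomotopyEquiv Y X) : HasEulerChar Y n := by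
  obtain ⟨Z, i1, i2, i3, h1, ⟨f⟩, h2⟩ := h
  exact ⟨Z, i1, i2, i3, h1, ⟨e.trans f⟩, h2⟩

/-- The characteristic map of a cell, extended outside the closed ball. -/
noncomputable def cellExtend {n : ℕ} {Y : Type*} (f : Metric.closedBall (0 : Fin n → ℝ) 1 → Y)
    (x : Fin n → ℝ) : Y :=
  open Classical in if h : x ∈ Metric.closedBall (0 : Fin n → ℝ) 1 then f ⟨x, h⟩ else f ⟨0, by simp⟩

lemma cellExtend_apply {n : ℕ} {Y : Type*} (f : Metric.closedBall (0 : Fin n → ℝ) 1 → Y)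
    {x : Fin n → ℝ} (h : x ∈ Metric.closedBall (0 : Fin n → ℝ) 1) :
    cellExtend f x = f ⟨x, h⟩ := dif_pos h

lemma injOn_cellExtend {n : ℕ} {Y : Type*} {f : Metric.closedBall (0 : Fin n → ℝ) 1 → Y}
    (hf : Function.Injective f) : InjOn (cellExtend f) (Metric.closedBall 0 1) := by
  intro x hx y hy h
  rw [cellExtend_apply f hx, cellExtend_apply f hy] at h
  exact congrArg Subtype.val (hf h)

lemma continuousOn_cellExtend {n : ℕ} {Y : Type*} [TopologicalSpace Y]
    {f : Metric.closedBall (0 : Fin n → ℝ) 1 → Y}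
    (hf : Continuous f) : ContinuousOn (cellExtend f) (Metric.closedBall 0 1) := by
  rw [continuousOn_iff_continuous_domRestrict]
  exact hf.congr fun x => (cellExtend_apply f x.2).symm

/-- The Euler characteristic of a finite complex all of whose closed cells are embedded. -/
lemma hasEulerChar_of_cells {Y : Type} [TopologicalSpace Y] [T2Space Y] (cell : ℕ → Type)
    (hfin : ∀ n, Finite (cell n)) (hempty : ∀ n, 3 ≤ n → IsEmpty (cell n))
    (f : ∀ n, cell n → Metric.closedBall (0 : Fin n → ℝ) 1 → Y)
    (hcont : ∀ n c, Continuous (f n c)) (hinj : ∀ n c, Function.Injective (f n c))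
    (hdisj : ∀ n c m c' (x : Metric.closedBall (0 : Fin n → ℝ) 1)
      (x' : Metric.closedBall (0 : Fin m → ℝ) 1), ‖(x : Fin n → ℝ)‖ < 1 → ‖(x' : Fin m → ℝ)‖ < 1 →
      f n c x = f m c' x' → (⟨n, c⟩ : Σ n, cell n) = ⟨m, c'⟩)
    (hbd : ∀ n c (x : Metric.closedBall (0 : Fin n → ℝ) 1), ‖(x : Fin n → ℝ)‖ = 1 → ∃ m < n, ∃ c' x', f m c' x' = f n c x)
    (hcov : ∀ y, ∃ n c x, f n c x = y) :
    HasEulerChar Y (Nat.card (cell 0) - Nat.card (cell 1) + Nat.card (cell 2)) := by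
  have hsub : ∀ n, Metric.ball (0 : Fin n → ℝ) 1 ⊆ Metric.closedBall 0 1 :=
    fun n => Metric.ball_subset_closedBall
  let map : (n : ℕ) → (i : cell n) → PartialEquiv (Fin n → ℝ) Y := fun n i =>
    ((injOn_cellExtend (hinj n i)).mono (hsub n)).toPartialEquiv _ _
  have hmap : ∀ n i, (map n i : (Fin n → ℝ) → Y) = cellExtend (f n i) := fun n i => rfl
  have hmap' : ∀ n i, (map n i).target = cellExtend (f n i) '' Metric.ball 0 1 := fun n i => rfl
  have H1 : ∀ᶠ n in Filter.atTop, IsEmpty (cell n) :=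
    Filter.eventually_atTop.2 ⟨3, fun n hn => hempty n hn⟩
  have H2 : ∀ n i, ContinuousOn (map n i) (Metric.closedBall 0 1) := fun n i =>
    continuousOn_cellExtend (hcont n i)
  -- The closed cell is compact and the space Hausdorff, so the injective characteristic map is
  -- closed and its inverse continuous.
  have H3 : ∀ n i, ContinuousOn (map n i).symm (map n i).target := fun n i => by
    rw [continuousOn_iff_isClosed]
    intro t ht
    refine ⟨cellExtend (f n i) '' (Metric.closedBall 0 1 ∩ t), ?_, ?_⟩
    · refine (((isCompact_closedBall (0 : Fin n → ℝ) 1).inter_right ht).image_of_continuousOn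
        ((H2 n i).mono inter_subset_left)).isClosed
    · ext y
      constructor
      · rintro ⟨h1, h2⟩
        refine ⟨⟨(map n i).symm y, ⟨hsub n ((map n i).map_target h2), h1⟩,
          (map n i).right_inv h2⟩, h2⟩
      · rintro ⟨⟨x, ⟨hx, hxt⟩, rfl⟩, h2⟩
        refine ⟨?_, h2⟩
        have h3 := (map n i).right_inv h2
        have h4 := injOn_cellExtend (hinj n i) (hsub n ((map n i).map_target h2)) hx h3
        rw [mem_preimage, h4]
        exact hxt
  have H4 : (univ : Set (Σ n, cell n)).PairwiseDisjoint
      (fun ni => map ni.1 ni.2 '' Metric.ball 0 1) := by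
    rintro ⟨n, c⟩ - ⟨m, c'⟩ - hne
    refine Set.disjoint_left.2 ?_
    rintro _ ⟨x, hx, rfl⟩ ⟨x', hx', h⟩
    rw [hmap, hmap, cellExtend_apply _ (hsub _ hx), cellExtend_apply _ (hsub _ hx')] at h
    exact hne (hdisj n c m c' _ _ (mem_ball_zero_iff.1 hx) (mem_ball_zero_iff.1 hx') h.symm)
  have H5 : ∀ n i, MapsTo (map n i) (Metric.sphere 0 1)
      (⋃ (m < n) (j : cell m), map m j '' Metric.closedBall 0 1) := by
    intro n i x hx
    obtain ⟨m, hm, c', x', h⟩ := hbd n i ⟨x, Metric.sphere_subset_closedBall hx⟩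
      (mem_sphere_zero_iff_norm.1 hx)
    simp only [mem_iUnion]
    refine ⟨m, hm, c', x', x'.2, ?_⟩
    rw [hmap, hmap, cellExtend_apply _ x'.2,
      cellExtend_apply _ (Metric.sphere_subset_closedBall hx)]
    exact h
  have H6 : ⋃ (n : ℕ) (j : cell n), map n j '' Metric.closedBall 0 1 = univ := by
    refine eq_univ_of_forall fun y => ?_
    obtain ⟨n, c, x, rfl⟩ := hcov y
    simp only [mem_iUnion]
    exact ⟨n, c, x, x.2, cellExtend_apply _ x.2⟩
  refine ⟨Y, inferInstance, inferInstance, CWComplex.mkFinite univ cell map H1 hfin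
    (fun _ _ => rfl) H2 H3 H4 H5 H6, CWComplex.finite_mkFinite univ cell map H1 hfin
    (fun _ _ => rfl) H2 H3 H4 H5 H6, ⟨ContinuousMap.HomotopyEquiv.refl Y⟩, ?_⟩
  change ∑ᶠ k : ℕ, (-1 : ℤ) ^ k * (Nat.card (cell k) : ℤ) = _
  rw [finsum_eq_sum_of_support_subset (s := Finset.range 3)]
  · simp [Finset.sum_range_succ]
    ring
  · intro k hk
    rw [Finset.coe_range, mem_Iio]
    by_contra hcon
    have := hempty k (not_lt.1 hcon)
    exact hk (by simp)

/-! ### Faces of a tile -/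

namespace FiniteGraph.TileSystem

open UpperHalfPlane

variable {G : FiniteGraph.{0}} {T : G.TileSystem}

/-- The faces of dimension `n` of a tile. -/
def Face : ℕ → Type
  | 0 => Fin 5
  | 1 => Fin 5
  | 2 => Unit
  | _ => Empty

instance : ∀ n, Finite (Face n)
  | 0 => inferInstanceAs (Finite (Fin 5))
  | 1 => inferInstanceAs (Finite (Fin 5))
  | 2 => inferInstanceAs (Finite Unit)
  | _ + 3 => inferInstanceAs (Finite Empty)

/-- The sides that contain a face. -/
def sides : ∀ {n : ℕ}, Face n → Set (Fin 5)
  | 0, k => {(show Fin 5 from k), (show Fin 5 from k) + 1}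
  | 1, k => {(show Fin 5 from k)}
  | 2, _ => ∅

lemma sides_injective {n m : ℕ} {F : Face n} {F' : Face m} (h : sides F = sides F') :
    (⟨n, F⟩ : Σ n, Face n) = ⟨m, F'⟩ := by
  have hk : ∀ k : Fin 5, k ≠ k + 1 := by decide
  have e1 : ∀ k k' : Fin 5, ({k, k + 1} : Set (Fin 5)) ≠ {k'} := fun k k' h => by
    have h1 : k = k' := h.subset (mem_insert k {k + 1})
    have h2 : k + 1 = k' := h.subset (mem_insert_of_mem _ rfl)
    exact hk k (h1.trans h2.symm)
  have e2 : ∀ k k' : Fin 5, ({k, k + 1} : Set (Fin 5)) = {k', k' + 1} → k = k' := fun k k' h => by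
    have h1 : k = k' ∨ k = k' + 1 := h.subset (mem_insert k {k + 1})
    have h2 : k + 1 = k' ∨ k + 1 = k' + 1 := h.subset (mem_insert_of_mem _ rfl)
    clear h
    revert k k'
    decide
  rcases n with _ | _ | _ | n
  · rcases m with _ | _ | _ | m
    · rw [e2 _ _ h]
    · exact absurd h (e1 _ _)
    · exact absurd h (insert_nonempty _ _).ne_empty
    · exact F'.elim
  · rcases m with _ | _ | _ | m
    · exact absurd h.symm (e1 _ _)
    · rw [singleton_eq_singleton_iff.1 h]
    · exact absurd h (singleton_nonempty _).ne_empty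
    · exact F'.elim
  · rcases m with _ | _ | _ | m
    · exact absurd h.symm (insert_nonempty _ _).ne_empty
    · exact absurd h.symm (singleton_nonempty _).ne_empty
    · rfl
    · exact F'.elim
  · exact F.elim

lemma sides_ncard {n : ℕ} (F : Face n) : (sides F).ncard + n = 2 := by
  have hk : ∀ k : Fin 5, k ≠ k + 1 := by decide
  rcases n with _ | _ | _ | n
  · exact congrArg (· + 0) (ncard_pair (hk _))
  · exact congrArg (· + 1) (ncard_singleton _)
  · exact congrArg (· + 2) (ncard_empty _)
  · exact F.elim

/-- A face of dimension `n` lies on `2 - n` sides, so lying on more sides means lower dimension.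
This places the boundary of a cell in cells of smaller dimension. -/
lemma sides_ssubset {n m : ℕ} {F : Face n} {F' : Face m} (h : sides F ⊂ sides F') : m < n := by
  have h1 := sides_ncard F
  have h2 := sides_ncard F'
  have h3 := ncard_lt_ncard h (toFinite _)
  omega

lemma exists_sides_eq {t : G.Tile} {p : Fin 2 → ℝ} (hp : p ∈ T.poly t) :
    ∃ (n : ℕ) (F : Face n), sides F = T.zeros t p := by
  rcases zeros_cases hp with h | ⟨k, h⟩ | ⟨k, h⟩
  · exact ⟨2, (), h.symm⟩
  · exact ⟨1, k, h.symm⟩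
  · exact ⟨0, k, h.symm⟩

/-- The open face consists of the points whose set of sides is exactly `sides F`, the closed face of
those lying at least on these sides. This description is invariant under the gluing. -/
lemma exists_face_param (t : G.Tile) {n : ℕ} (F : Face n) :
    ∃ h : Metric.closedBall (0 : Fin n → ℝ) 1 → Fin 2 → ℝ, Continuous h ∧ Function.Injective h ∧
      (∀ x, h x ∈ T.poly t ∧ sides F ⊆ T.zeros t (h x)) ∧
      (∀ x : Metric.closedBall (0 : Fin n → ℝ) 1, ‖(x : Fin n → ℝ)‖ < 1 ↔ T.zeros t (h x) = sides F) ∧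
      ∀ p ∈ T.poly t, sides F ⊆ T.zeros t p → ∃ x, h x = p := by
  have hE := T.width_ge (G.edge t.1)
  have hM := T.sq_rad_pos (G.source t.1)
  have hM1 := T.sq_rad_lt_one (G.source t.1)
  rcases n with _ | _ | _ | n
  · obtain ⟨h1, h2, h3⟩ := corner_mem_and_zero hE hM hM1 F
    have hz : T.zeros t (corner (T.width (G.edge t.1)) (T.rad (G.source t.1) ^ 2) F) =
        sides (n := 0) F := by
      ext j
      constructor
      · intro hj
        by_contra hcon
        have hcon' : ¬(j = (show Fin 5 from F) ∨ j = (show Fin 5 from F) + 1) := hcon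
        rw [not_or] at hcon'
        exact (lineForm_corner_pos hE hM hM1 hcon'.1 hcon'.2).ne' hj
      · rintro (rfl | rfl)
        · exact h2
        · exact h3
    refine ⟨fun _ => corner (T.width (G.edge t.1)) (T.rad (G.source t.1) ^ 2) F,
      continuous_const, fun x y _ => Subsingleton.elim _ _, fun x => ⟨h1, hz.ge⟩, fun x => ?_,
      fun p hp hs => ⟨⟨0, by simp⟩, ?_⟩⟩
    · refine iff_of_true ?_ hz
      rw [Subsingleton.elim (x : Fin 0 → ℝ) 0, norm_zero]
      exact one_pos
    · exact (eq_corner hE hM hM1 (hs (Or.inl rfl)) (hs (Or.inr rfl))).symm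
  · obtain ⟨k, hk⟩ : ∃ k : Fin 5, k = F := ⟨F, rfl⟩
    have hF : sides (n := 1) F = {k} := by rw [hk]; rfl
    have hk1 : k ≠ k + 1 := by clear hk hF; revert k; decide
    set A := corner (T.width (G.edge t.1)) (T.rad (G.source t.1) ^ 2) (k + 4) with hA
    set B := corner (T.width (G.edge t.1)) (T.rad (G.source t.1) ^ 2) k with hB
    have hAB : A ≠ B := corner_ne hE hM hM1 k
    have hA' := corner_mem_and_zero hE hM hM1 (k + 4)
    have hB' := corner_mem_and_zero hE hM hM1 k
    have hAk : lineForm (T.form t k) A = 0 := lineForm_corner_prev hE hM hM1 k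
    have hnorm : ∀ x : Fin 1 → ℝ, ‖x‖ = |x 0| := fun x => by
      rw [Pi.norm_def]
      simp
    let c : Metric.closedBall (0 : Fin 1 → ℝ) 1 → ℝ := fun x => ((x : Fin 1 → ℝ) 0 + 1) / 2
    have hc : ∀ x, 0 ≤ c x ∧ c x ≤ 1 := fun x => by
      have := mem_closedBall_zero_iff.1 x.2
      rw [hnorm, abs_le] at this
      constructor <;> simp only [c] <;> linarith
    refine ⟨fun x => (1 - c x) • A + c x • B, ?_, ?_, fun x => ⟨?_, ?_⟩, fun x => ?_, ?_⟩
    · have : Continuous c :=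
        (((continuous_apply 0).comp continuous_subtype_val).add continuous_const).div_const 2
      fun_prop
    · intro x y hxy
      have h1 : (c x - c y) • (B - A) = 0 := by
        have h2 : (1 - c x) • A + c x • B = (1 - c y) • A + c y • B := hxy
        have h3 := sub_eq_zero.2 h2
        rw [← h3]
        module
      have h2 : c x = c y :=
        sub_eq_zero.1 ((smul_eq_zero.1 h1).resolve_right (sub_ne_zero.2 hAB.symm))
      refine Subtype.ext (funext fun i => ?_)
      obtain rfl : i = 0 := Subsingleton.elim (α := Fin 1) i 0
      simp only [c] at h2
      linarith
    · exact convex_pentagon _ _ hA'.1 hB'.1 (by linarith [(hc x).2]) (hc x).1 (by ring)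
    · rw [hF, singleton_subset_iff]
      change lineForm (T.form t k) _ = 0
      rw [lineForm_combo _ _ _ (by ring), hAk, show lineForm (T.form t k) B = 0 from hB'.2.1]
      simp
    · have hcx : ‖(x : Fin 1 → ℝ)‖ < 1 ↔ c x ∈ Ioo (0 : ℝ) 1 := by
        rw [hnorm, abs_lt]
        simp only [c, mem_Ioo]
        constructor <;> rintro ⟨h1, h2⟩ <;> constructor <;> linarith
      rw [hcx, hF]
      constructor
      · intro h
        ext j
        constructor
        · intro hj
          by_contra hjk
          exact (lineForm_side_param_pos hE hM hM1 hjk h).ne' hj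
        · rintro rfl
          change lineForm (T.form t j) _ = 0
          rw [lineForm_combo _ _ _ (by ring), hAk, show lineForm (T.form t j) B = 0 from hB'.2.1]
          simp
      · intro h
        refine ⟨lt_of_le_of_ne (hc x).1 fun h0 => ?_, lt_of_le_of_ne (hc x).2 fun h0 => ?_⟩
        · have h1 : k + 4 ∈ T.zeros t ((1 - c x) • A + c x • B) := by
            rw [← h0, sub_zero, one_smul, zero_smul, add_zero]
            exact hA'.2.1
          rw [h] at h1
          exact (fin_five_ne k).1 h1
        · have h1 : k + 1 ∈ T.zeros t ((1 - c x) • A + c x • B) := by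
            rw [h0, sub_self, one_smul, zero_smul, zero_add]
            exact hB'.2.2
          rw [h] at h1
          exact hk1 h1.symm
    · intro p hp hs
      obtain ⟨s, hs', rfl⟩ := exists_side_param hE hM hM1 hp (hs (by rw [hF]; rfl) : k ∈ T.zeros t p)
      refine ⟨⟨fun _ => 2 * s - 1, ?_⟩, ?_⟩
      · rw [mem_closedBall_zero_iff, hnorm, abs_le]
        constructor <;> linarith [hs'.1, hs'.2]
      · have : ((2 * s - 1) + 1) / 2 = s := by ring
        simp only [c, this]
        rfl
  -- The tile is a convex body, and some homeomorphism of the plane carries it onto the closed unit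
  -- ball and its interior onto the open ball.
  · obtain ⟨h, h1, h2, -⟩ := exists_homeomorph_image_interior_closure_frontier_eq_unitBall
      (convex_pentagon (T.width (G.edge t.1)) (T.rad (G.source t.1) ^ 2))
      (interior_pentagon_nonempty hE hM hM1) (T.isCompact_poly t).isBounded
    rw [(isClosed_pentagon _ _).closure_eq] at h2
    have h3 : ∀ p, p ∈ T.poly t ↔ h p ∈ Metric.closedBall 0 1 := fun p => by
      rw [← h2, h.injective.mem_set_image]
      rfl
    have h4 : ∀ p, p ∈ T.poly t → (T.zeros t p = ∅ ↔ h p ∈ Metric.ball 0 1) := fun p hp => by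
      rw [← h1, h.injective.mem_set_image, interior_pentagon, eq_empty_iff_forall_notMem]
      exact forall_congr' fun k => ⟨fun hk => lt_of_le_of_ne (hp k) (Ne.symm hk), fun hk => hk.ne'⟩
    have h5 : ∀ x : Metric.closedBall (0 : Fin 2 → ℝ) 1, h.symm x ∈ T.poly t := fun x => by
      rw [h3, h.apply_symm_apply]
      exact x.2
    refine ⟨fun x => h.symm x, h.symm.continuous.comp continuous_subtype_val,
      h.symm.injective.comp Subtype.val_injective, fun x => ⟨h5 x, empty_subset _⟩, fun x => ?_,
      fun p hp _ => ⟨⟨h p, (h3 p).1 hp⟩, h.symm_apply_apply p⟩⟩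
    refine Iff.trans ?_ (h4 _ (h5 x)).symm
    rw [h.apply_symm_apply, mem_ball_zero_iff]
  · exact F.elim

end FiniteGraph.TileSystem

/-! ### Cell structure and Euler characteristic of the surface -/

namespace FiniteGraph.TileSystem

open UpperHalfPlane

variable {G : FiniteGraph.{0}} {T : G.TileSystem}

/-- The faces that are kept: all of them if `w` is true, and otherwise those on the back sheet
and those on the two sides of the tiles opposite to the vertex. -/
def Keep (w : Bool) (t : G.Tile) (J : Set (Fin 5)) : Prop :=
  w = true ∨ t.2.2 = false ∨ 2 ∈ J ∨ 3 ∈ J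

lemma Keep.mono {w : Bool} {t : G.Tile} {J J' : Set (Fin 5)} (hJ : J ⊆ J') (h : Keep w t J) :
    Keep w t J' := by
  rcases h with h | h | h | h
  · exact Or.inl h
  · exact Or.inr (Or.inl h)
  · exact Or.inr (Or.inr (Or.inl (hJ h)))
  · exact Or.inr (Or.inr (Or.inr (hJ h)))

lemma snd_snd_cross {k : Fin 5} (hk : k ≠ 3) (t : G.Tile) : (T.cross k t).2.2 = t.2.2 := by
  fin_cases k
  · rfl
  · rfl
  · rfl
  · exact absurd rfl hk
  · rfl

/-- Only a crossing of side 3 changes the sheet, and faces on side 3 are kept in both sheets. -/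
lemma Linked.keep {w : Bool} {t t' : G.Tile} {J : Set (Fin 5)} (h : T.Linked J t t')
    (hk : Keep w t J) : Keep w t' J := by
  refine h.induct (P := fun t' => Keep w t' J) hk ?_
  rintro s - (h1 | h1 | h1 | h1) k hk
  · exact Or.inl h1
  · rcases eq_or_ne k 3 with rfl | hk3
    · exact Or.inr (Or.inr (Or.inr hk))
    · exact Or.inr (Or.inl ((snd_snd_cross hk3 s).trans h1))
  · exact Or.inr (Or.inr (Or.inl h1))
  · exact Or.inr (Or.inr (Or.inr h1))

variable (T)

/-- The union of the kept faces. -/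
def part (w : Bool) : Set T.Surface := {x | ∃ t p, T.pt t p = x ∧ Keep w t (T.zeros t p)}

variable {T}

lemma pt_mem_part {w : Bool} {t : G.Tile} {p : T.poly t} :
    T.pt t p ∈ T.part w ↔ Keep w t (T.zeros t p) := by
  constructor
  · rintro ⟨t', p', h, hk⟩
    obtain ⟨h1, h2⟩ := T.pt_eq_iff.1 h
    rw [← h1, (h2.mem_poly_and_zeros p'.2).2]
    exact h2.keep hk
  · exact fun h => ⟨t, p, rfl, h⟩

lemma part_true : T.part true = univ :=
  eq_univ_of_forall fun x => by
    obtain ⟨t, p, rfl⟩ := T.exists_pt x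
    exact pt_mem_part.2 (Or.inl rfl)

variable (T)

/-- Tiles up to links across the sides in `J`. -/
def linkSetoid (J : Set (Fin 5)) : Setoid G.Tile where
  r := T.Linked J
  iseqv := ⟨Linked.refl J, Linked.symm, Linked.trans⟩

/-- The cells of dimension `n`. -/
def Cell (w : Bool) (n : ℕ) : Type :=
  Σ F : Face n, {q : Quotient (T.linkSetoid (sides F)) // Keep w q.out (sides F)}

instance (w : Bool) (n : ℕ) : Finite (T.Cell w n) := inferInstanceAs (Finite (Sigma _))

variable {T}

/-- A cell is a face together with a class of tiles linked across the sides through that face. Every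
point lies in the open cell given by the exact set of sides through it. -/
lemma hasEulerChar_part_aux (w : Bool) : HasEulerChar (T.part w)
    (Nat.card (T.Cell w 0) - Nat.card (T.Cell w 1) + Nat.card (T.Cell w 2)) := by
  choose g hg1 hg2 hg3 hg4 hg5 using fun (t : G.Tile) (n : ℕ) (F : Face n) =>
    exists_face_param (T := T) t F
  have hkeep : ∀ (n : ℕ) (c : T.Cell w n) x,
      T.pt c.2.1.out ⟨g c.2.1.out n c.1 x, (hg3 c.2.1.out n c.1 x).1⟩ ∈ T.part w := fun n c x =>
    pt_mem_part.2 (c.2.2.mono (hg3 c.2.1.out n c.1 x).2)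
  -- every point lies in the open cell of its face
  have hcov : ∀ t (p : T.poly t), Keep w t (T.zeros t p) → ∀ (n : ℕ) (F : Face n),
      sides F = T.zeros t p → ∃ (c : T.Cell w n) (x : _),
      T.pt c.2.1.out ⟨g c.2.1.out n c.1 x, (hg3 c.2.1.out n c.1 x).1⟩ = T.pt t p := by
    intro t p hk n F hF
    have hl : T.Linked (sides F) t (Quotient.mk (T.linkSetoid (sides F)) t).out :=
      Linked.symm (Quotient.exact (Quotient.out_eq (Quotient.mk (T.linkSetoid (sides F)) t)))
    have hl' : T.Linked (T.zeros t p) t (Quotient.mk (T.linkSetoid (sides F)) t).out := by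
      rw [← hF]
      exact hl
    obtain ⟨h1, h2⟩ := hl'.mem_poly_and_zeros p.2
    obtain ⟨x, hx⟩ := hg5 _ n F p h1 (by rw [h2, hF])
    refine ⟨⟨F, ⟨Quotient.mk (T.linkSetoid (sides F)) t, hl.keep (by rw [hF]; exact hk)⟩⟩, x, ?_⟩
    exact (T.pt_eq_iff.2 ⟨hx.symm, hl'⟩ : T.pt t p = T.pt _ ⟨_, (hg3 _ n F x).1⟩).symm
  refine hasEulerChar_of_cells (T.Cell w) (fun n => inferInstance) ?_
    (fun n c x => ⟨_, hkeep n c x⟩) ?_ ?_ ?_ ?_ ?_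
  · intro n hn
    obtain ⟨m, rfl⟩ := Nat.exists_eq_add_of_le' hn
    exact ⟨fun c => Empty.elim c.1⟩
  · intro n c
    exact (((T.continuous_pt _).comp ((hg1 _ _ _).subtype_mk _))).subtype_mk _
  · intro n c x y h
    exact hg2 _ _ _ (T.pt_eq_iff.1 (congrArg Subtype.val h)).1
  · rintro n ⟨F, q⟩ m ⟨F', q'⟩ x x' hx hx' h
    obtain ⟨h1, h2⟩ := T.pt_eq_iff.1 (congrArg Subtype.val h)
    have h3 := (h2.mem_poly_and_zeros (hg3 q.1.out n F x).1).2
    have hz := (hg4 q.1.out n F x).1 hx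
    have hz' := (hg4 q'.1.out m F' x').1 hx'
    simp only at h1 h2 h3 hz hz'
    rw [h1, hz'] at h3
    rw [← h1, hz] at h3
    -- Points of open cells know their faces: equal points have equal sets of sides. Once the faces
    -- agree, the gluing relation says that the tiles are linked.
    have h4 := sides_injective h3
    cases h4
    congr 2
    refine Subtype.ext ?_
    rw [← Quotient.out_eq q.1, ← Quotient.out_eq q'.1]
    refine Quotient.sound ?_
    change T.Linked (sides F) _ _
    rw [hz] at h2
    exact h2
  · rintro n ⟨F, q⟩ x hx
    have hz : T.zeros q.1.out (g q.1.out n F x) ≠ sides F := fun h =>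
      ((hg4 _ _ _ _).2 h).ne hx
    obtain ⟨h1, h2⟩ := hg3 q.1.out n F x
    obtain ⟨m, F', hF'⟩ := exists_sides_eq h1
    have hm : m < n := sides_ssubset (F := F) (F' := F') (by
      rw [hF']
      exact lt_of_le_of_ne h2 hz.symm)
    obtain ⟨c, y, hy⟩ := hcov q.1.out ⟨_, h1⟩ (pt_mem_part.1 (hkeep n ⟨F, q⟩ x)) m F' hF'
    exact ⟨m, hm, c, y, Subtype.ext hy⟩
  · rintro ⟨y, hy⟩
    obtain ⟨t, p, rfl⟩ := T.exists_pt y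
    obtain ⟨n, F, hF⟩ := exists_sides_eq p.2
    obtain ⟨c, x, h⟩ := hcov t p (pt_mem_part.1 hy) n F hF
    exact ⟨n, c, x, Subtype.ext h⟩

/-- The classes are counted by a complete invariant `r` of tiles under crossings in `J`; whether a
class is kept is read off from the invariant. -/
lemma card_classes {X : Type} {J : Set (Fin 5)} (r : G.Tile → X)
    (hinv : ∀ k ∈ J, ∀ t, r (T.cross k t) = r t) (hlink : ∀ t t', r t = r t' → T.Linked J t t')
    (hsurj : Function.Surjective r) (w : Bool) (P : X → Prop) (hP : ∀ t, Keep w t J ↔ P (r t)) :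
    Nat.card {q : Quotient (T.linkSetoid J) // Keep w q.out J} = Nat.card {x // P x} := by
  have hr : ∀ t t', T.Linked J t t' → r t = r t' := fun t t' h =>
    h.induct (P := fun t' => r t = r t') rfl fun s _ h1 k hk => h1.trans (hinv k hk s).symm
  let e : Quotient (T.linkSetoid J) ≃ X := Equiv.ofBijective (Quotient.lift r hr) <| by
    constructor
    · rintro ⟨t⟩ ⟨t'⟩ h
      exact Quotient.sound (hlink t t' h)
    · intro x
      obtain ⟨t, rfl⟩ := hsurj x
      exact ⟨Quotient.mk _ t, rfl⟩
  refine Nat.card_congr (e.subtypeEquiv fun q => ?_)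
  rw [hP]
  have : r q.out = e q := by
    conv_rhs => rw [← Quotient.out_eq q]
    rfl
  rw [this]

lemma card_keep (w : Bool) (Y : Type) :
    Nat.card {x : Y × Bool // w = true ∨ x.2 = false} = Nat.card Y * if w then 2 else 1 := by
  cases w
  · let e : {x : Y × Bool // false = true ∨ x.2 = false} ≃ Y :=
      { toFun := fun x => x.1.1
        invFun := fun y => ⟨(y, false), Or.inr rfl⟩
        left_inv := by
          rintro ⟨⟨y, ε⟩, h | h⟩
          · exact absurd h (by decide)
          · obtain rfl : ε = false := h
            rfl
        right_inv := fun y => rfl }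
    rw [Nat.card_congr e]
    simp
  · have e : {x : Y × Bool // true = true ∨ x.2 = false} ≃ Y × Bool :=
      Equiv.subtypeUnivEquiv fun _ => Or.inl rfl
    rw [Nat.card_congr e, Nat.card_prod]
    simp

lemma card_all {X : Type} : Nat.card {_x : X // True} = Nat.card X :=
  Nat.card_congr (Equiv.subtypeUnivEquiv fun _ => trivial)

lemma card_dart (G : FiniteGraph.{0}) : Nat.card G.Dart = 2 * Nat.card G.Edge := by
  classical
  have := Fintype.ofFinite G.Edge
  rw [← Nat.card_congr (Equiv.sigmaFiberEquiv G.edge), Nat.card_sigma]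
  have h : ∀ x : G.Edge, Nat.card {e // G.edge e = x} = 2 := by
    rintro ⟨e₀⟩
    have : {e | G.edge e = Quot.mk _ e₀} = {e₀, G.rev e₀} := by
      ext e
      change G.edge e = G.edge e₀ ↔ e = e₀ ∨ e = G.rev e₀
      rw [eq_comm, edge_eq_iff]
    change Nat.card {e | G.edge e = Quot.mk _ e₀} = 2
    rw [this, Nat.card_coe_set_eq, ncard_pair (G.rev_ne e₀).symm]
  rw [Finset.sum_congr rfl fun x _ => h x]
  simp [mul_comm]

/-- The spoke of a tile. -/
def spoke (T : G.TileSystem) (t : G.Tile) : G.Dart := if t.2.1 then t.1 else T.next.symm t.1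

lemma spoke_cross_four (t : G.Tile) : T.spoke (T.cross 4 t) = T.spoke t := by
  obtain ⟨e, a, ε⟩ := t
  cases a
  · rfl
  · exact T.next.symm_apply_apply e

lemma linked_of_spoke_eq {J : Set (Fin 5)} (hJ : 4 ∈ J) {t t' : G.Tile}
    (h : T.spoke t = T.spoke t') (hε : t.2.2 = t'.2.2) : T.Linked J t t' := by
  obtain ⟨e, a, ε⟩ := t
  obtain ⟨e', a', ε'⟩ := t'
  obtain rfl : ε = ε' := hε
  have hc : T.Linked J (e, a, ε) (T.cross 4 (e, a, ε)) := Linked.cross hJ _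
  cases a <;> cases a'
  · obtain rfl : e = e' := T.next.symm.injective h
    exact Linked.refl _ _
  · obtain rfl : T.next.symm e = e' := h
    exact hc
  · obtain rfl : e = T.next.symm e' := h
    have : T.cross 4 (T.next.symm e', true, ε) = (e', false, ε) := by
      change (T.next (T.next.symm e'), false, ε) = _
      rw [T.next.apply_symm_apply]
    rwa [this] at hc
  · obtain rfl : e = e' := h
    exact Linked.refl _ _

lemma linked_flip {J : Set (Fin 5)} (hJ : 0 ∈ J ∨ 2 ∈ J) (e : G.Dart) (a a' ε : Bool) :
    T.Linked J (e, a, ε) (e, a', ε) := by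
  have h : T.Linked J (e, true, ε) (e, false, ε) := by
    rcases hJ with hJ | hJ
    · exact Linked.cross (T := T) (k := 0) hJ (e, true, ε)
    · exact Linked.cross (T := T) (k := 2) hJ (e, true, ε)
  cases a <;> cases a'
  · exact Linked.refl _ _
  · exact h.symm
  · exact h
  · exact Linked.refl _ _

lemma linked_sheet {J : Set (Fin 5)} (hJ : 3 ∈ J) (e : G.Dart) (a ε ε' : Bool) :
    T.Linked J (e, a, ε) (e, a, ε') := by
  have h : T.Linked J (e, a, true) (e, a, false) := Linked.cross (T := T) (k := 3) hJ (e, a, true)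
  cases ε <;> cases ε'
  · exact Linked.refl _ _
  · exact h.symm
  · exact h
  · exact Linked.refl _ _

lemma linked_edge {J : Set (Fin 5)} (hJ : 0 ∈ J ∨ 2 ∈ J) (h1 : 1 ∈ J) {t t' : G.Tile}
    (h : G.edge t.1 = G.edge t'.1) (hε : t.2.2 = t'.2.2) : T.Linked J t t' := by
  obtain ⟨e, a, ε⟩ := t
  obtain ⟨e', a', ε'⟩ := t'
  obtain rfl : ε = ε' := hε
  rcases G.edge_eq_iff.1 h with h | h
  · obtain rfl : e' = e := h
    exact linked_flip hJ _ _ _ _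
  · obtain rfl : e' = G.rev e := h
    have : T.Linked J (e, a, ε) (G.rev e, !a, ε) := Linked.cross (T := T) (k := 1) h1 (e, a, ε)
    exact this.trans (linked_flip hJ _ _ _ _)

lemma card_cell_two (w : Bool) :
    Nat.card (T.Cell w 2) = Nat.card G.Dart * 2 * if w then 2 else 1 := by
  have h := card_classes (T := T) (J := ∅) (fun t => ((t.1, t.2.1), t.2.2)) (by simp)
    (by
      rintro ⟨e, a, ε⟩ ⟨e', a', ε'⟩ h
      simp only [Prod.mk.injEq] at h
      obtain ⟨⟨rfl, rfl⟩, rfl⟩ := h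
      exact Linked.refl _ _)
    (fun x => ⟨(x.1.1, x.1.2, x.2), rfl⟩) w (fun x => w = true ∨ x.2 = false)
    (fun t => by simp [Keep])
  rw [card_keep, Nat.card_prod, Nat.card_eq_fintype_card (α := Bool), Fintype.card_bool] at h
  rw [← h]
  exact Nat.card_congr (Equiv.uniqueSigma (α := Unit) (fun F : Unit =>
    {q : Quotient (T.linkSetoid (sides (n := 2) F)) // Keep w q.out (sides (n := 2) F)}))

/-- Sides 0, 1 and 4 are classified by a dart and a sheet (for side 4 the dart is the spoke), and
only those on the back sheet are kept when `w` is false. Sides 2 and 3 are always kept; they give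
two classes for every dart. -/
lemma card_cell_one (w : Bool) :
    Nat.card (T.Cell w 1) = 3 * (Nat.card G.Dart * if w then 2 else 1) + 4 * Nat.card G.Dart := by
  have e0 := card_classes (T := T) (J := {0}) (fun t => (t.1, t.2.2)) (by
      rintro k rfl t
      rfl)
    (by
      rintro ⟨e, a, ε⟩ ⟨e', a', ε'⟩ h
      simp only [Prod.mk.injEq] at h
      obtain ⟨rfl, rfl⟩ := h
      exact linked_flip (Or.inl (mem_singleton _)) _ _ _ _)
    (fun x => ⟨(x.1, true, x.2), rfl⟩) w (fun x => w = true ∨ x.2 = false)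
    (fun t => by simp [Keep])
  have e1 := card_classes (T := T) (J := {1})
    (fun t => (if t.2.1 then t.1 else G.rev t.1, t.2.2)) (by
      rintro k rfl ⟨e, a, ε⟩
      cases a <;> simp [cross, G.rev_rev])
    (by
      rintro ⟨e, a, ε⟩ ⟨e', a', ε'⟩ h
      have hc : T.Linked {1} (e, a, ε) (G.rev e, !a, ε) := 
        Linked.cross (T := T) (k := 1) (mem_singleton _) (e, a, ε)
      simp only [Prod.mk.injEq] at h
      obtain ⟨h, rfl⟩ := h
      cases a <;> cases a' <;> simp only [if_true, if_false, Bool.false_eq_true] at h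
      · have := congrArg G.rev h
        rw [G.rev_rev, G.rev_rev] at this
        rw [this]
        exact Linked.refl _ _
      · rwa [h] at hc
      · rw [h, G.rev_rev] at hc
        rw [h]
        exact hc
      · rw [h]
        exact Linked.refl _ _)
    (fun x => ⟨(x.1, true, x.2), rfl⟩) w (fun x => w = true ∨ x.2 = false)
    (fun t => by simp [Keep])
  have e2 := card_classes (T := T) (J := {2}) (fun t => (t.1, t.2.2)) (by
      rintro k rfl t
      rfl)
    (by
      rintro ⟨e, a, ε⟩ ⟨e', a', ε'⟩ h
      simp only [Prod.mk.injEq] at h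
      obtain ⟨rfl, rfl⟩ := h
      exact linked_flip (Or.inr (mem_singleton _)) _ _ _ _)
    (fun x => ⟨(x.1, true, x.2), rfl⟩) w (fun x => True)
    (fun t => by simp [Keep])
  have e3 := card_classes (T := T) (J := {3}) (fun t => (t.1, t.2.1)) (by
      rintro k rfl t
      rfl)
    (by
      rintro ⟨e, a, ε⟩ ⟨e', a', ε'⟩ h
      simp only [Prod.mk.injEq] at h
      obtain ⟨rfl, rfl⟩ := h
      exact linked_sheet (mem_singleton _) _ _ _ _)
    (fun x => ⟨(x.1, x.2, true), rfl⟩) w (fun x => True)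
    (fun t => by simp [Keep])
  have e4 := card_classes (T := T) (J := {4}) (fun t => (T.spoke t, t.2.2)) (by
      rintro k rfl t
      simp only [spoke_cross_four]
      rfl)
    (fun t t' h => linked_of_spoke_eq (mem_singleton _) (Prod.ext_iff.1 h).1 (Prod.ext_iff.1 h).2)
    (fun x => ⟨(x.1, true, x.2), rfl⟩) w (fun x => w = true ∨ x.2 = false)
    (fun t => by simp [Keep])
  rw [card_keep] at e0 e1 e4
  rw [card_all, Nat.card_prod, Nat.card_eq_fintype_card (α := Bool), Fintype.card_bool] at e2 e3
  have h : Nat.card (T.Cell w 1) = Nat.card (Σ k : Fin 5,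
    {q : Quotient (T.linkSetoid {k}) // Keep w q.out {k}}) := rfl
  rw [h, Nat.card_sigma, Fin.sum_univ_five, e0, e1, e2, e3, e4]
  ring

/-- The corners are, in order: edge midpoints (edge and sheet), the corners of sides 1 and 2 (edge
and sheet, always kept), the corners on side 3 (one for each dart and one for each spoke, shared by
the sheets), and the vertices of the graph (vertex and sheet). -/
lemma card_cell_zero (w : Bool) :
    Nat.card (T.Cell w 0) = (Nat.card G.Vertex + Nat.card G.Edge) * (if w then 2 else 1) +
      2 * Nat.card G.Edge + 2 * Nat.card G.Dart := by
  have e0 := card_classes (T := T) (J := {0, 0 + 1}) (fun t => (G.edge t.1, t.2.2)) (by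
      rintro k (rfl | rfl) t
      · rfl
      · exact Prod.ext (G.edge_rev t.1) rfl)
    (fun t t' h => linked_edge (Or.inl (by simp)) (by simp) (Prod.ext_iff.1 h).1
      (Prod.ext_iff.1 h).2)
    (fun ⟨x, ε⟩ => by
      obtain ⟨e, rfl⟩ := Quotient.exists_rep x
      exact ⟨(e, true, ε), rfl⟩) w (fun x => w = true ∨ x.2 = false)
    (fun t => by simp [Keep])
  have e1 := card_classes (T := T) (J := {1, 1 + 1}) (fun t => (G.edge t.1, t.2.2)) (by
      rintro k (rfl | rfl) t
      · exact Prod.ext (G.edge_rev t.1) rfl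
      · rfl)
    (fun t t' h => linked_edge (Or.inr (by simp)) (by simp) (Prod.ext_iff.1 h).1
      (Prod.ext_iff.1 h).2)
    (fun ⟨x, ε⟩ => by
      obtain ⟨e, rfl⟩ := Quotient.exists_rep x
      exact ⟨(e, true, ε), rfl⟩) w (fun x => True)
    (fun t => iff_of_true (Or.inr (Or.inr (Or.inl (Or.inr rfl)))) trivial)
  have e2 := card_classes (T := T) (J := {2, 2 + 1}) (fun t => t.1) (by
      rintro k (rfl | rfl) t
      · rfl
      · rfl)
    (by
      rintro ⟨e, a, ε⟩ ⟨e', a', ε'⟩ h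
      obtain rfl : e = e' := h
      exact (linked_flip (Or.inr (by simp)) e a a' ε).trans
        (linked_sheet (by simp) e a' ε ε'))
    (fun e => ⟨(e, true, true), rfl⟩) w (fun x => True)
    (fun t => iff_of_true (Or.inr (Or.inr (Or.inl (Or.inl rfl)))) trivial)
  have e3 := card_classes (T := T) (J := {3, 3 + 1}) (fun t => T.spoke t) (by
      rintro k (rfl | rfl) t
      · rfl
      · exact spoke_cross_four t)
    (by
      rintro ⟨e, a, ε⟩ t' h
      exact (linked_sheet (by simp) e a ε t'.2.2).trans
        (linked_of_spoke_eq (by simp) h rfl))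
    (fun e => ⟨(e, true, true), rfl⟩) w (fun x => True)
    (fun t => iff_of_true (Or.inr (Or.inr (Or.inr (Or.inl rfl)))) trivial)
  have e4 := card_classes (T := T) (J := {4, 4 + 1}) (fun t => (G.source t.1, t.2.2)) (by
      rintro k (rfl | rfl) t
      · exact Prod.ext (T.source_cross_four t) rfl
      · rfl)
    (fun t t' h => linked_vertex_iff.2 ⟨(Prod.ext_iff.1 h).1, (Prod.ext_iff.1 h).2⟩)
    (fun ⟨x, ε⟩ => by
      obtain ⟨e, rfl⟩ := Quotient.exists_rep x
      exact ⟨(e, true, ε), rfl⟩) w (fun x => w = true ∨ x.2 = false)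
    (fun t => by simp [Keep])
  rw [card_keep] at e0 e4
  rw [card_all, Nat.card_prod, Nat.card_eq_fintype_card (α := Bool), Fintype.card_bool] at e1
  rw [card_all] at e2 e3
  have h : Nat.card (T.Cell w 0) = Nat.card (Σ k : Fin 5,
    {q : Quotient (T.linkSetoid {k, k + 1}) // Keep w q.out {k, k + 1}}) := rfl
  rw [h, Nat.card_sigma, Fin.sum_univ_five, e0, e1, e2, e3, e4]
  ring

lemma hasEulerChar_part (w : Bool) : HasEulerChar (T.part w)
    ((if w then 2 else 1) * (Nat.card G.Vertex - Nat.card G.Edge : ℤ) - 2 * Nat.card G.Edge) := by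
  convert hasEulerChar_part_aux (T := T) w using 1
  rw [card_cell_zero, card_cell_one, card_cell_two, card_dart]
  push_cast
  split_ifs <;> ring

lemma hasEulerChar_surface : HasEulerChar T.Surface
    (2 * (Nat.card G.Vertex - Nat.card G.Edge : ℤ) - 2 * Nat.card G.Edge) := by
  have h := hasEulerChar_part (T := T) true
  rw [if_pos rfl] at h
  exact h.of_homotopyEquiv
    ((Homeomorph.Set.univ T.Surface).symm.trans
      (Homeomorph.setCongr part_true.symm)).toHomotopyEquiv

end FiniteGraph.TileSystem

/-! ### Retraction of the complement of the graph -/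

namespace UpperHalfPlane

/-- The intersection point of two sides of a tile, beyond the two sides opposite to the vertex. -/
noncomputable def apex (E M : ℝ) : Fin 2 → ℝ := ![2 * (E - M) / (1 - M), E]

/-- The lines of sides 1 and 4 meet beyond sides 2 and 3. A segment from a point of the tile to the
apex moves away from the leg, stays on side 1 or 4 if it starts there, and leaves the tile through
side 2 or 3. It does no harm that the apex is outside the hyperbolic plane. -/
lemma lineForm_apex {E M : ℝ} (hE : 100 ≤ E) (hM : 0 < M) (hM1 : M < 1) :
    0 < lineForm (side E M 0) (apex E M) ∧ lineForm (side E M 1) (apex E M) = 0 ∧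
    lineForm (side E M 2) (apex E M) < 0 ∧ lineForm (side E M 3) (apex E M) < 0 ∧
    lineForm (side E M 4) (apex E M) = 0 := by
  obtain ⟨f0, f1, f2, f3, f4⟩ := side_form E M (apex E M)
  rw [f0, f1, f2, f3, f4]
  have h1 : 0 < 1 - M := by linarith
  have e0 : apex E M 0 = 2 * (E - M) / (1 - M) := rfl
  have e1 : apex E M 1 = E := rfl
  rw [e0, e1]
  refine ⟨div_pos (by linarith) h1, by ring, ?_, ?_, by field_simp; ring⟩
  · have : E + E - (1 + E) / 2 * (2 * (E - M) / (1 - M)) =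
        (2 * E * (1 - M) - (1 + E) * (E - M)) / (1 - M) := by field_simp; ring
    rw [this]
    exact div_neg_of_neg_of_pos (by nlinarith) h1
  · have : E + 1 - 4 * (2 * (E - M) / (1 - M)) =
        ((E + 1) * (1 - M) - 8 * (E - M)) / (1 - M) := by field_simp; ring
    rw [this]
    exact div_neg_of_neg_of_pos (by nlinarith) h1

/-- The time at which the segment from `p` towards the apex crosses the side `k`. -/
noncomputable def crossTime (E M : ℝ) (k : Fin 5) (p : Fin 2 → ℝ) : ℝ :=
  lineForm (side E M k) p / (lineForm (side E M k) p - lineForm (side E M k) (apex E M))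

/-- The last point of the tile on the segment from `p` to the apex. -/
noncomputable def exitPoint (E M : ℝ) (p : Fin 2 → ℝ) : Fin 2 → ℝ :=
  (1 - min (crossTime E M 2 p) (crossTime E M 3 p)) • p +
    min (crossTime E M 2 p) (crossTime E M 3 p) • apex E M

section

variable {E M : ℝ} (hE : 100 ≤ E) (hM : 0 < M) (hM1 : M < 1)
include hE hM hM1

lemma crossTime_spec {p : Fin 2 → ℝ} (hp : p ∈ pentagon E M) {k : Fin 5} (hk : k = 2 ∨ k = 3) :
    0 ≤ crossTime E M k p ∧ crossTime E M k p < 1 ∧ ∀ r, 0 ≤ r →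
      (r ≤ crossTime E M k p → 0 ≤ lineForm (side E M k) ((1 - r) • p + r • apex E M)) ∧
      (r = crossTime E M k p → lineForm (side E M k) ((1 - r) • p + r • apex E M) = 0) := by
  have hneg : lineForm (side E M k) (apex E M) < 0 := by
    rcases hk with rfl | rfl
    · exact (lineForm_apex hE hM hM1).2.2.1
    · exact (lineForm_apex hE hM hM1).2.2.2.1
  have h0 := hp k
  have hd : 0 < lineForm (side E M k) p - lineForm (side E M k) (apex E M) := by linarith
  refine ⟨div_nonneg h0 hd.le, (div_lt_one hd).2 (by linarith), fun r hr => ⟨fun h => ?_,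
    fun h => ?_⟩⟩
  · rw [lineForm_combo _ _ _ (by ring)]
    rw [crossTime, le_div_iff₀ hd] at h
    linarith
  · rw [lineForm_combo _ _ _ (by ring)]
    rw [crossTime, eq_div_iff hd.ne'] at h
    linarith

lemma exitPoint_spec {p : Fin 2 → ℝ} (hp : p ∈ pentagon E M) :
    exitPoint E M p ∈ pentagon E M ∧
    (lineForm (side E M 2) (exitPoint E M p) = 0 ∨ lineForm (side E M 3) (exitPoint E M p) = 0) ∧
    (0 < lineForm (side E M 0) p → 0 < lineForm (side E M 0) (exitPoint E M p)) ∧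
    (lineForm (side E M 1) p = 0 → lineForm (side E M 1) (exitPoint E M p) = 0) ∧
    (lineForm (side E M 4) p = 0 → lineForm (side E M 4) (exitPoint E M p) = 0) ∧
    (lineForm (side E M 2) p = 0 ∨ lineForm (side E M 3) p = 0 → exitPoint E M p = p) := by
  obtain ⟨q0, q1, q2, q3, q4⟩ := lineForm_apex hE hM hM1
  obtain ⟨a1, a2, a3⟩ := crossTime_spec hE hM hM1 hp (k := 2) (Or.inl rfl)
  obtain ⟨b1, b2, b3⟩ := crossTime_spec hE hM hM1 hp (k := 3) (Or.inr rfl)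
  have r0 : 0 ≤ min (crossTime E M 2 p) (crossTime E M 3 p) := le_min a1 b1
  have r1 : min (crossTime E M 2 p) (crossTime E M 3 p) < 1 := (min_le_left _ _).trans_lt a2
  have r2 := min_le_left (crossTime E M 2 p) (crossTime E M 3 p)
  have r3 := min_le_right (crossTime E M 2 p) (crossTime E M 3 p)
  have r4 := min_choice (crossTime E M 2 p) (crossTime E M 3 p)
  have r5 : lineForm (side E M 2) p = 0 ∨ lineForm (side E M 3) p = 0 →
      min (crossTime E M 2 p) (crossTime E M 3 p) = 0 := by
    rintro (h | h)
    · refine le_antisymm (r2.trans ?_) r0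
      rw [crossTime, h, zero_div]
    · refine le_antisymm (r3.trans ?_) r0
      rw [crossTime, h, zero_div]
  unfold exitPoint
  set r := min (crossTime E M 2 p) (crossTime E M 3 p)
  have hc : ∀ k, lineForm (side E M k) ((1 - r) • p + r • apex E M) =
      (1 - r) * lineForm (side E M k) p + r * lineForm (side E M k) (apex E M) := fun k =>
    lineForm_combo _ _ _ (by ring)
  refine ⟨forall_fin_five.2 ⟨?_, ?_, (a3 r r0).1 r2, (b3 r r0).1 r3, ?_⟩, ?_, fun h => ?_,
    fun h => ?_, fun h => ?_, fun h => ?_⟩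
  · rw [hc]
    have := hp 0
    nlinarith
  · rw [hc, q1]
    have := hp 1
    nlinarith
  · rw [hc, q4]
    have := hp 4
    nlinarith
  · exact r4.imp (a3 r r0).2 (b3 r r0).2
  · rw [hc]
    nlinarith
  · rw [hc, h, q1]
    ring
  · rw [hc, h, q4]
    ring
  · rw [r5 h]
    simp

lemma continuousOn_exitPoint : ContinuousOn (exitPoint E M) (pentagon E M) := by
  have h : ∀ k : Fin 5, k = 2 ∨ k = 3 → ContinuousOn (crossTime E M k) (pentagon E M) := by
    intro k hk
    have hneg : lineForm (side E M k) (apex E M) < 0 := by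
      rcases hk with rfl | rfl
      · exact (lineForm_apex hE hM hM1).2.2.1
      · exact (lineForm_apex hE hM hM1).2.2.2.1
    refine (continuous_lineForm _).continuousOn.div
      ((continuous_lineForm _).sub continuous_const).continuousOn fun p hp => ?_
    have := hp k
    linarith
  have h2 := continuous_min.comp_continuousOn ((h 2 (Or.inl rfl)).prodMk (h 3 (Or.inr rfl)))
  exact ((continuousOn_const.sub h2).smul continuousOn_id).add (h2.smul continuousOn_const)

end

end UpperHalfPlane

namespace FiniteGraph.TileSystem

open UpperHalfPlane

variable {G : FiniteGraph.{0}} {T : G.TileSystem}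

lemma pt_cross {t : G.Tile} (p : T.poly t) {k : Fin 5} (hk : k ∈ T.zeros t p) :
    T.pt t p = T.pt (T.cross k t) ⟨p, T.mem_poly_cross p.2 hk⟩ :=
  T.pt_eq_iff.2 ⟨rfl, Linked.cross hk t⟩

variable (T)

/-- The embedded graph: the legs of the front tiles. -/
def graphSet : Set T.Surface := {x | ∃ t p, T.pt t p = x ∧ t.2.2 = true ∧ 0 ∈ T.zeros t p}

variable {T}

/-- Independence of the representative holds because sides 0 and 3 do not meet: at a point of a leg
no identification changes the sheet. -/
lemma pt_mem_graphSet {t : G.Tile} {p : T.poly t} :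
    T.pt t p ∈ T.graphSet ↔ t.2.2 = true ∧ 0 ∈ T.zeros t p := by
  constructor
  · rintro ⟨t', p', h, h1, h2⟩
    obtain ⟨e1, e2⟩ := T.pt_eq_iff.1 h
    have hz := (e2.mem_poly_and_zeros p'.2).2
    rw [← e1, hz]
    refine ⟨e2.induct (P := fun t => t.2.2 = true) h1 fun s hs h k hk => ?_, h2⟩
    rw [← h]
    refine snd_snd_cross ?_ s
    rintro rfl
    exact absurd (T.adjacent p'.2 h2 hk) (by decide)
  · exact fun h => ⟨t, p, rfl, h⟩

variable (T)

/-- Where a point of a tile is moved by the retraction. -/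
noncomputable def goal (t : G.Tile) (p : Fin 2 → ℝ) : Fin 2 → ℝ :=
  if t.2.2 then exitPoint (T.width (G.edge t.1)) (T.rad (G.source t.1) ^ 2) p else p

variable {T}

lemma goal_of_eq_false {t : G.Tile} (ht : t.2.2 = false) (p : Fin 2 → ℝ) : T.goal t p = p :=
  if_neg (by simp [ht])

lemma goal_spec {t : G.Tile} {p : Fin 2 → ℝ} (hp : p ∈ T.poly t) (ht : t.2.2 = true) :
    T.goal t p ∈ T.poly t ∧ (2 ∈ T.zeros t (T.goal t p) ∨ 3 ∈ T.zeros t (T.goal t p)) ∧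
    (0 ∉ T.zeros t p → 0 < lineForm (T.form t 0) (T.goal t p)) ∧
    (1 ∈ T.zeros t p → 1 ∈ T.zeros t (T.goal t p)) ∧
    (4 ∈ T.zeros t p → 4 ∈ T.zeros t (T.goal t p)) ∧
    (2 ∈ T.zeros t p ∨ 3 ∈ T.zeros t p → T.goal t p = p) := by
  obtain ⟨h1, h2, h3, h4⟩ :=
    exitPoint_spec (T.width_ge (G.edge t.1)) (T.sq_rad_pos (G.source t.1)) (T.sq_rad_lt_one _) hp
  rw [goal, if_pos ht]
  exact ⟨h1, h2, fun h => h3 (lt_of_le_of_ne (hp 0) (Ne.symm h)), h4⟩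

lemma goal_mem {t : G.Tile} {p : Fin 2 → ℝ} (hp : p ∈ T.poly t) : T.goal t p ∈ T.poly t := by
  cases ht : t.2.2
  · rwa [goal_of_eq_false ht]
  · exact (goal_spec hp ht).1

lemma continuousOn_goal (t : G.Tile) : ContinuousOn (T.goal t) (T.poly t) := by
  cases ht : t.2.2
  · refine continuousOn_id.congr fun p _ => ?_
    exact goal_of_eq_false ht p
  · refine (continuousOn_exitPoint (T.width_ge _) (T.sq_rad_pos _) (T.sq_rad_lt_one _)).congr
      fun p _ => ?_
    rw [goal, if_pos ht]

/-- This compatibility makes the retraction well defined off the graph. Points on sides 2 or 3 and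
on the back sheet do not move, and side 0 is excluded on the front sheet, so only sides 1 and 4
remain. -/
lemma goal_cross {t : G.Tile} {p : Fin 2 → ℝ} (hp : p ∈ T.poly t) {k : Fin 5}
    (hk : k ∈ T.zeros t p) (h0 : t.2.2 = true → 0 ∉ T.zeros t p) :
    T.goal (T.cross k t) p = T.goal t p ∧ k ∈ T.zeros t (T.goal t p) := by
  have hp' := T.mem_poly_cross hp hk
  have hz := T.zeros_cross hp hk
  have hk' := hk
  rw [← hz] at hk'
  have key : 2 ∈ T.zeros t p ∨ 3 ∈ T.zeros t p →
      T.goal (T.cross k t) p = T.goal t p ∧ k ∈ T.zeros t (T.goal t p) := by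
    intro h
    have e1 : T.goal t p = p := by
      cases ht : t.2.2
      · exact goal_of_eq_false ht p
      · exact (goal_spec hp ht).2.2.2.2.2 h
    have e2 : T.goal (T.cross k t) p = p := by
      cases ht : (T.cross k t).2.2
      · exact goal_of_eq_false ht p
      · refine (goal_spec hp' ht).2.2.2.2.2 ?_
        rwa [hz]
    rw [e1, e2]
    exact ⟨rfl, hk⟩
  by_cases h23 : 2 ∈ T.zeros t p ∨ 3 ∈ T.zeros t p
  · exact key h23
  have hk3 : k ≠ 3 := fun h => h23 (Or.inr (h ▸ hk))
  have hk2 : k ≠ 2 := fun h => h23 (Or.inl (h ▸ hk))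
  have hε := snd_snd_cross (T := T) hk3 t
  cases ht : t.2.2
  · rw [ht] at hε
    rw [goal_of_eq_false ht, goal_of_eq_false hε]
    exact ⟨rfl, hk⟩
  · rw [ht] at hε
    obtain ⟨g1, g2, -, g3, g4, -⟩ := goal_spec hp ht
    obtain ⟨g1', g2', -, g3', g4', -⟩ := goal_spec hp' hε
    have hk0 : k ≠ 0 := fun h => h0 ht (h ▸ hk)
    -- A point on side 1 is moved along it to the corner of sides 1 and 2, a point on side 4 to the
    -- corner of sides 3 and 4. These corners are common to both tiles.
    obtain rfl | rfl : k = 1 ∨ k = 4 := by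
      clear hk hp' hz hk' key hε g1' g2' g3' g4'
      revert k
      decide
    · have z1 := g3 hk
      have z2 := g2.resolve_right fun h => absurd (T.adjacent g1 z1 h) (by decide)
      have z1' := g3' hk'
      have z2' := g2'.resolve_right fun h => absurd (T.adjacent g1' z1' h) (by decide)
      refine ⟨?_, z1⟩
      have w1 : lineForm (T.form (T.cross 1 t) 1) (T.goal (T.cross 1 t) p) = 0 := z1'
      have w2 : lineForm (T.form (T.cross 1 t) 2) (T.goal (T.cross 1 t) p) = 0 := z2'
      rw [T.form_cross t (by decide)] at w1 w2
      exact (eq_corner (T.width_ge _) (T.sq_rad_pos _) (T.sq_rad_lt_one _) (k := 1) w1 w2).trans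
        (eq_corner (T.width_ge _) (T.sq_rad_pos _) (T.sq_rad_lt_one _) (k := 1) z1 z2).symm
    · have z1 := g4 hk
      have z2 := g2.resolve_left fun h => absurd (T.adjacent g1 z1 h) (by decide)
      have z1' := g4' hk'
      have z2' := g2'.resolve_left fun h => absurd (T.adjacent g1' z1' h) (by decide)
      refine ⟨?_, z1⟩
      have w1 : lineForm (T.form (T.cross 4 t) 4) (T.goal (T.cross 4 t) p) = 0 := z1'
      have w2 : lineForm (T.form (T.cross 4 t) 3) (T.goal (T.cross 4 t) p) = 0 := z2'
      rw [T.form_cross t (by decide)] at w1 w2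
      exact (eq_corner (T.width_ge _) (T.sq_rad_pos _) (T.sq_rad_lt_one _) (k := 3) w2 w1).trans
        (eq_corner (T.width_ge _) (T.sq_rad_pos _) (T.sq_rad_lt_one _) (k := 3) z2 z1).symm

lemma goal_linked {t t' : G.Tile} {p : Fin 2 → ℝ} (hp : p ∈ T.poly t)
    (h0 : t.2.2 = true → 0 ∉ T.zeros t p) (h : T.Linked (T.zeros t p) t t') :
    T.goal t' p = T.goal t p ∧ T.zeros t p ⊆ T.zeros t (T.goal t p) := by
  refine ⟨?_, fun k hk => (goal_cross hp hk h0).2⟩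
  have h0' : ∀ s, T.Linked (T.zeros t p) t s → s.2.2 = true → 0 ∉ T.zeros s p := by
    intro s hs h1 h2
    obtain ⟨h3, h4⟩ := hs.mem_poly_and_zeros hp
    have h5 : T.pt s ⟨p, h3⟩ ∈ T.graphSet := pt_mem_graphSet.2 ⟨h1, h2⟩
    rw [← (T.pt_eq_iff (p := ⟨p, hp⟩) (p' := ⟨p, h3⟩)).2 ⟨rfl, hs⟩] at h5
    obtain ⟨h6, h7⟩ := pt_mem_graphSet.1 h5
    exact h0 h6 h7
  refine h.induct (P := fun t' => T.goal t' p = T.goal t p) rfl fun s hs h1 k hk => ?_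
  obtain ⟨h3, h4⟩ := hs.mem_poly_and_zeros hp
  rw [← h4] at hk
  exact (goal_cross h3 hk (h0' s hs)).1.trans h1

/-- Moving a point of a tile towards its goal. -/
noncomputable def slide (T : G.TileSystem) (t : G.Tile) (s : unitInterval) (p : T.poly t) :
    T.poly t :=
  ⟨(1 - s : ℝ) • (p : Fin 2 → ℝ) + (s : ℝ) • T.goal t p, convex_pentagon _ _ p.2 (goal_mem p.2)
    (by linarith [s.2.2]) s.2.1 (by ring)⟩

lemma pt_slide_eq {t t' : G.Tile} {p : T.poly t} {p' : T.poly t'} (h : T.pt t p = T.pt t' p')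
    (h0 : T.pt t p ∉ T.graphSet) (s : unitInterval) :
    T.pt t (T.slide t s p) = T.pt t' (T.slide t' s p') := by
  obtain ⟨e1, e2⟩ := T.pt_eq_iff.1 h
  obtain ⟨g1, g2⟩ := goal_linked p.2 (fun h1 h2 => h0 (pt_mem_graphSet.2 ⟨h1, h2⟩)) e2
  refine T.pt_eq_iff.2 ⟨?_, e2.mono fun k hk => ?_⟩
  · simp only [slide]
    rw [← e1, g1]
  · change lineForm _ _ = 0
    simp only [slide]
    rw [lineForm_combo _ _ _ (by ring), show lineForm (T.form t k) p = 0 from hk,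
      show lineForm (T.form t k) (T.goal t p) = 0 from g2 hk]
    simp

lemma slide_zero (t : G.Tile) (p : T.poly t) : T.slide t 0 p = p :=
  Subtype.ext (by simp [slide])

lemma slide_one (t : G.Tile) (p : T.poly t) : (T.slide t 1 p : Fin 2 → ℝ) = T.goal t p := by
  simp [slide]

lemma pt_slide_notMem {t : G.Tile} {p : T.poly t} (h0 : T.pt t p ∉ T.graphSet)
    (s : unitInterval) : T.pt t (T.slide t s p) ∉ T.graphSet := by
  rw [pt_mem_graphSet, not_and] at h0 ⊢
  intro ht h
  have h1 : 0 < lineForm (T.form t 0) p := lt_of_le_of_ne (p.2 0) (Ne.symm (h0 ht))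
  have h2 := (goal_spec p.2 ht).2.2.1 (h0 ht)
  have h3 : lineForm (T.form t 0) (T.slide t s p) = 0 := h
  simp only [slide] at h3
  rw [lineForm_combo _ _ _ (by ring)] at h3
  have h4 := s.2.1
  have h5 := s.2.2
  rcases h4.eq_or_lt with h6 | h6
  · rw [← h6] at h3
    linarith
  · nlinarith

lemma pt_slide_one_mem (t : G.Tile) (p : T.poly t) : T.pt t (T.slide t 1 p) ∈ T.part false := by
  rw [pt_mem_part, slide_one]
  cases ht : t.2.2
  · exact Or.inr (Or.inl ht)
  · exact Or.inr (Or.inr (goal_spec p.2 ht).2.1)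

lemma slide_of_mem_part {t : G.Tile} {p : T.poly t} (h : T.pt t p ∈ T.part false)
    (s : unitInterval) : T.slide t s p = p := by
  have hg : T.goal t p = p := by
    cases ht : t.2.2
    · exact goal_of_eq_false ht p
    · rcases pt_mem_part.1 h with h | h | h
      · exact absurd h (by decide)
      · exact absurd (ht.symm.trans h) (by decide)
      · exact (goal_spec p.2 ht).2.2.2.2.2 h
  refine Subtype.ext ?_
  change (1 - s : ℝ) • (p : Fin 2 → ℝ) + (s : ℝ) • T.goal t p = p
  rw [hg]
  module

lemma part_false_subset : T.part false ⊆ T.graphSetᶜ := by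
  intro x hx hx'
  obtain ⟨t, p, rfl⟩ := T.exists_pt x
  obtain ⟨h1, h2⟩ := pt_mem_graphSet.1 hx'
  rcases pt_mem_part.1 hx with h | h | h | h
  · exact absurd h (by decide)
  · exact absurd (h1.symm.trans h) (by decide)
  · exact absurd (T.adjacent p.2 h2 h) (by decide)
  · exact absurd (T.adjacent p.2 h2 h) (by decide)

/-- The deformation of the complement of the graph. -/
noncomputable def deform (T : G.TileSystem) (x : T.Surface) (s : unitInterval) : T.Surface :=
  T.pt (T.exists_pt x).choose (T.slide _ s (T.exists_pt x).choose_spec.choose)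

lemma deform_pt {t : G.Tile} {p : T.poly t} (h0 : T.pt t p ∉ T.graphSet) (s : unitInterval) :
    T.deform (T.pt t p) s = T.pt t (T.slide t s p) :=
  (pt_slide_eq (T.exists_pt (T.pt t p)).choose_spec.choose_spec.symm h0 s).symm

/-- The images of the tiles are finitely many closed sets covering the surface, and on each of them
the deformation is given by the continuous formula `slide`. -/
lemma continuous_deform :
    Continuous fun x : (T.graphSetᶜ : Set T.Surface) × unitInterval => T.deform x.1 x.2 := by
  refine (locallyFinite_of_finite fun t : G.Tile =>
    {x : (T.graphSetᶜ : Set T.Surface) × unitInterval | (x.1 : T.Surface) ∈ range (T.pt t)}).continuous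
    ?_ ?_ ?_
  · refine eq_univ_of_forall fun x => mem_iUnion.2 ?_
    obtain ⟨t, p, h⟩ := T.exists_pt x.1
    exact ⟨t, p, h⟩
  · intro t
    exact (isCompact_range (T.continuous_pt t)).isClosed.preimage
      (continuous_subtype_val.comp continuous_fst)
  · intro t
    rw [continuousOn_iff_continuous_domRestrict]
    have hfold : ∀ x : {x : (T.graphSetᶜ : Set T.Surface) × unitInterval |
        (x.1 : T.Surface) ∈ range (T.pt t)}, T.fold x.1.1 ∈ T.poly t := by
      rintro ⟨x, p, h⟩
      change T.fold (x.1 : T.Surface) ∈ _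
      rw [← h]
      exact p.2
    have hc : Continuous fun x : {x : (T.graphSetᶜ : Set T.Surface) × unitInterval |
        (x.1 : T.Surface) ∈ range (T.pt t)} => (⟨T.fold x.1.1, hfold x⟩ : T.poly t) :=
      (T.continuous_fold.comp (continuous_subtype_val.comp
        (continuous_fst.comp continuous_subtype_val))).subtype_mk _
    have hg : Continuous fun p : T.poly t => T.goal t p :=
      continuousOn_iff_continuous_domRestrict.1 (continuousOn_goal t)
    have hs : Continuous fun x : {x : (T.graphSetᶜ : Set T.Surface) × unitInterval |
        (x.1 : T.Surface) ∈ range (T.pt t)} => T.pt t (T.slide t x.1.2 ⟨T.fold x.1.1, hfold x⟩) := by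
      refine (T.continuous_pt t).comp (Continuous.subtype_mk ?_ _)
      have h1 : Continuous fun x : {x : (T.graphSetᶜ : Set T.Surface) × unitInterval |
        (x.1 : T.Surface) ∈ range (T.pt t)} => (x.1.2 : ℝ) :=
        continuous_subtype_val.comp (continuous_snd.comp continuous_subtype_val)
      exact ((continuous_const.sub h1).smul (continuous_subtype_val.comp hc)).add
        (h1.smul (hg.comp hc))
    refine hs.congr ?_
    rintro ⟨⟨⟨x, hx⟩, s⟩, p, h⟩
    have h' : T.pt t p = x := h
    subst h'
    exact (deform_pt hx s).symm

/-- The deformation ends in `part false`, fixes it pointwise and never meets the graph. The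
complement is thus homotopy equivalent to that subcomplex, whose cells have been counted. -/
lemma hasEulerChar_compl : HasEulerChar (T.graphSetᶜ : Set T.Surface)
    ((Nat.card G.Vertex : ℤ) - 3 * Nat.card G.Edge) := by
  have h := hasEulerChar_part (T := T) false
  rw [if_neg (by decide)] at h
  have hmem : ∀ x : (T.graphSetᶜ : Set T.Surface), ∀ s, T.deform x s ∈ T.graphSetᶜ := by
    rintro ⟨x, hx⟩ s
    obtain ⟨t, p, rfl⟩ := T.exists_pt x
    rw [deform_pt hx]
    exact pt_slide_notMem hx s
  have hone : ∀ x : (T.graphSetᶜ : Set T.Surface), T.deform x 1 ∈ T.part false := by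
    rintro ⟨x, hx⟩
    obtain ⟨t, p, rfl⟩ := T.exists_pt x
    rw [deform_pt hx]
    exact pt_slide_one_mem t p
  have hzero : ∀ x : (T.graphSetᶜ : Set T.Surface), T.deform x 0 = x := by
    rintro ⟨x, hx⟩
    obtain ⟨t, p, rfl⟩ := T.exists_pt x
    rw [deform_pt hx, slide_zero]
  have hfix : ∀ x ∈ T.part false, ∀ s, T.deform x s = x := by
    intro x hx s
    obtain ⟨t, p, rfl⟩ := T.exists_pt x
    rw [deform_pt (part_false_subset hx), slide_of_mem_part hx]
  let r : C((T.graphSetᶜ : Set T.Surface), T.part false) :=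
    ⟨fun x => ⟨T.deform x 1, hone x⟩, (continuous_deform.comp
      (continuous_id.prodMk continuous_const)).subtype_mk _⟩
  let i : C(T.part false, (T.graphSetᶜ : Set T.Surface)) :=
    ⟨fun x => ⟨x, part_false_subset x.2⟩, continuous_subtype_val.subtype_mk _⟩
  let H : ContinuousMap.Homotopy (ContinuousMap.id (T.graphSetᶜ : Set T.Surface)) (i.comp r) :=
    { toFun := fun x => ⟨T.deform x.2 x.1, hmem x.2 x.1⟩
      continuous_toFun := (continuous_deform.comp continuous_swap).subtype_mk _
      map_zero_left := fun x => Subtype.ext (hzero x)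
      map_one_left := fun x => rfl }
  have e : ContinuousMap.HomotopyEquiv (T.graphSetᶜ : Set T.Surface) (T.part false) :=
    { toFun := r
      invFun := i
      left_inv := ⟨H.symm⟩
      right_inv := by
        have : r.comp i = ContinuousMap.id _ := by
          ext x
          exact congrArg Subtype.val (Subtype.ext (hfix x x.2 1) : r (i x) = x)
        rw [this] }
  convert h.of_homotopyEquiv e using 1
  ring

/-! ### Connectedness of the surface and of the complement -/

lemma linked_of_connected (hG : G.Connected) (t t' : G.Tile) : T.Linked {0}ᶜ t t' := by
  have hflip : ∀ (e : G.Dart) (a a' ε ε' : Bool), T.Linked {0}ᶜ (e, a, ε) (e, a', ε') :=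
    fun e a a' ε ε' => (linked_flip (Or.inr (by simp)) e a a' ε).trans
      (linked_sheet (by simp) e a' ε ε')
  have hnext : ∀ (e : G.Dart), T.Linked {0}ᶜ (e, true, true) (T.next e, true, true) := fun e =>
    (Linked.cross (T := T) (k := 4) (by simp) (e, true, true)).trans (hflip _ _ _ _ _)
  have hsource : ∀ (e e' : G.Dart), G.source e = G.source e' →
      T.Linked {0}ᶜ (e, true, true) (e', true, true) := by
    intro e e' h
    have h3 : (T.next ^ (T.pos e' - T.pos e)) e = e' := zpow_eq h (by rw [add_sub_cancel])
    rw [← h3]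
    induction (T.pos e' - T.pos e) using Int.induction_on with
    | zero => exact Linked.refl _ _
    | succ i ih =>
      rw [add_comm, zpow_add, zpow_one, Equiv.Perm.mul_apply]
      exact ih.trans (hnext _)
    | pred i ih =>
      refine ih.trans (Linked.symm ?_)
      have := hnext ((T.next ^ (-(i : ℤ) - 1)) e)
      rwa [← Equiv.Perm.mul_apply, ← zpow_one_add, add_sub_cancel] at this
  have hall : ∀ v w : G.Vertex, ∀ e e', G.source e = v → G.source e' = w →
      T.Linked {0}ᶜ (e, true, true) (e', true, true) := by
    intro v w e e' he he'
    have h := hG v w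
    induction h generalizing e' with
    | refl => exact hsource e e' (he.trans he'.symm)
    | tail _ hbc ih =>
      obtain ⟨f, hf, hf'⟩ := hbc
      have h1 : T.Linked {0}ᶜ (f, true, true) (G.rev f, true, true) :=
        (Linked.cross (T := T) (k := 1) (by simp) (f, true, true)).trans (hflip _ _ _ _ _)
      exact ((ih f hf).trans h1).trans (hsource _ _ (hf'.trans he'.symm))
  obtain ⟨e, a, ε⟩ := t
  obtain ⟨e', a', ε'⟩ := t'
  exact ((hflip _ _ _ _ _).trans (hall _ _ e e' rfl rfl)).trans (hflip _ _ _ _ _)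

/-- Any two adjacent tiles have a common point off the legs. -/
lemma exists_common {k : Fin 5} (hk : k ≠ 0) (t : G.Tile) :
    ∃ p : T.poly t, k ∈ T.zeros t p ∧ 0 < lineForm (T.form t 0) p := by
  have hE := T.width_ge (G.edge t.1)
  have hM := T.sq_rad_pos (G.source t.1)
  have hM1 := T.sq_rad_lt_one (G.source t.1)
  rcases eq_or_ne k 4 with rfl | hk4
  · obtain ⟨h1, h2, h3⟩ := corner_mem_and_zero hE hM hM1 3
    exact ⟨⟨_, h1⟩, h3, lineForm_corner_pos hE hM hM1 (j := 0) (k := 3) (by decide) (by decide)⟩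
  · obtain ⟨h1, h2, h3⟩ := corner_mem_and_zero hE hM hM1 k
    exact ⟨⟨_, h1⟩, h2, lineForm_corner_pos hE hM hM1 hk.symm
      (by clear h1 h2 h3; revert k; decide)⟩

/-- Since links avoiding side 0 join all tiles, it suffices that two neighbours across any other
side share a point off their legs; a corner off the leg serves. -/
lemma isPreconnected_iUnion (hG : G.Connected) {A : G.Tile → Set T.Surface}
    (hA : ∀ t, IsPreconnected (A t))
    (hmem : ∀ t (p : T.poly t), 0 < lineForm (T.form t 0) p → T.pt t p ∈ A t) :
    IsPreconnected (⋃ t, A t) := by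
  refine IsPreconnected.iUnion_of_reflTransGen hA fun t t' => ?_
  refine (Relation.ReflTransGen.mono ?_ t t' (linked_of_connected (T := T) hG t t'))
  rintro s _ ⟨k, hk, rfl⟩
  obtain ⟨p, h1, h2⟩ := exists_common (T := T) (k := k) hk s
  refine ⟨T.pt s p, hmem s p h2, ?_⟩
  rw [pt_cross p h1]
  refine hmem _ _ ?_
  have h3 := T.mem_poly_cross p.2 h1 0
  refine lt_of_le_of_ne h3 fun h4 => ?_
  have h5 : (0 : Fin 5) ∈ T.zeros (T.cross k s) p := h4.symm
  rw [T.zeros_cross p.2 h1] at h5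
  exact h2.ne' h5

lemma isPreconnected_compl (hG : G.Connected) : IsPreconnected (T.graphSetᶜ : Set T.Surface) := by
  have h : (T.graphSetᶜ : Set T.Surface) = ⋃ t : G.Tile,
      T.pt t '' {p | t.2.2 = true → 0 < lineForm (T.form t 0) p} := by
    ext x
    obtain ⟨s, q, rfl⟩ := T.exists_pt x
    simp only [mem_iUnion]
    constructor
    · intro h
      rw [mem_compl_iff, pt_mem_graphSet, not_and] at h
      exact ⟨s, q, fun h1 => lt_of_le_of_ne (q.2 0) (Ne.symm (h h1)), rfl⟩
    · rintro ⟨t, p, hp, h⟩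
      rw [← h, mem_compl_iff, pt_mem_graphSet, not_and]
      exact fun h1 h2 => (hp h1).ne' h2
  rw [h]
  refine isPreconnected_iUnion hG (fun t => ?_) fun t p hp => ⟨p, fun _ => hp, rfl⟩
  refine IsPreconnected.image ?_ _ (T.continuous_pt t).continuousOn
  have hconv : Convex ℝ (T.poly t ∩ {p | t.2.2 = true → 0 < lineForm (T.form t 0) p}) := by
    refine (convex_pentagon _ _).inter ?_
    intro p hp q hq a b ha hb hab ht
    rw [lineForm_combo _ _ _ hab]
    have h1 := hp ht
    have h2 := hq ht
    rcases ha.eq_or_lt with rfl | ha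
    · rw [zero_add] at hab
      rw [hab]
      linarith
    · have := mul_pos ha h1
      have := mul_nonneg hb h2.le
      linarith
  have himg : Subtype.val '' {p : T.poly t | t.2.2 = true → 0 < lineForm (T.form t 0) p} =
      T.poly t ∩ {p | t.2.2 = true → 0 < lineForm (T.form t 0) p} :=
    Subtype.image_preimage_coe _ {p | t.2.2 = true → 0 < lineForm (T.form t 0) p}
  rw [← IsInducing.subtypeVal.isPreconnected_image, himg]
  exact hconv.isPreconnected

lemma connectedSpace (hG : G.Connected) : ConnectedSpace T.Surface := by
  have h : IsPreconnected (⋃ t : G.Tile, range (T.pt t)) := by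
    refine isPreconnected_iUnion hG (fun t => ?_) fun t p _ => ⟨p, rfl⟩
    have : PreconnectedSpace (T.poly t) :=
      isPreconnected_iff_preconnectedSpace.1 (convex_pentagon _ _).isPreconnected
    exact isPreconnected_range (T.continuous_pt t)
  have hu : (⋃ t : G.Tile, range (T.pt t)) = univ := eq_univ_of_forall fun x => by
    obtain ⟨t, p, rfl⟩ := T.exists_pt x
    exact mem_iUnion.2 ⟨t, p, rfl⟩
  rw [hu] at h
  obtain ⟨e⟩ := G.nonempty_dart
  obtain ⟨p, -⟩ := exists_common (T := T) (k := 1) (by decide) (e, true, true)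
  exact { isPreconnected_univ := h, toNonempty := ⟨T.pt _ p⟩ }

end FiniteGraph.TileSystem

/-! ### The isometric embedding of the metric graph -/

namespace UpperHalfPlane

lemma unklein_vertical {N : ℝ} (hN : 0 < N) :
    unklein ![0, N] = ⟨⟨0, Real.sqrt N⟩, Real.sqrt_pos.2 hN⟩ := by
  have h : 0 < (![0, N] : Fin 2 → ℝ) 1 - (![0, N] : Fin 2 → ℝ) 0 ^ 2 := by simpa using hN
  rw [unklein, dif_pos h]
  ext1
  simp

/-- The point at height `r * exp s` of the vertical geodesic. -/
noncomputable def vertical (r s : ℝ) : ℍ := unklein ![0, r ^ 2 * Real.exp (2 * s)]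

lemma coe_vertical {r : ℝ} (hr : 0 < r) (s : ℝ) :
    (vertical r s : ℂ) = ⟨0, r * Real.exp s⟩ := by
  have h : r ^ 2 * Real.exp (2 * s) = (r * Real.exp s) ^ 2 := by
    rw [mul_pow, ← Real.exp_nat_mul]
    norm_num
  rw [vertical, unklein_vertical (by positivity)]
  change (⟨0, Real.sqrt _⟩ : ℂ) = _
  rw [h, Real.sqrt_sq (by positivity)]

lemma dist_vertical {r : ℝ} (hr : 0 < r) (s s' : ℝ) :
    dist (vertical r s) (vertical r s') = |s - s'| := by
  have him : ∀ s, (vertical r s).im = r * Real.exp s := fun s =>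
    congrArg Complex.im (coe_vertical hr s)
  have hre : ∀ s, (vertical r s).re = 0 := fun s => congrArg Complex.re (coe_vertical hr s)
  rw [dist_of_re_eq ((hre s).trans (hre s').symm), him, him, Real.dist_eq,
    Real.log_mul hr.ne' (Real.exp_ne_zero _), Real.log_mul hr.ne' (Real.exp_ne_zero _),
    Real.log_exp, Real.log_exp]
  congr 1
  ring

lemma klein_vertical {r : ℝ} (hr : 0 < r) (s : ℝ) :
    klein (vertical r s) = ![0, r ^ 2 * Real.exp (2 * s)] :=
  klein_unklein (by simpa using by positivity)

/-- On the imaginary axis the reflection in `|z|² = E` sends height `y` to `E / y`. Beyond its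
midpoint an edge is therefore the leg of the reversed edge, read backwards and reflected. -/
lemma mirror_smul_vertical {E M r r' : ℝ} (hE : 0 < E) (hr : 0 < r) (hr' : 0 < r') {s s' : ℝ}
    (h : s + s' = Real.log E - Real.log r - Real.log r') :
    mirror (side E M 1) • vertical r' s' = vertical r s := by
  have h1 : (side E M 1) = (-1, 0, E) := rfl
  have hd : 0 < lineDisc (side E M 1) := by
    rw [h1, lineDisc]
    linarith
  have h2 : E = r * Real.exp s * (r' * Real.exp s') := by
    rw [← Real.exp_log hE, show Real.log E = Real.log r + s + (Real.log r' + s') by linarith,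
      Real.exp_add, Real.exp_add, Real.exp_add, Real.exp_log hr, Real.exp_log hr']
  ext1
  rw [coe_mirror_smul hd, coe_vertical hr, coe_vertical hr', h1]
  have h3 : r' * Real.exp s' ≠ 0 := by positivity
  have h4 : (-1 : ℂ) * (starRingEnd ℂ) ⟨0, r' * Real.exp s'⟩ ≠ 0 := by
    intro h
    have := congrArg Complex.im h
    simp at this
    exact hr'.ne' this
  simp only [zero_div, Complex.ofReal_zero, neg_zero, zero_mul, zero_sub, add_zero,
    Complex.ofReal_neg, Complex.ofReal_one]
  rw [div_eq_iff h4]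
  apply Complex.ext
  · simp
    linarith
  · simp

end UpperHalfPlane

namespace FiniteGraph.TileSystem

open UpperHalfPlane

variable {G : FiniteGraph.{0}} (T : G.TileSystem)

/-- The distance from the initial vertex of a directed edge to its midpoint. -/
noncomputable def half (e : G.Dart) : ℝ :=
  Real.log (T.width (G.edge e)) / 2 - Real.log (T.rad (G.source e))

lemma width_pos (e : G.Edge) : 0 < T.width e := by linarith [T.width_ge e]

lemma rad_mul_exp_half (e : G.Dart) :
    T.rad (G.source e) ^ 2 * Real.exp (2 * T.half e) = T.width (G.edge e) := by
  have hr := T.rad_pos (G.source e)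
  rw [half, mul_sub, Real.exp_sub, mul_div_cancel₀ _ two_ne_zero, Real.exp_log (T.width_pos _),
    two_mul, Real.exp_add, Real.exp_log hr]
  field_simp

lemma half_pos (e : G.Dart) : 0 < T.half e := by
  have h1 := Real.log_pos (show 1 < T.width (G.edge e) by linarith [T.width_ge (G.edge e)])
  have h2 := Real.log_neg (T.rad_pos (G.source e)) (T.rad_lt_one _)
  unfold half
  linarith

/-- The squared height on the leg of a directed edge, by arc length. -/
noncomputable def height (e : G.Dart) (s : ℝ) : ℝ :=
  -- Clamping the arc length to `[0, half e]` keeps the point in the tile and the path continuous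
  -- for every real `s`.
  T.rad (G.source e) ^ 2 * Real.exp (2 * max 0 (min (T.half e) s))

lemma height_bounds (e : G.Dart) (s : ℝ) :
    T.rad (G.source e) ^ 2 ≤ T.height e s ∧ T.height e s ≤ T.width (G.edge e) := by
  have hr := T.sq_rad_pos (G.source e)
  constructor
  · exact le_mul_of_one_le_right hr.le (Real.one_le_exp (by positivity))
  · rw [← T.rad_mul_exp_half e]
    unfold height
    gcongr
    exact max_le (T.half_pos e).le (min_le_left _ _)

lemma height_eq {e : G.Dart} {s : ℝ} (h0 : 0 ≤ s) (h1 : s ≤ T.half e) :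
    T.height e s = T.rad (G.source e) ^ 2 * Real.exp (2 * s) := by
  rw [height, min_eq_right h1, max_eq_right h0]

lemma vertical_mem {t : G.Tile} {N : ℝ} (h1 : T.rad (G.source t.1) ^ 2 ≤ N)
    (h2 : N ≤ T.width (G.edge t.1)) : ![0, N] ∈ T.poly t := by
  have h3 := T.sq_rad_pos (G.source t.1)
  have h4 := T.width_pos (G.edge t.1)
  refine mem_pentagon_iff.2 ⟨le_rfl, h2, ?_, ?_, ?_⟩ <;> simp <;> linarith

lemma zeros_vertical {t : G.Tile} {N : ℝ} (h1 : T.rad (G.source t.1) ^ 2 ≤ N) {k : Fin 5} :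
    k ∈ T.zeros t ![0, N] ↔
      k = 0 ∨ k = 1 ∧ N = T.width (G.edge t.1) ∨ k = 4 ∧ N = T.rad (G.source t.1) ^ 2 := by
  have h3 := T.sq_rad_pos (G.source t.1)
  have h4 := T.width_pos (G.edge t.1)
  obtain ⟨f0, f1, f2, f3, f4⟩ :=
    side_form (T.width (G.edge t.1)) (T.rad (G.source t.1) ^ 2) ![0, N]
  change lineForm (side _ _ k) _ = 0 ↔ _
  fin_cases k
  · exact iff_of_true f0 (Or.inl rfl)
  · change lineForm (side _ _ 1) _ = 0 ↔ _
    rw [f1, sub_eq_zero]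
    simp [eq_comm]
  · change lineForm (side _ _ 2) _ = 0 ↔ _
    rw [f2]
    simp
    linarith
  · change lineForm (side _ _ 3) _ = 0 ↔ _
    rw [f3]
    simp
    linarith
  · change lineForm (side _ _ 4) _ = 0 ↔ _
    rw [f4]
    simp [sub_eq_zero]

/-- The leg of a directed edge, by arc length. -/
noncomputable def leg (e : G.Dart) (s : ℝ) : T.Surface :=
  T.pt (e, true, true) ⟨![0, T.height e s], T.vertical_mem (t := (e, true, true))
    (T.height_bounds e s).1 (T.height_bounds e s).2⟩

lemma continuous_leg (e : G.Dart) : Continuous (T.leg e) := by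
  refine (T.continuous_pt _).comp (Continuous.subtype_mk ?_ _)
  refine continuous_pi fun i => ?_
  fin_cases i
  · exact continuous_const
  · change Continuous (T.height e)
    unfold height
    fun_prop

lemma leg_mem_graphSet (e : G.Dart) (s : ℝ) : T.leg e s ∈ T.graphSet :=
  pt_mem_graphSet.2 ⟨rfl, (T.zeros_vertical (T.height_bounds e s).1).2 (Or.inl rfl)⟩

lemma leg_zero {e e' : G.Dart} (h : G.source e = G.source e') : T.leg e 0 = T.leg e' 0 := by
  have h0 : ∀ e, T.height e 0 = T.rad (G.source e) ^ 2 := fun e => by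
    rw [T.height_eq le_rfl (T.half_pos e).le]
    simp
  refine T.pt_eq_iff.2 ⟨by simp only [h0, h], ?_⟩
  refine (linked_vertex_iff (T := T) (t := (e, true, true)) (t' := (e', true, true)) |>.2 ⟨h, rfl⟩).mono ?_
  rintro k (rfl | rfl)
  · exact (T.zeros_vertical (T.height_bounds e 0).1).2 (Or.inr (Or.inr ⟨rfl, h0 e⟩))
  · exact (T.zeros_vertical (T.height_bounds e 0).1).2 (Or.inl rfl)

lemma height_half (e : G.Dart) : T.height e (T.half e) = T.width (G.edge e) := by
  rw [T.height_eq (T.half_pos e).le le_rfl, rad_mul_exp_half]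

lemma leg_half (e : G.Dart) : T.leg e (T.half e) = T.leg (G.rev e) (T.half (G.rev e)) := by
  refine T.pt_eq_iff.2 ⟨by simp only [height_half, G.edge_rev], ?_⟩
  have h1 : 1 ∈ T.zeros (e, true, true) ![0, T.height e (T.half e)] :=
    (T.zeros_vertical (T.height_bounds e _).1).2 (Or.inr (Or.inl ⟨rfl, T.height_half e⟩))
  have h0 : 0 ∈ T.zeros (e, true, true) ![0, T.height e (T.half e)] :=
    (T.zeros_vertical (T.height_bounds e _).1).2 (Or.inl rfl)
  exact (Linked.cross h1 (e, true, true)).trans (Linked.cross h0 (G.rev e, false, true))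

/-- The height decides which sides pass through the point: besides the leg, side 1 at the midpoint,
side 4 at the vertex, and no other in between. The links available in each case give the three
alternatives. -/
lemma leg_inj {e e' : G.Dart} {s s' : ℝ} (h0 : 0 ≤ s) (h1 : s ≤ T.half e) (h0' : 0 ≤ s')
    (h1' : s' ≤ T.half e') (h : T.leg e s = T.leg e' s') :
    (e = e' ∧ s = s') ∨ (e' = G.rev e ∧ s = T.half e ∧ s' = T.half e') ∨
      (G.source e = G.source e' ∧ s = 0 ∧ s' = 0) := by
  obtain ⟨hN, hL⟩ := T.pt_eq_iff.1 h
  replace hN : T.height e s = T.height e' s' := congrFun hN 1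
  have hb := T.height_bounds e s
  have hlt : ∀ {a b : ℝ} {e : G.Dart}, T.rad (G.source e) ^ 2 * Real.exp (2 * a) =
      T.rad (G.source e) ^ 2 * Real.exp (2 * b) → a = b := by
    intro a b e h
    have := Real.exp_injective (mul_left_cancel₀ (T.sq_rad_pos (G.source e)).ne' h)
    linarith
  have hz : ∀ k, k ∈ T.zeros (e, true, true) ![0, T.height e s] → _ := fun k =>
    (T.zeros_vertical (t := (e, true, true)) hb.1).1
  by_cases hw : T.height e s = T.width (G.edge e)
  · have hs : s = T.half e := by
      refine hlt (e := e) ?_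
      rw [← T.height_eq h0 h1, hw, rad_mul_exp_half]
    have hed : e' = e ∨ e' = G.rev e := by
      have hM : T.height e s ≠ T.rad (G.source e) ^ 2 := by
        have := T.sq_rad_lt_one (G.source e)
        have := T.width_ge (G.edge e)
        rw [hw]
        linarith
      refine (hL.induct (P := fun t => t.1 = e ∨ t.1 = G.rev e) (Or.inl rfl) ?_)
      rintro t - ht k hk
      rcases hz k hk with rfl | ⟨rfl, -⟩ | ⟨-, h4⟩
      · exact ht
      · change G.rev t.1 = e ∨ G.rev t.1 = G.rev e
        rcases ht with ht | ht
        · exact Or.inr (by rw [ht])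
        · exact Or.inl (by rw [ht, G.rev_rev])
      · exact absurd h4 hM
    have hs' : s' = T.half e' := by
      refine hlt (e := e') ?_
      rw [← T.height_eq h0' h1', ← hN, hw, rad_mul_exp_half]
      rcases hed with rfl | rfl
      · rfl
      · rw [G.edge_rev]
    rcases hed with rfl | he
    · exact Or.inl ⟨rfl, hs.trans hs'.symm⟩
    · exact Or.inr (Or.inl ⟨he, hs, hs'⟩)
  · by_cases hM : T.height e s = T.rad (G.source e) ^ 2
    · right; right
      have hsrc : G.source e = G.source e' := by
        have h2 : T.Linked {4, 0} (e, true, true) (e', true, true) := by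
          refine hL.mono fun k hk => ?_
          rcases hz k hk with rfl | ⟨-, h4⟩ | ⟨rfl, -⟩
          · simp
          · exact absurd h4 hw
          · simp
        exact (linked_vertex_iff.1 h2).1
      refine ⟨hsrc, hlt (e := e) ?_, hlt (e := e') ?_⟩
      · rw [← T.height_eq h0 h1, hM]
        simp
      · rw [← T.height_eq h0' h1', ← hN, hM, hsrc]
        simp
    · left
      have he : e' = e := by
        refine (hL.induct (P := fun t => t.1 = e) rfl ?_)
        rintro t - ht k hk
        rcases hz k hk with rfl | ⟨-, h4⟩ | ⟨-, h4⟩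
        · exact ht
        · exact absurd h4 hw
        · exact absurd h4 hM
      subst he
      refine ⟨rfl, hlt (e := e') ?_⟩
      rw [← T.height_eq h0 h1, hN, ← T.height_eq h0' h1']

lemma exists_leg_eq {x : T.Surface} (hx : x ∈ T.graphSet) :
    ∃ e s, 0 ≤ s ∧ s ≤ T.half e ∧ T.leg e s = x := by
  obtain ⟨⟨e, a, ε⟩, ⟨p, hp⟩, rfl, rfl, h0⟩ := hx
  have hp0 : p = ![0, p 1] := by
    ext i
    fin_cases i
    · exact (side_form _ _ p).1.symm.trans h0
    · rfl
  obtain ⟨-, -, b1, b2, -⟩ :=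
    pentagon_bounds (T.width_ge _) (T.sq_rad_pos _) (T.sq_rad_lt_one _) hp
  have hM := T.sq_rad_pos (G.source e)
  have hs : T.rad (G.source e) ^ 2 * Real.exp (2 * (Real.log (p 1 / T.rad (G.source e) ^ 2) / 2)) =
      p 1 := by
    rw [mul_div_cancel₀ _ two_ne_zero, Real.exp_log (div_pos (hM.trans_le b1) hM)]
    exact mul_div_cancel₀ _ hM.ne'
  have hs0 : 0 ≤ Real.log (p 1 / T.rad (G.source e) ^ 2) / 2 :=
    div_nonneg (Real.log_nonneg ((one_le_div hM).2 b1)) zero_le_two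
  have hs1 : Real.log (p 1 / T.rad (G.source e) ^ 2) / 2 ≤ T.half e := by
    have h1 : T.rad (G.source e) ^ 2 *
        Real.exp (2 * (Real.log (p 1 / T.rad (G.source e) ^ 2) / 2)) ≤
        T.rad (G.source e) ^ 2 * Real.exp (2 * T.half e) := by
      rw [hs, rad_mul_exp_half]
      exact b2
    have := Real.exp_le_exp.1 (le_of_mul_le_mul_left h1 hM)
    linarith
  refine ⟨e, _, hs0, hs1, T.pt_eq_iff.2 ⟨?_, ?_⟩⟩
  · change ![0, T.height e _] = p
    rw [T.height_eq hs0 hs1, hs, ← hp0]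
  · have hz : (0 : Fin 5) ∈ T.zeros (e, true, true) ![0, T.height e (Real.log (p 1 / T.rad (G.source e) ^ 2) / 2)] :=
      (T.zeros_vertical (T.height_bounds e _).1).2 (Or.inl rfl)
    cases a
    · exact Linked.cross hz (e, true, true)
    · exact Linked.refl _ _

/-- The edge path on the surface. -/
noncomputable def path (e : G.Dart) (s : ℝ) : T.Surface :=
  if s ≤ T.half e then T.leg e s else T.leg (G.rev e) (T.half e + T.half (G.rev e) - s)

lemma continuous_path (e : G.Dart) : Continuous (T.path e) := by
  refine Continuous.if_le (T.continuous_leg e) ((T.continuous_leg _).comp (by fun_prop))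
    continuous_id continuous_const fun s hs => ?_
  rw [show s = T.half e from hs, leg_half, add_sub_cancel_left]

lemma path_of_le {e : G.Dart} {s : ℝ} (h : s ≤ T.half e) : T.path e s = T.leg e s := if_pos h

lemma path_rev (e : G.Dart) (s : ℝ) :
    T.path (G.rev e) (T.half e + T.half (G.rev e) - s) = T.path e s := by
  rcases lt_trichotomy s (T.half e) with h | h | h
  · rw [path, if_neg (by linarith), path, if_pos h.le, G.rev_rev]
    congr 1
    ring
  · rw [h, add_sub_cancel_left, path_of_le _ le_rfl, path_of_le _ le_rfl, ← leg_half]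
  · rw [path, if_pos (by linarith), path, if_neg (not_le.2 h)]

lemma path_mem_graphSet (e : G.Dart) (s : ℝ) : T.path e s ∈ T.graphSet := by
  unfold path
  split_ifs <;> exact T.leg_mem_graphSet _ _

lemma isGivenBy_leg {t : G.Tile} {p : Fin 2 → ℝ} {D : G.Tile → GL (Fin 2) ℝ}
    {φ : T.Surface → ℍ} (hD : T.IsGivenBy t p D φ) {e : G.Dart} {s : ℝ}
    (hp : p = ![0, T.height e s]) (ht : T.Linked (T.zeros t p) t (e, true, true)) :
    ∀ᶠ a in 𝓝 s, 0 ≤ a → a ≤ T.half e →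
      φ (T.leg e a) = D (e, true, true) • vertical (T.rad (G.source e)) a := by
  have hc : Continuous fun a => (![0, T.height e a] : Fin 2 → ℝ) := by
    refine continuous_pi fun i => ?_
    fin_cases i
    · exact continuous_const
    · change Continuous (T.height e)
      unfold height
      fun_prop
  have h1 := hD _ ht
  rw [hp] at h1
  filter_upwards [hc.continuousAt.eventually h1] with a ha h0 hle
  rw [leg, ha, vertical, T.height_eq h0 hle]

/-- Only the midpoint needs an argument, for there the path passes to the tile of the reversed edge.
The unfolding turns both halves into pieces of one vertical geodesic under one isometry. -/
lemma exists_chart_path {e : G.Dart} {s : ℝ} (h0 : 0 ≤ s) (h1 : s ≤ T.half e) :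
    ∃ φ ∈ atlas ℍ T.Surface, T.path e s ∈ φ.source ∧ ∃ g : GL (Fin 2) ℝ, ∀ᶠ a in 𝓝 s, 0 ≤ a →
      a ≤ T.half e + T.half (G.rev e) →
      φ (T.path e a) = g • vertical (T.rad (G.source e)) a := by
  obtain ⟨φ, hφ, hs⟩ := exists_mem_charts (T := T) (T.leg e s)
  obtain ⟨D, hD, hg⟩ := hφ _ _ hs
  refine ⟨φ, hφ, by rwa [T.path_of_le h1], D (e, true, true), ?_⟩
  have h2 := T.isGivenBy_leg hg rfl (Linked.refl _ _)
  rcases h1.lt_or_eq with h | rfl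
  · filter_upwards [h2, eventually_lt_nhds h] with a ha hlt h3 _
    rw [T.path_of_le hlt.le, ha h3 hlt.le]
  · have z1 : 1 ∈ T.zeros (e, true, true) ![0, T.height e (T.half e)] :=
      (T.zeros_vertical (T.height_bounds e _).1).2 (Or.inr (Or.inl ⟨rfl, T.height_half e⟩))
    have z0 : 0 ∈ T.zeros (e, true, true) ![0, T.height e (T.half e)] :=
      (T.zeros_vertical (T.height_bounds e _).1).2 (Or.inl rfl)
    have l1 := Linked.cross (T := T) z1 (e, true, true)
    have l2 := l1.trans (Linked.cross (T := T) z0 (G.rev e, false, true))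
    have h3 := T.isGivenBy_leg (e := G.rev e) (s := T.half (G.rev e)) hg
      (by simp only [height_half, G.edge_rev]) l2
    have hc : Filter.Tendsto (fun a => T.half e + T.half (G.rev e) - a) (𝓝 (T.half e))
        (𝓝 (T.half (G.rev e))) := by
      have : Continuous fun a => T.half e + T.half (G.rev e) - a := by fun_prop
      simpa using this.tendsto (T.half e)
    filter_upwards [h2, hc.eventually h3] with a ha hb c0 c1
    by_cases hle : a ≤ T.half e
    · rw [T.path_of_le hle, ha c0 hle]
    · rw [path, if_neg hle, hb (by linarith) (by linarith)]
      -- The new tile is reached by crossing side 1 and then side 0. The reflection in the leg fixes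
      -- the path, and the reflection in side 1 carries the reversed leg to the continuation of the
      -- first one.
      have e1 := hD.cross _ l1 0 z0 (vertical (T.rad (G.source (G.rev e)))
        (T.half e + T.half (G.rev e) - a))
      rw [show T.cross 0 (T.cross 1 (e, true, true)) = (G.rev e, true, true) from rfl] at e1
      have e0 : mirror (T.form (e, true, true) 0) • vertical (T.rad (G.source (G.rev e)))
          (T.half e + T.half (G.rev e) - a) = vertical (T.rad (G.source (G.rev e)))
          (T.half e + T.half (G.rev e) - a) := by
        refine mirror_smul_of_lineForm_eq_zero (T.disc_form_pos _ _) ?_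
        rw [klein_vertical (T.rad_pos _)]
        exact (side_form _ _ _).1
      have e2 : mirror (T.form (e, true, true) 1) • vertical (T.rad (G.source (G.rev e)))
          (T.half e + T.half (G.rev e) - a) = vertical (T.rad (G.source e)) a := by
        refine mirror_smul_vertical (T.width_pos _) (T.rad_pos _) (T.rad_pos _) ?_
        unfold half
        rw [G.edge_rev]
        ring
      rw [e1, e0, hD.cross _ (Linked.refl _ _) 1 z1, e2]

variable {T} {d : G.Edge → ℝ}

/-- The embedding of a metric graph. -/
noncomputable def embed (hd : ∀ e, d (G.edge e) = T.half e + T.half (G.rev e)) :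
    G.Realization d → T.Surface :=
  Quot.lift (fun x => T.path x.1 x.2) (by
    rintro _ _ (⟨e, s, s', h⟩ | ⟨e, e', s, s', h, hs, hs'⟩)
    · replace h := h.trans (hd e)
      change T.path e s = T.path (G.rev e) s'
      rw [← T.path_rev e s]
      congr 1
      linarith
    · change T.path e s = T.path e' s'
      rw [hs, hs', T.path_of_le (T.half_pos _).le, T.path_of_le (T.half_pos _).le]
      exact T.leg_zero h)

lemma embed_edgePath (hd : ∀ e, d (G.edge e) = T.half e + T.half (G.rev e)) (e : G.Dart)
    (s : Icc (0 : ℝ) (d (G.edge e))) : embed hd (G.edgePath d e s) = T.path e s := rfl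

lemma continuous_embed (hd : ∀ e, d (G.edge e) = T.half e + T.half (G.rev e)) :
    Continuous (embed hd) := by
  refine continuous_quot_lift _ (continuous_sigma fun e => ?_)
  exact (T.continuous_path e).comp continuous_subtype_val

/-- Every point of a metric graph lies on the first half of some directed edge. -/
lemma exists_edgePath (hd : ∀ e, d (G.edge e) = T.half e + T.half (G.rev e))
    (x : G.Realization d) : ∃ e s, G.edgePath d e s = x ∧ (s : ℝ) ≤ T.half e := by
  obtain ⟨⟨e, s⟩, rfl⟩ := Quot.exists_rep x
  rcases le_total (s : ℝ) (T.half e) with h | h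
  · exact ⟨e, s, rfl, h⟩
  · refine ⟨G.rev e, ⟨d (G.edge e) - s, by linarith [s.2.2], ?_⟩, ?_, ?_⟩
    · rw [G.edge_rev]
      linarith [s.2.1]
    · exact (Quot.sound (Glue.flip e s _ (by simp))).symm
    · change d (G.edge e) - s ≤ _
      linarith [hd e]

lemma injective_embed (hd : ∀ e, d (G.edge e) = T.half e + T.half (G.rev e)) :
    Function.Injective (embed hd) := by
  intro x y hxy
  obtain ⟨e, s, rfl, hs⟩ := exists_edgePath hd x
  obtain ⟨e', s', rfl, hs'⟩ := exists_edgePath hd y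
  rw [embed_edgePath, embed_edgePath, T.path_of_le hs, T.path_of_le hs'] at hxy
  rcases T.leg_inj s.2.1 hs s'.2.1 hs' hxy with ⟨rfl, h⟩ | ⟨rfl, h, h'⟩ | ⟨h, h0, h0'⟩
  · rw [Subtype.ext h]
  · exact Quot.sound (Glue.flip e s s' (by rw [h, h', ← hd]))
  · exact Quot.sound (Glue.vertex e e' s s' h h0 h0')

lemma range_embed (hd : ∀ e, d (G.edge e) = T.half e + T.half (G.rev e)) :
    range (embed hd) = T.graphSet := by
  apply Subset.antisymm
  · rintro _ ⟨x, rfl⟩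
    obtain ⟨e, s, rfl, -⟩ := exists_edgePath hd x
    exact T.path_mem_graphSet _ _
  · intro x hx
    obtain ⟨e, s, h0, h1, rfl⟩ := T.exists_leg_eq hx
    refine ⟨G.edgePath d e ⟨s, h0, ?_⟩, T.path_of_le h1⟩
    rw [hd]
    linarith [T.half_pos (G.rev e)]

/-- Points on the second half of an edge are handled by reversing it. -/
lemma exists_isometric_chart {e : G.Dart} {s : ℝ} (h0 : 0 ≤ s)
    (h1 : s ≤ T.half e + T.half (G.rev e)) :
    ∃ φ ∈ atlas ℍ T.Surface, T.path e s ∈ φ.source ∧ ∃ U ∈ 𝓝 s, ∀ a ∈ U, 0 ≤ a →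
      a ≤ T.half e + T.half (G.rev e) → ∀ b ∈ U, 0 ≤ b → b ≤ T.half e + T.half (G.rev e) →
      dist (φ (T.path e a)) (φ (T.path e b)) = |a - b| := by
  have key : ∀ {e : G.Dart} {s : ℝ}, 0 ≤ s → s ≤ T.half e →
      ∃ φ ∈ atlas ℍ T.Surface, T.path e s ∈ φ.source ∧ ∃ U ∈ 𝓝 s, ∀ a ∈ U, 0 ≤ a →
      a ≤ T.half e + T.half (G.rev e) → ∀ b ∈ U, 0 ≤ b → b ≤ T.half e + T.half (G.rev e) →
      dist (φ (T.path e a)) (φ (T.path e b)) = |a - b| := by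
    intro e s h0 h1
    obtain ⟨φ, hφ, hs, g, hg⟩ := T.exists_chart_path h0 h1
    refine ⟨φ, hφ, hs, _, hg, fun a ha a0 a1 b hb b0 b1 => ?_⟩
    rw [ha a0 a1, hb b0 b1, dist_gl_smul, dist_vertical (T.rad_pos _)]
  rcases le_total s (T.half e) with h | h
  · exact key h0 h
  · obtain ⟨φ, hφ, hs, U, hU, H⟩ := key (e := G.rev e)
      (s := T.half e + T.half (G.rev e) - s) (by linarith) (by linarith)
    rw [path_rev] at hs
    have hc : Continuous fun a => T.half e + T.half (G.rev e) - a := by fun_prop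
    rw [G.rev_rev] at H
    refine ⟨φ, hφ, hs, _, hc.continuousAt.preimage_mem_nhds hU, fun a ha a0 a1 b hb b0 b1 => ?_⟩
    have := H _ ha (by linarith) (by linarith) _ hb (by linarith) (by linarith)
    rw [path_rev, path_rev] at this
    rw [this, ← abs_neg]
    congr 1
    ring

lemma isIsometricEmbedding_embed (hd : ∀ e, d (G.edge e) = T.half e + T.half (G.rev e)) :
    IsIsometricEmbedding G d (embed hd) := by
  constructor
  · have : CompactSpace (G.Realization d) :=
      inferInstanceAs (CompactSpace (Quot (G.Glue d)))
    exact ((continuous_embed hd).isClosedEmbedding (injective_embed hd)).isEmbedding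
  · intro e s
    have hle : ∀ a : Icc (0 : ℝ) (d (G.edge e)), (a : ℝ) ≤ T.half e + T.half (G.rev e) :=
      fun a => a.2.2.trans (hd e).le
    obtain ⟨φ, hφ, hs, U, hU, H⟩ := exists_isometric_chart s.2.1 (hle s)
    refine ⟨φ, hφ, Subtype.val ⁻¹' U ∩ {a | T.path e a ∈ φ.source}, Filter.inter_mem
      (continuous_subtype_val.continuousAt.preimage_mem_nhds hU)
      (((T.continuous_path e).comp continuous_subtype_val).continuousAt.preimage_mem_nhds
        (φ.open_source.mem_nhds hs)), fun a ha => ha.2, fun a ha b hb => ?_⟩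
    exact H a ha.1 a.2.1 (hle a) b hb.1 b.2.1 (hle b)

end FiniteGraph.TileSystem

/-! ### Choice of the cyclic orders and of the tile parameters -/

lemma finRotate_modEq {n : ℕ} (i : Fin n) : ((finRotate n i : ℕ) : ℤ) ≡ (i : ℕ) + 1 [ZMOD n] := by
  cases n with
  | zero => exact i.elim0
  | succ n =>
    rw [finRotate_apply, ← Nat.cast_add_one, Int.natCast_modEq_iff, Fin.val_add]
    rcases n with - | n
    · exact Nat.modEq_one
    · exact Nat.mod_modEq _ _

/-- The number `m` is the positive root of `s * m² + 4 * c * m - s = 0`, with the square root moved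
to the denominator. -/
lemma exists_root {s c : ℝ} (hs : 0 < s) (hc : 0 < c) :
    ∃ m : ℝ, 0 < m ∧ m < 1 ∧ s * (1 - m ^ 2) = 4 * m * c := by
  set r := Real.sqrt (4 * c ^ 2 + s ^ 2) with hr
  have hr2 : r ^ 2 = 4 * c ^ 2 + s ^ 2 := Real.sq_sqrt (by positivity)
  have hrs : s ≤ r := Real.le_sqrt_of_sq_le (by nlinarith)
  have hD : 0 < 2 * c + r := by linarith
  refine ⟨s / (2 * c + r), div_pos hs hD, (div_lt_one hD).2 (by linarith), ?_⟩
  field_simp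
  linear_combination hr2

namespace FiniteGraph

/-- A cyclic order on the directed edges at each vertex. -/
lemma exists_cyclic_order (G : FiniteGraph.{u}) : ∃ (next : Equiv.Perm G.Dart) (pos : G.Dart → ℤ),
    (∀ e, G.source (next e) = G.source e) ∧
    (∀ e, pos (next e) ≡ pos e + 1 [ZMOD G.degree (G.source e)]) ∧
    ∀ e e', G.source e = G.source e' → pos e ≡ pos e' [ZMOD G.degree (G.source e)] → e = e' := by
  let q : ∀ v : G.Vertex, {e : G.Dart // G.source e = v} ≃ Fin (G.degree v) := fun v =>
    Finite.equivFin _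
  let next : Equiv.Perm G.Dart := (Equiv.sigmaFiberEquiv G.source).permCongr
    (Equiv.sigmaCongrRight fun v => ((q v).trans (finRotate _)).trans (q v).symm)
  let pos : G.Dart → ℤ := fun e => (q (G.source e) ⟨e, rfl⟩ : ℕ)
  have hnext : ∀ e, next e = (q (G.source e)).symm (finRotate _ (q (G.source e) ⟨e, rfl⟩)) :=
    fun e => rfl
  have hpos : ∀ v (x : {e : G.Dart // G.source e = v}), pos x = (q v x : ℕ) := by
    rintro _ ⟨e, rfl⟩
    rfl
  refine ⟨next, pos, fun e => ?_, fun e => ?_, fun e e' h hp => ?_⟩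
  · rw [hnext]
    exact ((q (G.source e)).symm _).2
  · rw [hnext, hpos, Equiv.apply_symm_apply]
    exact finRotate_modEq _
  · have h1 := hpos _ ⟨e, rfl⟩
    have h2 := hpos _ ⟨e', h.symm⟩
    dsimp only at h1 h2
    rw [h1, h2, Int.natCast_modEq_iff] at hp
    have h3 := (q (G.source e)).injective
      (Fin.ext (hp.eq_of_lt_of_lt (Fin.is_lt _) (Fin.is_lt _)))
    exact congrArg Subtype.val h3

/-- The degree fixes `m` at each vertex. The length of an edge then prescribes `log E = t * d + log
m + log m'`, and since there are finitely many edges, a large `t` gives `E ≥ 100` for all of them.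
-/
lemma exists_tileSystem (G : FiniteGraph.{0}) (hdeg : ∀ v : G.Vertex, 3 ≤ G.degree v)
    (d : G.Edge → ℝ) (hd : ∀ e, 0 < d e) :
    ∃ t : ℝ, 0 < t ∧ ∃ T : G.TileSystem, ∀ e, t * d (G.edge e) = T.half e + T.half (G.rev e) := by
  obtain ⟨next, pos, h1, h2, h3⟩ := G.exists_cyclic_order
  have hrad : ∀ v : G.Vertex, ∃ m : ℝ, 0 < m ∧ m < 1 ∧
      Real.sin (Real.pi / G.degree v) * (1 - m ^ 2) =
        4 * m * Real.cos (Real.pi / G.degree v) := by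
    intro v
    have hn : (3 : ℝ) ≤ G.degree v := by exact_mod_cast hdeg v
    have hpi := Real.pi_pos
    have hle : Real.pi / G.degree v ≤ Real.pi / 3 :=
      div_le_div_of_nonneg_left hpi.le (by norm_num) hn
    have hpos : 0 < Real.pi / G.degree v := div_pos hpi (by linarith)
    exact exists_root (Real.sin_pos_of_pos_of_lt_pi hpos (by linarith))
      (Real.cos_pos_of_mem_Ioo ⟨by linarith, by linarith⟩)
  choose rad r1 r2 r3 using hrad
  -- The sum is symmetric under reversal, so the chosen representative of the edge does not matter
  -- (`hC`).
  let C : G.Edge → ℝ := fun E => Real.log (rad (G.source E.out)) +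
    Real.log (rad (G.source (G.rev E.out)))
  obtain ⟨t₀, ht₀⟩ := Finite.exists_le fun E => (Real.log 100 - C E) / d E
  have hwidth : ∀ E, 100 ≤ Real.exp (max 1 t₀ * d E + C E) := by
    intro E
    rw [← Real.log_le_iff_le_exp (by norm_num)]
    have := (div_le_iff₀ (hd E)).1 ((ht₀ E).trans (le_max_right 1 t₀))
    linarith
  refine ⟨max 1 t₀, lt_max_of_lt_left one_pos, ⟨next, pos, h1, h2, h3, hdeg, rad, r1, r2, r3,
    fun E => Real.exp (max 1 t₀ * d E + C E), hwidth⟩, fun e => ?_⟩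
  have hC : C (G.edge e) = Real.log (rad (G.source e)) + Real.log (rad (G.source (G.rev e))) := by
    rcases (G.edge_eq_iff (e := (G.edge e).out) (e' := e)).1 (Quotient.out_eq _) with h | h
    · simp only [C]
      rw [← h]
    · have h' : (G.edge e).out = G.rev e := by rw [h, G.rev_rev, ← h]
      simp only [C]
      rw [h', G.rev_rev, add_comm]
  simp only [TileSystem.half, G.edge_rev, Real.log_exp, hC]
  ring

/-! ### Maps of graphs -/

lemma edgePath_congr (G : FiniteGraph.{u}) (d : G.Edge → ℝ) {e e' : G.Dart} (h : e = e')
    {s : Icc (0 : ℝ) (d (G.edge e))} {s' : Icc (0 : ℝ) (d (G.edge e'))} (hs : (s : ℝ) = s') :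
    G.edgePath d e s = G.edgePath d e' s' := by
  subst h
  rw [Subtype.ext hs]

universe v

/-- The map of metric graphs induced by a map of directed edges. -/
def realizationMap {G : FiniteGraph.{u}} {H : FiniteGraph.{v}} {d : G.Edge → ℝ} {d' : H.Edge → ℝ}
    (σ : G.Dart → H.Dart) (hrev : ∀ e, σ (G.rev e) = H.rev (σ e))
    (hsource : ∀ e e', G.source e = G.source e' → H.source (σ e) = H.source (σ e'))
    (hd : ∀ e, d' (H.edge (σ e)) = d (G.edge e)) (x : G.Realization d) : H.Realization d' :=
  Quot.lift (fun x : (Σ e : G.Dart, Icc (0 : ℝ) (d (G.edge e))) =>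
    H.edgePath d' (σ x.1) ⟨x.2, x.2.2.1, x.2.2.2.trans (hd x.1).ge⟩) (by
    rintro _ _ (⟨e, s, s', h⟩ | ⟨e, e', s, s', h, hs, hs'⟩)
    · refine (Quot.sound (Glue.flip (σ e) _ ⟨s', s'.2.1, ?_⟩ (h.trans (hd e).symm))).trans
        (H.edgePath_congr d' (hrev e).symm rfl)
      rw [H.edge_rev, hd e]
      exact s'.2.2.trans (congrArg d (G.edge_rev e)).le
    · exact Quot.sound (Glue.vertex _ _ _ _ (hsource e e' h) hs hs')) x

lemma continuous_realizationMap {G : FiniteGraph.{u}} {H : FiniteGraph.{v}} {d : G.Edge → ℝ}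
    {d' : H.Edge → ℝ} (σ : G.Dart → H.Dart) (hrev : ∀ e, σ (G.rev e) = H.rev (σ e))
    (hsource : ∀ e e', G.source e = G.source e' → H.source (σ e) = H.source (σ e'))
    (hd : ∀ e, d' (H.edge (σ e)) = d (G.edge e)) :
    Continuous (realizationMap σ hrev hsource hd) := by
  refine continuous_quot_lift _ (continuous_sigma fun e => ?_)
  have h : Continuous fun s : Icc (0 : ℝ) (d' (H.edge (σ e))) => H.edgePath d' (σ e) s :=
    continuous_quot_mk.comp continuous_sigmaMk
  have h' : Continuous fun s : Icc (0 : ℝ) (d (G.edge e)) =>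
      (⟨s, s.2.1, s.2.2.trans (hd e).ge⟩ : Icc (0 : ℝ) (d' (H.edge (σ e)))) :=
    continuous_subtype_val.subtype_mk _
  exact h.comp h'

/-- The graph obtained by renaming the directed edges. -/
def relabel (G : FiniteGraph.{u}) {D : Type v} (σ : D ≃ G.Dart) : FiniteGraph.{v} where
  Dart := D
  finite_dart := Finite.of_equiv _ σ.symm
  nonempty_dart := G.nonempty_dart.map σ.symm
  rev e := σ.symm (G.rev (σ e))
  rev_rev e := by rw [σ.apply_symm_apply, G.rev_rev, σ.symm_apply_apply]
  rev_ne e h := G.rev_ne (σ e) (by rw [← σ.symm_apply_eq, h])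
  sameSource := G.sameSource.comap σ

section

variable (G : FiniteGraph.{u}) {D : Type v} (σ : D ≃ G.Dart)

/-- Renaming does not change the vertices. -/
def vertexEquiv : (G.relabel σ).Vertex ≃ G.Vertex := Quotient.congr σ fun _ _ => Iff.rfl

/-- Renaming does not change the edges. -/
def edgeEquiv : (G.relabel σ).Edge ≃ G.Edge := Quotient.congr σ fun _ _ =>
  or_congr σ.apply_eq_iff_eq.symm σ.eq_symm_apply

lemma degree_relabel (v : (G.relabel σ).Vertex) :
    (G.relabel σ).degree v = G.degree (G.vertexEquiv σ v) :=
  Nat.card_congr (Equiv.subtypeEquiv σ fun _ => ((G.vertexEquiv σ).apply_eq_iff_eq).symm)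

lemma connected_relabel (hG : G.Connected) : (G.relabel σ).Connected := by
  intro v w
  have h := Relation.ReflTransGen.lift (p := fun a b => ∃ e : (G.relabel σ).Dart,
    (G.relabel σ).source e = a ∧ (G.relabel σ).source ((G.relabel σ).rev e) = b)
    (G.vertexEquiv σ).symm ?_ _ _ (hG (G.vertexEquiv σ v) (G.vertexEquiv σ w))
  · rwa [Function.onFun, Equiv.symm_apply_apply, Equiv.symm_apply_apply] at h
  · rintro a b ⟨e, rfl, rfl⟩
    refine ⟨σ.symm e, (Equiv.eq_symm_apply _).2 ?_, (Equiv.eq_symm_apply _).2 ?_⟩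
    · exact congrArg G.source (σ.apply_symm_apply e)
    · change G.source (σ (σ.symm (G.rev (σ (σ.symm e))))) = _
      rw [σ.apply_symm_apply, σ.apply_symm_apply]

end

end FiniteGraph

lemma IsGeodesicSegment.congr_length {S : Type u} [TopologicalSpace S] [ChartedSpace ℍ S]
    {L L' : ℝ} {γ : Icc (0 : ℝ) L → S} (hγ : IsGeodesicSegment γ) (h : L' = L) :
    IsGeodesicSegment fun s : Icc (0 : ℝ) L' => γ ⟨s, s.2.1, s.2.2.trans h.le⟩ := by
  subst h
  exact hγ

namespace FiniteGraph

lemma exists_isIsometricEmbedding_of_relabel (G : FiniteGraph.{u}) {D : Type*} (σ : D ≃ G.Dart)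
    (d : G.Edge → ℝ) {S : Type*} [TopologicalSpace S] [T2Space S] [ChartedSpace ℍ S]
    {Φ : (G.relabel σ).Realization (fun E => d (G.edgeEquiv σ E)) → S}
    (hΦ : IsIsometricEmbedding (G.relabel σ) _ Φ) :
    ∃ Ψ : G.Realization d → S, IsIsometricEmbedding G d Ψ ∧ range Ψ = range Φ := by
  have hlen : ∀ e, d (G.edgeEquiv σ ((G.relabel σ).edge (σ.symm e))) = d (G.edge e) := fun e =>
    congrArg (fun e => d (G.edge e)) (σ.apply_symm_apply e)
  let f : G.Realization d → (G.relabel σ).Realization (fun E => d (G.edgeEquiv σ E)) :=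
    realizationMap (H := G.relabel σ) σ.symm (fun e => by
      change _ = σ.symm (G.rev (σ (σ.symm e)))
      rw [σ.apply_symm_apply]) (fun e e' h => by
      refine (G.vertexEquiv σ).injective ?_
      change G.source (σ (σ.symm e)) = G.source (σ (σ.symm e'))
      rwa [σ.apply_symm_apply, σ.apply_symm_apply]) hlen
  let f' : (G.relabel σ).Realization (fun E => d (G.edgeEquiv σ E)) → G.Realization d :=
    realizationMap (G := G.relabel σ) σ (fun e => σ.apply_symm_apply _)
      (fun e e' h => congrArg (G.vertexEquiv σ) h) fun e => rfl
  have hf : Continuous f := continuous_realizationMap _ _ _ _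
  have hinv : Function.LeftInverse f' f := by
    intro x
    obtain ⟨⟨e, s⟩, rfl⟩ := Quot.exists_rep x
    exact G.edgePath_congr d (σ.apply_symm_apply e) rfl
  have hinv' : Function.RightInverse f' f := by
    intro x
    obtain ⟨⟨e, s⟩, rfl⟩ := Quot.exists_rep x
    exact (G.relabel σ).edgePath_congr _ (σ.symm_apply_apply e) rfl
  refine ⟨Φ ∘ f, ⟨?_, fun e => ?_⟩, hinv'.surjective.range_comp Φ⟩
  · have : CompactSpace (G.Realization d) := inferInstanceAs (CompactSpace (Quot (G.Glue d)))
    exact ((hΦ.isEmbedding.continuous.comp hf).isClosedEmbedding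
      (hΦ.isEmbedding.injective.comp hinv.injective)).isEmbedding
  · exact (hΦ.isGeodesicSegment (σ.symm e)).congr_length (hlen e).symm

/-! ### Sign of the Euler characteristic and conclusion -/

/-- Vertices are classes of darts, and every edge has two darts. -/
lemma card_vertex_lt (G : FiniteGraph.{0}) :
    (Nat.card G.Vertex : ℤ) ≤ 2 * Nat.card G.Edge ∧ 1 ≤ (Nat.card G.Edge : ℤ) := by
  have h1 : Nat.card G.Vertex ≤ Nat.card G.Dart :=
    Nat.card_le_card_of_surjective G.source Quotient.mk_surjective
  have h2 : 0 < Nat.card G.Edge := by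
    have : Nonempty G.Edge := G.nonempty_dart.map G.edge
    exact Nat.card_pos
  rw [TileSystem.card_dart] at h1
  omega

end FiniteGraph

theorem theorem1p1 (G : FiniteGraph.{u}) (hG : G.Connected)
    (hdeg : ∀ v : G.Vertex, 3 ≤ G.degree v)
    (d : G.Edge → ℝ) (hd : ∀ e, 0 < d e) :
    ∃ (g : ℕ) (S : Type) (_ : TopologicalSpace S) (_ : ChartedSpace ℍ S),
      (g : ℤ) = (Nat.card G.Edge : ℤ) + G.betti ∧
      ClosedHyperbolicSurface S ∧ HasGenus S g ∧
      ∃ t : ℝ, 0 < t ∧ ∃ Φ : G.Realization (fun e => t * d e) → S,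
        IsIsometricEmbedding G (fun e => t * d e) Φ ∧ IsEssential (range Φ) := by
  -- The tiles are indexed by darts and the surface has to live in `Type`, so the darts are first
  -- renamed by a finite ordinal.
  let σ : Fin (Nat.card G.Dart) ≃ G.Dart := (Finite.equivFin G.Dart).symm
  obtain ⟨t, ht, T, hT⟩ := FiniteGraph.exists_tileSystem (G.relabel σ)
    (fun v => (hdeg _).trans (G.degree_relabel σ v).ge) (fun E => d (G.edgeEquiv σ E))
    fun E => hd _
  have hG' := G.connected_relabel σ hG
  have hV : Nat.card (G.relabel σ).Vertex = Nat.card G.Vertex := Nat.card_congr (G.vertexEquiv σ)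
  have hE : Nat.card (G.relabel σ).Edge = Nat.card G.Edge := Nat.card_congr (G.edgeEquiv σ)
  have hcard := (G.relabel σ).card_vertex_lt
  have hsurface := FiniteGraph.TileSystem.hasEulerChar_surface (T := T)
  have hcompl := FiniteGraph.TileSystem.hasEulerChar_compl (T := T)
  rw [hV, hE] at hcard hsurface hcompl
  have hg : (((Nat.card G.Edge : ℤ) + G.betti).toNat : ℤ) = (Nat.card G.Edge : ℤ) + G.betti := by
    refine Int.toNat_of_nonneg ?_
    unfold FiniteGraph.betti
    omega
  obtain ⟨Φ, hΦ, hrange⟩ := G.exists_isIsometricEmbedding_of_relabel σ (fun e => t * d e)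
    (FiniteGraph.TileSystem.isIsometricEmbedding_embed (T := T) hT)
  refine ⟨_, T.Surface, inferInstance, inferInstance, hg, ⟨inferInstance, inferInstance,
    FiniteGraph.TileSystem.connectedSpace hG', inferInstance⟩, ?_, t, ht, Φ, hΦ, ?_⟩
  · rw [HasGenus, hg]
    convert hsurface using 1
    unfold FiniteGraph.betti
    ring
  · rw [hrange, FiniteGraph.TileSystem.range_embed]
    intro x hx
    -- The complement is connected, so each component in question is the whole complement; its Euler
    -- characteristic `|V| - 3|E|` is at most `-|E|`.
    refine ⟨_, ?_, (FiniteGraph.TileSystem.isPreconnected_compl hG').connectedComponentIn hx ▸ hcompl⟩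
    omega
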